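/- **Setting.** Let $G\rightrightarrows M$ be a Lie groupoid (Hausdorff, second countable), $\dim M=n$, $\dim G=n+m$, with target $r$ and source $s$; a product $gh$ is defined when $s(g)=r(h)$. Let $\mathcal G\to M$ be its Lie algebroid, with fibres $\mathcal G_x=\ker (dr)_{1_x}$, anchor $ds$, and the bracket of left-invariant vector fields. Fix a smooth positive density $\mu$ on the fibres of $\mathcal G$, and let $\lambda=(\lambda^x)_{x\in M}$ be the associated left Haar system: $\lambda^x$ is the measure on $r^{-1}(x)$ given by the left-equivariant density that equals $\mu$ at the units. **Tangent groupoid.** $\tilde G=G\times\mathbb R^*\,\cup\,\mathcal G\times\{0\}$, with the smooth structure for which $G\times\mathbb R^*$ is open with its product structure and for which $$(u,v,t)\mapsto\begin{cases}(\psi(u,tv),t)& t\ne0\\ (\theta(u,v),0)& t=0\end{cases}\qquad (u\in U,\ tv\in V),\qquad \theta(u,v)=\Bigl(\varphi(u),\tfrac{\partial\psi}{\partial v}(u,0)v\Bigr),$$ is a chart whenever $\psi:U\times V\to G$ and $\varphi:U\to M$ are charts ($U\subset\mathbb R^n$, $0\in V\subset\mathbb R^m$ open) with $r(\psi(u,v))=\varphi(u)$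 and $\psi(U\times\{0\})=\psi(U\times V)\cap G^{(0)}$. On $C_c^\infty(\tilde G)$ (complex-valued functions) convolution is $$(f*g)(\gamma,t)=|t|^{-m}\!\int f(\eta,t)\,g(\eta^{-1}\gamma,t)\,d\lambda^{r(\gamma)}(\eta)\quad(t\neq0),$$ $$(f*g)(x,X,0)=\int_{\mathcal G_x} f(x,Y,0)\,g(x,X-Y,0)\,d\mu_x(Y),$$ and $[f,g]=f*g-g*f$. **Poisson bracket.** $\mathcal G^*$ carries its canonical Poisson bracket: for coordinates $x_j$ on $M$, a local frame $(e_i)$ of $\mathcal G$ with $ds(e_i)=\sum_j a_{ij}\partial/\partial x_j$ and $[e_i,e_j]=\sum_k c_{ijk}e_k$, and the corresponding fibre coordinates $\eta_i$ on $\mathcal G^*$, $$\{F,H\}=\sum_{i,j}a_{ij}\Bigl(\frac{\partial F}{\partial\eta_i}\frac{\partial H}{\partial x_j}-\frac{\partial H}{\partial\eta_i}\frac{\partial F}{\partial x_j}\Bigr)+\sum_{i,j,k}c_{ijk}\,\eta_k\frac{\partial F}{\partial\eta_i}\frac{\partial H}{\partial\eta_j}.$$ It is transported to functions of Schwartz type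 on $\mathcal G$ by $\{f,g\}=\mathcal F^{-1}(\{\mathcal Ff,\mathcal Fg\})$, where $(\mathcal Ff)(x,\alpha)=\int_{\mathcal G_x}e^{2\pi i\alpha(Y)}f(x,Y)\,d\mu_x(Y)$ and $\mathcal F^{-1}$ is the inverse Fourier transform, an integral over $\mathcal G_x^*$ with respect to the dual density. **Lemma.** Let $f,g\in C_c^\infty(\tilde G)$ and let $f_0,g_0$ be their restrictions to $\mathcal G=\tilde G(0)$. Then $$\frac{\partial}{\partial t}[f,g]\Big|_{t=0}=\frac1{2\pi i}\{f_0,g_0\}.$$ That is: at every point $(X,0)$ with $X\in\mathcal G$, the function $[f,g]$ is differentiable and its differential is $\frac1{2\pi i}\{f_0,g_0\}(X)\,dt$; in particular its derivative along any tangent vector $\partial/\partial t$ at $(X,0)$ with $dt(\partial/\partial t)=1$ is $\frac1{2\pi i}\{f_0,g_0\}(X)$. -/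

import Mathlib

open scoped Manifold ContDiff Topology
open MeasureTheory

noncomputable section

/-- Euclidean space of dimension `k`. -/
abbrev Eu (k : ℕ) : Type := EuclideanSpace ℝ (Fin k)

/-- The `i`-th vector of the canonical basis of `ℝ^k`. -/
def stdVec {k : ℕ} (i : Fin k) : Eu k := EuclideanSpace.single i (1 : ℝ)

/-- Local normal form of a submersion with a section (a consequence of the inverse function
theorem). -/
theorem exists_straightening {n m : ℕ} {ρ : Eu (n + m) → Eu n} {ι : Eu n → Eu (n + m)}
    {O : Set (Eu (n + m))} {W : Set (Eu n)} (hO : IsOpen O) (hW : IsOpen W)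
    (hρ : ContDiffOn ℝ ∞ ρ O) (hι : ContDiffOn ℝ ∞ ι W) (hOW : Set.MapsTo ρ O W)
    (hρι : ∀ u ∈ W, ρ (ι u) = u) {u₀ : Eu n} (hu₀ : u₀ ∈ W) (hy₀ : ι u₀ ∈ O) :
    ∃ (L : Eu (n + m) →L[ℝ] Eu m) (Ψ : OpenPartialHomeomorph (Eu (n + m)) (Eu n × Eu m)),
      ι u₀ ∈ Ψ.source ∧ Ψ.source ⊆ O ∧ ContDiffOn ℝ ∞ Ψ Ψ.source ∧
      ContDiffOn ℝ ∞ Ψ.symm Ψ.target ∧ ∀ y, Ψ y = (ρ y, L (y - ι (ρ y))) := by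
  have hρ0 : HasFDerivAt ρ (fderiv ℝ ρ (ι u₀)) (ι u₀) :=
    ((hρ.contDiffAt (hO.mem_nhds hy₀)).differentiableAt (by simp)).hasFDerivAt
  have hι0 : HasFDerivAt ι (fderiv ℝ ι u₀) u₀ :=
    ((hι.contDiffAt (hW.mem_nhds hu₀)).differentiableAt (by simp)).hasFDerivAt
  set R := fderiv ℝ ρ (ι u₀) with hR
  set J := fderiv ℝ ι u₀ with hJ
  have hRJ : R.comp J = ContinuousLinearMap.id ℝ _ := by
    have h1 : HasFDerivAt (ρ ∘ ι) (R.comp J) u₀ := hρ0.comp u₀ hι0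
    have h2 : HasFDerivAt (ρ ∘ ι) (ContinuousLinearMap.id ℝ _) u₀ :=
      (hasFDerivAt_id u₀).congr_of_eventuallyEq
        (Filter.eventually_of_mem (hW.mem_nhds hu₀) hρι)
    exact h1.unique h2
  have hRs : Function.Surjective R := fun z => ⟨J z, by
    simpa using congrArg (fun T => T z) hRJ⟩
  have hK : Module.finrank ℝ (LinearMap.ker R.toLinearMap) = Module.finrank ℝ (Eu m) := by
    have h := R.toLinearMap.finrank_range_add_finrank_ker
    rw [LinearMap.range_eq_top.2 hRs, finrank_top] at h
    simp only [finrank_euclideanSpace, Fintype.card_fin] at h ⊢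
    omega
  let ε := LinearEquiv.ofFinrankEq _ _ hK
  obtain ⟨L', hL'⟩ := LinearMap.exists_extend ε.toLinearMap
  let L : Eu (n + m) →L[ℝ] Eu m := LinearMap.toContinuousLinearMap L'
  have hLK : ∀ z, R z = 0 → L z = 0 → z = 0 := by
    intro z hz hLz
    have h1 := congrArg (fun T => T (⟨z, hz⟩ : LinearMap.ker R.toLinearMap)) hL'
    have h2 : ε ⟨z, hz⟩ = 0 := by
      have h3 : L' z = 0 := hLz
      simpa [h3] using h1.symm
    have h3 := (LinearEquiv.map_eq_zero_iff ε).1 h2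
    exact congrArg Subtype.val h3
  let Φ : Eu (n + m) → Eu n × Eu m := fun y => (ρ y, L (y - ι (ρ y)))
  have hΦ : ContDiffOn ℝ ∞ Φ O :=
    hρ.prodMk (L.contDiff.comp_contDiffOn (contDiffOn_id.sub (hι.comp hρ hOW)))
  have hρy : ρ (ι u₀) = u₀ := hρι _ hu₀
  have hΦ0 : HasFDerivAt Φ (R.prod (L.comp (ContinuousLinearMap.id ℝ _ - J.comp R))) (ι u₀) := by
    have h1 : HasFDerivAt (ι ∘ ρ) (J.comp R) (ι u₀) :=
      HasFDerivAt.comp (ι u₀) (by rw [hρy]; exact hι0) hρ0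
    exact hρ0.prodMk (L.hasFDerivAt.comp (ι u₀) ((hasFDerivAt_id (ι u₀)).sub h1))
  have hinj : Function.Injective
      (R.prod (L.comp (ContinuousLinearMap.id ℝ _ - J.comp R))).toLinearMap := by
    rw [← LinearMap.ker_eq_bot, LinearMap.ker_eq_bot']
    intro z hz
    have hz1 : R z = 0 := congrArg Prod.fst hz
    have hz2 : L (z - J (R z)) = 0 := congrArg Prod.snd hz
    rw [hz1, map_zero, sub_zero] at hz2
    exact hLK z hz1 hz2
  let T : Eu (n + m) ≃L[ℝ] (Eu n × Eu m) :=
    (LinearEquiv.ofInjectiveOfFinrankEq _ hinj (by simp)).toContinuousLinearEquiv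
  have hT : (T : Eu (n + m) →L[ℝ] (Eu n × Eu m)) =
      R.prod (L.comp (ContinuousLinearMap.id ℝ _ - J.comp R)) := by
    ext z : 1; rfl
  have hc0 : ContDiffAt ℝ ∞ Φ (ι u₀) := hΦ.contDiffAt (hO.mem_nhds hy₀)
  have hT0 : HasFDerivAt Φ (T : Eu (n + m) →L[ℝ] (Eu n × Eu m)) (ι u₀) := by rw [hT]; exact hΦ0
  let Ψ₀ := hc0.toOpenPartialHomeomorph Φ hT0 (by simp)
  have hinv : IsOpen (O ∩ (fderiv ℝ Φ) ⁻¹'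
      Set.range ((↑) : (Eu (n + m) ≃L[ℝ] (Eu n × Eu m)) → _)) :=
    (hΦ.continuousOn_fderiv_of_isOpen hO (by simp)).isOpen_inter_preimage hO
      (ContinuousLinearEquiv.isOpen (𝕜 := ℝ))
  let Ψ := Ψ₀.restrOpen _ hinv
  have hΨs : Ψ.source = Ψ₀.source ∩ (O ∩ (fderiv ℝ Φ) ⁻¹'
      Set.range ((↑) : (Eu (n + m) ≃L[ℝ] (Eu n × Eu m)) → _)) := Ψ₀.restrOpen_source _ _
  refine ⟨L, Ψ, ?_, ?_, ?_, ?_, fun y => rfl⟩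
  · rw [hΨs]
    exact ⟨hc0.mem_toOpenPartialHomeomorph_source hT0 (by simp), hy₀, T, hT0.fderiv.symm⟩
  · rw [hΨs]; exact fun y hy => hy.2.1
  · rw [hΨs]; exact hΦ.mono (fun y hy => hy.2.1)
  · intro a ha
    have h := Ψ.map_target ha
    rw [hΨs] at h
    obtain ⟨S, hS⟩ := h.2.2
    have hcd : ContDiffAt ℝ ∞ Φ (Ψ.symm a) := hΦ.contDiffAt (hO.mem_nhds h.2.1)
    refine (Ψ.contDiffAt_symm ha (f₀' := S) ?_ hcd).contDiffWithinAt
    rw [hS]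
    exact (hcd.differentiableAt (by simp)).hasFDerivAt

/-! ### Lie groupoids -/

/-- A Lie groupoid `G ⇉ M` with `dim G = n + m`, `dim M = n`; `r` is the target map and `s` the
source map. The product `mul g h` is meaningful when `s g = r h`; its values at other pairs are
irrelevant, and smoothness is required on the submanifold of composable pairs. -/
structure LieGroupoid (n m : ℕ) (G M : Type*)
    [TopologicalSpace G] [ChartedSpace (Eu (n + m)) G]
    [TopologicalSpace M] [ChartedSpace (Eu n) M] where
  r : G → M
  s : G → M
  unit : M → G
  mul : G → G → G
  inv : G → G
  r_unit : ∀ x, r (unit x) = x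
  s_unit : ∀ x, s (unit x) = x
  r_mul : ∀ g h, s g = r h → r (mul g h) = r g
  s_mul : ∀ g h, s g = r h → s (mul g h) = s h
  mul_assoc : ∀ g h k, s g = r h → s h = r k → mul (mul g h) k = mul g (mul h k)
  unit_mul : ∀ g, mul (unit (r g)) g = g
  mul_unit : ∀ g, mul g (unit (s g)) = g
  r_inv : ∀ g, r (inv g) = s g
  s_inv : ∀ g, s (inv g) = r g
  mul_inv : ∀ g, mul g (inv g) = unit (r g)
  inv_mul : ∀ g, mul (inv g) g = unit (s g)
  contMDiff_r : ContMDiff 𝓘(ℝ, Eu (n + m)) 𝓘(ℝ, Eu n) ∞ r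
  contMDiff_s : ContMDiff 𝓘(ℝ, Eu (n + m)) 𝓘(ℝ, Eu n) ∞ s
  contMDiff_unit : ContMDiff 𝓘(ℝ, Eu n) 𝓘(ℝ, Eu (n + m)) ∞ unit
  contMDiff_inv : ContMDiff 𝓘(ℝ, Eu (n + m)) 𝓘(ℝ, Eu (n + m)) ∞ inv
  contMDiffOn_mul :
    ContMDiffOn (𝓘(ℝ, Eu (n + m)).prod 𝓘(ℝ, Eu (n + m))) 𝓘(ℝ, Eu (n + m)) ∞
      (fun p : G × G => mul p.1 p.2) {p | s p.1 = r p.2}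
  submersion_r : ∀ g, Function.Surjective (mfderiv 𝓘(ℝ, Eu (n + m)) 𝓘(ℝ, Eu n) r g)
  submersion_s : ∀ g, Function.Surjective (mfderiv 𝓘(ℝ, Eu (n + m)) 𝓘(ℝ, Eu n) s g)

namespace LieGroupoid

variable {n m : ℕ} {G M : Type*}
  [TopologicalSpace G] [ChartedSpace (Eu (n + m)) G]
  [TopologicalSpace M] [ChartedSpace (Eu n) M]
  (Γ : LieGroupoid n m G M)

/-! ### The Lie algebroid -/

/-- The fibre at `x` of the Lie algebroid: the tangent space at the unit of `x` of the fibre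
`r⁻¹(x)`, that is, the kernel of the differential of `r` there. -/
def Alg (x : M) : Submodule ℝ (TangentSpace 𝓘(ℝ, Eu (n + m)) (Γ.unit x)) :=
  LinearMap.ker
    (mfderiv 𝓘(ℝ, Eu (n + m)) 𝓘(ℝ, Eu n) Γ.r (Γ.unit x)).toLinearMap

/-- The total space of the Lie algebroid. -/
abbrev Algebroid : Type _ := Σ x : M, Γ.Alg x

/-- The total space of the dual of the Lie algebroid. -/
abbrev DualAlgebroid : Type _ := Σ x : M, Module.Dual ℝ (Γ.Alg x)

theorem finrank_alg (x : M) : Module.finrank ℝ (Γ.Alg x) = m := by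
  let L : Eu (n + m) →ₗ[ℝ] Eu n :=
    (mfderiv 𝓘(ℝ, Eu (n + m)) 𝓘(ℝ, Eu n) Γ.r (Γ.unit x)).toLinearMap
  have hs : Function.Surjective L := Γ.submersion_r (Γ.unit x)
  have h := L.finrank_range_add_finrank_ker
  rw [LinearMap.range_eq_top.2 hs, finrank_top] at h
  simp only [finrank_euclideanSpace, Fintype.card_fin] at h
  have h2 : Module.finrank ℝ (LinearMap.ker L) = m := by omega
  exact h2

instance (x : M) : Module.Finite ℝ (Γ.Alg x) := by
  let L : Eu (n + m) →ₗ[ℝ] Eu n :=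
    (mfderiv 𝓘(ℝ, Eu (n + m)) 𝓘(ℝ, Eu n) Γ.r (Γ.unit x)).toLinearMap
  exact inferInstanceAs (Module.Finite ℝ (LinearMap.ker L))

/-- Some basis of a fibre of the Lie algebroid (used only to integrate densities over the
fibre and its dual; the integrals do not depend on it). -/
def algBasis (x : M) : Module.Basis (Fin m) ℝ (Γ.Alg x) :=
  Module.finBasisOfFinrankEq ℝ _ (Γ.finrank_alg x)

/-- The velocity of a map into the fibre `r⁻¹(x)` passing through the unit of `x` lies in the
Lie algebroid. -/
theorem mfderiv_mem_alg {F : Eu m → G} {v : Eu m} {x : M} (h0 : F v = Γ.unit x)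
    (h : ∀ᶠ w in 𝓝 v, Γ.r (F w) = x) (z : Eu m) :
    (mfderiv 𝓘(ℝ, Eu m) 𝓘(ℝ, Eu (n + m)) F v z : Eu (n + m)) ∈ Γ.Alg x := by
  change mfderiv 𝓘(ℝ, Eu (n + m)) 𝓘(ℝ, Eu n) Γ.r (Γ.unit x)
    (mfderiv 𝓘(ℝ, Eu m) 𝓘(ℝ, Eu (n + m)) F v z) = 0
  by_cases hF : MDifferentiableAt 𝓘(ℝ, Eu m) 𝓘(ℝ, Eu (n + m)) F v
  · have hr : MDifferentiableAt 𝓘(ℝ, Eu (n + m)) 𝓘(ℝ, Eu n) Γ.r (F v) :=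
      (Γ.contMDiff_r.mdifferentiable (by simp)) _
    have hc := mfderiv_comp (I := 𝓘(ℝ, Eu m)) (I'' := 𝓘(ℝ, Eu n)) v hr hF
    have he : (Γ.r ∘ F) =ᶠ[𝓝 v] fun _ => x := h
    rw [he.mfderiv_eq] at hc
    have hz := congrArg (fun L => L z) hc
    rw [← h0]
    refine Eq.trans hz.symm ?_
    rw [mfderiv_const]
    rfl
  · rw [mfderiv_zero_of_not_mdifferentiableAt hF]
    exact map_zero _

/-! ### Local charts -/

/-- A chart `ψ : U × V → G` of `G`, together with a chart `φ : U → M` of `M`, such that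
`r (ψ (u, v)) = φ u`. -/
structure SubmersionChart where
  φ : OpenPartialHomeomorph (Eu n) M
  ψ : OpenPartialHomeomorph (Eu n × Eu m) G
  V : Set (Eu m)
  source_eq : ψ.source = φ.source ×ˢ V
  isOpen_V : IsOpen V
  smooth_φ : ContMDiffOn 𝓘(ℝ, Eu n) 𝓘(ℝ, Eu n) ∞ φ φ.source
  smooth_φ_symm : ContMDiffOn 𝓘(ℝ, Eu n) 𝓘(ℝ, Eu n) ∞ φ.symm φ.target
  smooth_ψ : ContMDiffOn 𝓘(ℝ, Eu n × Eu m) 𝓘(ℝ, Eu (n + m)) ∞ ψ ψ.source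
  smooth_ψ_symm : ContMDiffOn 𝓘(ℝ, Eu (n + m)) 𝓘(ℝ, Eu n × Eu m) ∞ ψ.symm ψ.target
  r_ψ : ∀ u ∈ φ.source, ∀ v ∈ V, Γ.r (ψ (u, v)) = φ u

/-- A chart of `G` adapted to the units: moreover `0 ∈ V` and
`ψ (U × {0}) = ψ (U × V) ∩ G⁽⁰⁾`. -/
structure AdaptedChart extends SubmersionChart Γ where
  zero_mem : (0 : Eu m) ∈ V
  unit_iff : ∀ u ∈ φ.source, ∀ v ∈ V, ψ (u, v) ∈ Set.range Γ.unit ↔ v = 0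

/-- Around every unit there is an adapted chart. -/
theorem exists_adaptedChart [IsManifold 𝓘(ℝ, Eu (n + m)) ∞ G] [IsManifold 𝓘(ℝ, Eu n) ∞ M]
    (x₀ : M) : ∃ c : Γ.AdaptedChart, x₀ ∈ c.φ.target := by
  let e : OpenPartialHomeomorph G (Eu (n + m)) := chartAt (Eu (n + m)) (Γ.unit x₀)
  let d : OpenPartialHomeomorph M (Eu n) := chartAt (Eu n) x₀
  have he : ContMDiffOn 𝓘(ℝ, Eu (n + m)) 𝓘(ℝ, Eu (n + m)) ∞ e e.source := contMDiffOn_chart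
  have he' : ContMDiffOn 𝓘(ℝ, Eu (n + m)) 𝓘(ℝ, Eu (n + m)) ∞ e.symm e.target :=
    contMDiffOn_chart_symm
  have hd : ContMDiffOn 𝓘(ℝ, Eu n) 𝓘(ℝ, Eu n) ∞ d d.source := contMDiffOn_chart
  have hd' : ContMDiffOn 𝓘(ℝ, Eu n) 𝓘(ℝ, Eu n) ∞ d.symm d.target := contMDiffOn_chart_symm
  have hge : Γ.unit x₀ ∈ e.source := mem_chart_source _ _
  have hxd : x₀ ∈ d.source := mem_chart_source _ _
  have hcr : Continuous Γ.r := Γ.contMDiff_r.continuous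
  have hcu : Continuous Γ.unit := Γ.contMDiff_unit.continuous
  let O : Set (Eu (n + m)) := e.target ∩ e.symm ⁻¹'
    (Γ.r ⁻¹' d.source ∩ (fun g => Γ.unit (Γ.r g)) ⁻¹' e.source)
  let W : Set (Eu n) := d.target ∩ d.symm ⁻¹' (Γ.unit ⁻¹' e.source)
  have hO : IsOpen O := e.isOpen_inter_preimage_symm
    ((d.open_source.preimage hcr).inter (e.open_source.preimage (hcu.comp hcr)))
  have hW : IsOpen W := d.isOpen_inter_preimage_symm (e.open_source.preimage hcu)
  let ρ : Eu (n + m) → Eu n := fun y => d (Γ.r (e.symm y))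
  let ι : Eu n → Eu (n + m) := fun u => e (Γ.unit (d.symm u))
  have hρ : ContDiffOn ℝ ∞ ρ O := by
    rw [← contMDiffOn_iff_contDiffOn]
    exact hd.comp (Γ.contMDiff_r.comp_contMDiffOn (he'.mono fun y hy => hy.1))
      (fun y hy => hy.2.1)
  have hι : ContDiffOn ℝ ∞ ι W := by
    rw [← contMDiffOn_iff_contDiffOn]
    exact he.comp (Γ.contMDiff_unit.comp_contMDiffOn (hd'.mono fun y hy => hy.1))
      (fun y hy => hy.2)
  have hOW : Set.MapsTo ρ O W := by
    intro y hy
    refine ⟨d.map_source hy.2.1, ?_⟩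
    change Γ.unit (d.symm (d (Γ.r (e.symm y)))) ∈ e.source
    rw [d.left_inv hy.2.1]
    exact hy.2.2
  have hρι : ∀ u ∈ W, ρ (ι u) = u := by
    intro u hu
    change d (Γ.r (e.symm (e (Γ.unit (d.symm u))))) = u
    rw [e.left_inv hu.2, Γ.r_unit, d.right_inv hu.1]
  have hιO : ∀ u ∈ W, ι u ∈ O := by
    intro u hu
    refine ⟨e.map_source hu.2, ?_, ?_⟩
    · change Γ.r (e.symm (e (Γ.unit (d.symm u)))) ∈ d.source
      rw [e.left_inv hu.2, Γ.r_unit]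
      exact d.map_target hu.1
    · change Γ.unit (Γ.r (e.symm (e (Γ.unit (d.symm u))))) ∈ e.source
      rw [e.left_inv hu.2, Γ.r_unit]
      exact hu.2
  have hu₀ : d x₀ ∈ W := by
    refine ⟨d.map_source hxd, ?_⟩
    change Γ.unit (d.symm (d x₀)) ∈ e.source
    rw [d.left_inv hxd]
    exact hge
  obtain ⟨L, Ψ, h0, hΨO, hΨ, hΨ', hΨeq⟩ :=
    exists_straightening hO hW hρ hι hOW hρι hu₀ (hιO _ hu₀)
  have hΨι : ∀ u ∈ W, Ψ (ι u) = (u, 0) := by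
    intro u hu
    rw [hΨeq, hρι u hu, sub_self, map_zero]
  have hN : ((d x₀, 0) : Eu n × Eu m) ∈ Ψ.target := by
    rw [← hΨι _ hu₀]
    exact Ψ.map_source h0
  obtain ⟨U₀, V, hU₀, hV, hxU₀, h0V, hUV⟩ := isOpen_prod_iff.1 Ψ.open_target _ _ hN
  let U : Set (Eu n) := U₀ ∩ (W ∩ ι ⁻¹' Ψ.source)
  have hU : IsOpen U := hU₀.inter (hι.continuousOn.isOpen_inter_preimage hW Ψ.open_source)
  let ψ' : OpenPartialHomeomorph (Eu n × Eu m) G := (e.trans Ψ).symm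
  let ψ : OpenPartialHomeomorph (Eu n × Eu m) G := ψ'.restrOpen (U ×ˢ V) (hU.prod hV)
  let φ : OpenPartialHomeomorph (Eu n) M := d.symm.restrOpen U hU
  have hψs : ψ.source = U ×ˢ V := by
    ext p
    constructor
    · exact fun hp => hp.2
    · intro hp
      have h1 : p ∈ Ψ.target := hUV ⟨hp.1.1, hp.2⟩
      exact ⟨⟨h1, (hΨO (Ψ.map_target h1)).1⟩, hp⟩
  have hφs : φ.source = U := by
    ext u
    exact ⟨fun hu => hu.2, fun hu => ⟨hu.2.1.1, hu⟩⟩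
  have hpt : ∀ p ∈ U ×ˢ V, p ∈ Ψ.target := fun p hp => hUV ⟨hp.1.1, hp.2⟩
  have hrψ : ∀ u ∈ U, ∀ v ∈ V, Γ.r (ψ (u, v)) = d.symm u := by
    intro u hu v hv
    have h1 := hpt (u, v) ⟨hu, hv⟩
    have h2 := hΨO (Ψ.map_target h1)
    have h3 : ρ (Ψ.symm (u, v)) = u := by
      have h4 := hΨeq (Ψ.symm (u, v))
      rw [Ψ.right_inv h1] at h4
      exact (congrArg Prod.fst h4).symm
    change Γ.r (e.symm (Ψ.symm (u, v))) = d.symm u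
    rw [← d.left_inv h2.2.1]
    exact congrArg d.symm h3
  refine ⟨{ φ := φ, ψ := ψ, V := V
            source_eq := by rw [hψs, hφs]
            isOpen_V := hV
            smooth_φ := hd'.mono (fun u hu => hu.1)
            smooth_φ_symm := hd.mono (fun x hx => hx.1)
            smooth_ψ := ?_
            smooth_ψ_symm := ?_
            r_ψ := ?_
            zero_mem := h0V
            unit_iff := ?_ }, ?_⟩
  · rw [hψs]
    exact he'.comp ((contMDiffOn_iff_contDiffOn.2 hΨ').mono hpt)
      (fun p hp => (hΨO (Ψ.map_target (hpt p hp))).1)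
  · have h1 : ψ.target ⊆ e.source ∩ e ⁻¹' Ψ.source := fun g hg => hg.1
    exact (contMDiffOn_iff_contDiffOn.2 hΨ).comp (he.mono fun g hg => (h1 hg).1)
      (fun g hg => (h1 hg).2)
  · rw [hφs]
    exact hrψ
  · rw [hφs]
    intro u hu v hv
    have h1 := hpt (u, v) ⟨hu, hv⟩
    have h2 := hΨO (Ψ.map_target h1)
    constructor
    · rintro ⟨x, hx⟩
      have h3 := hrψ u hu v hv
      rw [← hx, Γ.r_unit] at h3
      have h4 : Ψ.symm (u, v) = ι u := by
        have h5 : e (ψ (u, v)) = Ψ.symm (u, v) := e.right_inv h2.1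
        rw [← h5, ← hx, h3]
      have h6 := Ψ.right_inv h1
      rw [h4, hΨι u hu.2.1] at h6
      exact (congrArg Prod.snd h6).symm
    · rintro rfl
      have h3 : Ψ.symm (u, 0) = ι u := by
        rw [← hΨι u hu.2.1, Ψ.left_inv hu.2.2]
      refine ⟨d.symm u, ?_⟩
      change Γ.unit (d.symm u) = e.symm (Ψ.symm (u, 0))
      rw [h3]
      exact (e.left_inv hu.2.1.2).symm
  · change x₀ ∈ d.source ∩ d ⁻¹' U
    refine ⟨hxd, hxU₀, hu₀, h0⟩

namespace AdaptedChart

variable {Γ} (c : Γ.AdaptedChart)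

theorem ψ_zero {u : Eu n} (hu : u ∈ c.φ.source) : c.ψ (u, 0) = Γ.unit (c.φ u) := by
  obtain ⟨y, hy⟩ := (c.unit_iff u hu 0 c.zero_mem).2 rfl
  have h := c.r_ψ u hu 0 c.zero_mem
  rw [← hy, Γ.r_unit] at h
  rw [← hy, h]

open Classical in
/-- The moving frame of the Lie algebroid attached to the chart:
`e_i (φ u) = ∂ψ/∂v_i (u, 0)`, for `u ∈ U`. -/
def frame (u : Eu n) (i : Fin m) : Γ.Alg (c.φ u) :=
  if hu : u ∈ c.φ.source then
    ⟨(mfderiv 𝓘(ℝ, Eu m) 𝓘(ℝ, Eu (n + m)) (fun v : Eu m => c.ψ (u, v)) 0 (stdVec i) :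
        Eu (n + m)),
      Γ.mfderiv_mem_alg (F := fun v : Eu m => c.ψ (u, v)) (c.ψ_zero hu)
        (Filter.eventually_of_mem (c.isOpen_V.mem_nhds c.zero_mem)
          (fun v hv => c.r_ψ u hu v hv)) (stdVec i)⟩
  else 0

/-- The coordinates, in the frame `e_i (φ u)`, of a vector of the fibre at `φ u`: the
`v`-components of its image by the differential of `ψ⁻¹`. -/
def coord (u : Eu n) (w : Eu (n + m)) (k : Fin m) : ℝ :=
  ((mfderiv 𝓘(ℝ, Eu (n + m)) 𝓘(ℝ, Eu n × Eu m) c.ψ.symm (Γ.unit (c.φ u)) w :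
      Eu n × Eu m).2) k

/-- The left-invariant vector field on `s⁻¹(φ(U))` attached to the section `e_i`: at `g`, with
`s g = φ u`, the image of `e_i (φ u)` by the differential of left translation by `g`. -/
def leftField (i : Fin m) (g : G) : TangentSpace 𝓘(ℝ, Eu (n + m)) g :=
  (mfderiv 𝓘(ℝ, Eu m) 𝓘(ℝ, Eu (n + m))
    (fun v : Eu m => Γ.mul g (c.ψ (c.φ.symm (Γ.s g), v))) 0 (stdVec i) : Eu (n + m))

/-- The structure functions of the anchor `ds : 𝒢 → TM`: `ds (e_i) = ∑ⱼ a_ij ∂/∂u_j`. -/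
def anchorCoeff (i : Fin m) (j : Fin n) (u : Eu n) : ℝ :=
  ((fderiv ℝ (fun v : Eu m => c.φ.symm (Γ.s (c.ψ (u, v)))) 0 (stdVec i) : Eu n)) j

/-- The structure functions of the bracket: `[e_i, e_j] = ∑ₖ c_ijk e_k`, where the bracket of
sections of the Lie algebroid is that of the corresponding left-invariant vector fields. -/
def bracketCoeff (i j k : Fin m) (u : Eu n) : ℝ :=
  c.coord u (VectorField.mlieBracket 𝓘(ℝ, Eu (n + m)) (c.leftField i) (c.leftField j)
    (Γ.unit (c.φ u))) k

/-- The point `∑ₖ η_k e^k (φ u)` of the dual of the Lie algebroid, where `e^k` is the dual frame. -/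
def dualPoint (u : Eu n) (η : Eu m) : Γ.DualAlgebroid :=
  ⟨c.φ u, ∑ k, η k • ((EuclideanSpace.proj (𝕜 := ℝ) k).toLinearMap ∘ₗ
      (LinearMap.snd ℝ (Eu n) (Eu m)) ∘ₗ
      (mfderiv 𝓘(ℝ, Eu (n + m)) 𝓘(ℝ, Eu n × Eu m) c.ψ.symm
        (Γ.unit (c.φ u))).toLinearMap ∘ₗ (Γ.Alg (c.φ u)).subtype)⟩

/-- The coordinates `(u, η)` cover the dual of the Lie algebroid over `φ(U)`. -/
theorem exists_dualPoint_eq {u : Eu n} (hu : u ∈ c.φ.source)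
    (a : Module.Dual ℝ (Γ.Alg (c.φ u))) : ∃ η : Eu m, c.dualPoint u η = ⟨c.φ u, a⟩ := by
  have hmem : ((u, 0) : Eu n × Eu m) ∈ c.ψ.source := by
    rw [c.source_eq]; exact ⟨hu, c.zero_mem⟩
  have hq : Γ.unit (c.φ u) ∈ c.ψ.target := by
    rw [← c.ψ_zero hu]; exact c.ψ.map_source hmem
  have hqs : c.ψ.symm (Γ.unit (c.φ u)) = (u, 0) := by
    rw [← c.ψ_zero hu, c.ψ.left_inv hmem]
  have hds : MDifferentiableAt 𝓘(ℝ, Eu (n + m)) 𝓘(ℝ, Eu n × Eu m) c.ψ.symm (Γ.unit (c.φ u)) :=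
    (c.smooth_ψ_symm.contMDiffAt (c.ψ.open_target.mem_nhds hq)).mdifferentiableAt (by simp)
  have hdψ : MDifferentiableAt 𝓘(ℝ, Eu n × Eu m) 𝓘(ℝ, Eu (n + m)) c.ψ
      (c.ψ.symm (Γ.unit (c.φ u))) := by
    rw [hqs]
    exact (c.smooth_ψ.contMDiffAt (c.ψ.open_source.mem_nhds hmem)).mdifferentiableAt (by simp)
  have hru : Γ.r (Γ.unit (c.φ u)) ∈ c.φ.target := by
    rw [Γ.r_unit]; exact c.φ.map_source hu
  have hdφ : MDifferentiableAt 𝓘(ℝ, Eu n) 𝓘(ℝ, Eu n) c.φ.symm (Γ.r (Γ.unit (c.φ u))) :=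
    (c.smooth_φ_symm.contMDiffAt (c.φ.open_target.mem_nhds hru)).mdifferentiableAt (by simp)
  have hdr : MDifferentiableAt 𝓘(ℝ, Eu (n + m)) 𝓘(ℝ, Eu n) Γ.r (Γ.unit (c.φ u)) :=
    (Γ.contMDiff_r.mdifferentiable (by simp)) _
  let S : Eu (n + m) →L[ℝ] Eu n × Eu m :=
    mfderiv 𝓘(ℝ, Eu (n + m)) 𝓘(ℝ, Eu n × Eu m) c.ψ.symm (Γ.unit (c.φ u))
  have hS1 : ∀ w : Γ.Alg (c.φ u), (S w.1).1 = 0 := by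
    intro w
    have h1 := mfderiv_comp (I := 𝓘(ℝ, Eu (n + m))) (I' := 𝓘(ℝ, Eu n × Eu m))
      (I'' := 𝓘(ℝ, Eu n)) (Γ.unit (c.φ u)) (g := (Prod.fst : Eu n × Eu m → Eu n))
      (differentiableAt_fst.mdifferentiableAt) hds
    have h2 := mfderiv_comp (I := 𝓘(ℝ, Eu (n + m))) (I' := 𝓘(ℝ, Eu n))
      (I'' := 𝓘(ℝ, Eu n)) (Γ.unit (c.φ u)) hdφ hdr
    have h3 : (Prod.fst ∘ c.ψ.symm) =ᶠ[𝓝 (Γ.unit (c.φ u))] (c.φ.symm ∘ Γ.r) := by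
      refine Filter.eventually_of_mem (c.ψ.open_target.mem_nhds hq) (fun g hg => ?_)
      have h4 := c.ψ.map_target hg
      rw [c.source_eq] at h4
      have h5 := c.r_ψ _ h4.1 _ h4.2
      rw [Prod.mk.eta, c.ψ.right_inv hg] at h5
      change (c.ψ.symm g).1 = c.φ.symm (Γ.r g)
      rw [h5, c.φ.left_inv h4.1]
    rw [h3.mfderiv_eq, h2, mfderiv_eq_fderiv, fderiv_fst] at h1
    have h6 := congrArg (fun T => T (w : TangentSpace 𝓘(ℝ, Eu (n + m)) (Γ.unit (c.φ u)))) h1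
    refine Eq.trans h6.symm ?_
    have h7 : mfderiv 𝓘(ℝ, Eu (n + m)) 𝓘(ℝ, Eu n) Γ.r (Γ.unit (c.φ u)) w = 0 := w.2
    change mfderiv 𝓘(ℝ, Eu n) 𝓘(ℝ, Eu n) c.φ.symm (Γ.r (Γ.unit (c.φ u)))
      (mfderiv 𝓘(ℝ, Eu (n + m)) 𝓘(ℝ, Eu n) Γ.r (Γ.unit (c.φ u)) w) = 0
    rw [h7]
    exact map_zero _
  have hS2 : Function.Injective S := by
    have h1 := mfderiv_comp (I := 𝓘(ℝ, Eu (n + m))) (I' := 𝓘(ℝ, Eu n × Eu m))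
      (I'' := 𝓘(ℝ, Eu (n + m))) (Γ.unit (c.φ u)) hdψ hds
    have h3 : (c.ψ ∘ c.ψ.symm) =ᶠ[𝓝 (Γ.unit (c.φ u))] id :=
      Filter.eventually_of_mem (c.ψ.open_target.mem_nhds hq) (fun g hg => c.ψ.right_inv hg)
    rw [h3.mfderiv_eq, mfderiv_id] at h1
    intro w w' hww
    have h4 := congrArg (fun T => T w) h1
    have h5 := congrArg (fun T => T w') h1
    exact h4.trans ((congrArg (mfderiv 𝓘(ℝ, Eu n × Eu m) 𝓘(ℝ, Eu (n + m)) c.ψ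
      (c.ψ.symm (Γ.unit (c.φ u)))) hww).trans h5.symm)
  let D : Γ.Alg (c.φ u) →ₗ[ℝ] Eu m :=
    (LinearMap.snd ℝ (Eu n) (Eu m)) ∘ₗ S.toLinearMap ∘ₗ (Γ.Alg (c.φ u)).subtype
  have hD : Function.Injective D := by
    intro w w' hww
    apply Subtype.ext
    apply hS2
    exact Prod.ext ((hS1 w).trans (hS1 w').symm) hww
  let T := LinearEquiv.ofInjectiveOfFinrankEq D hD (by rw [Γ.finrank_alg]; simp)
  refine ⟨WithLp.toLp 2 (fun k => a (T.symm (stdVec k))), ?_⟩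
  refine congrArg (fun b => (⟨c.φ u, b⟩ : Γ.DualAlgebroid)) ?_
  ext w
  have h1 : T w = ∑ k, (D w k) • (stdVec k : Eu m) := by
    change D w = _
    ext l
    simp [stdVec, Pi.single_apply]
  have h2 : w = ∑ k, (D w k) • T.symm (stdVec k) := by
    have := congrArg T.symm h1
    simpa using this
  conv_rhs => rw [h2, map_sum]
  rw [LinearMap.sum_apply]
  refine Finset.sum_congr rfl (fun k _ => ?_)
  rw [map_smul, smul_eq_mul, mul_comm]
  rfl

/-- The Poisson bracket of the dual of the Lie algebroid in the coordinates `(u, η)`: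
`∑ a_ij (∂F/∂η_i ∂H/∂u_j - ∂H/∂η_i ∂F/∂u_j) + ∑ c_ijk η_k ∂F/∂η_i ∂H/∂η_j`. -/
def localPoisson (F H : Γ.DualAlgebroid → ℂ) (u : Eu n) (η : Eu m) : ℂ :=
  let dη (K : Γ.DualAlgebroid → ℂ) (i : Fin m) : ℂ :=
    fderiv ℝ (fun η' : Eu m => K (c.dualPoint u η')) η (stdVec i)
  let du (K : Γ.DualAlgebroid → ℂ) (j : Fin n) : ℂ :=
    fderiv ℝ (fun u' : Eu n => K (c.dualPoint u' η)) u (stdVec j)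
  (∑ i, ∑ j, (c.anchorCoeff i j u : ℂ) * (dη F i * du H j - dη H i * du F j)) +
    ∑ i, ∑ j, ∑ k, (c.bracketCoeff i j k u : ℂ) * (η k : ℂ) * (dη F i * dη H j)

end AdaptedChart

/-! ### Densities and the Haar system -/

/-- A smooth positive density on the fibres of the Lie algebroid. -/
structure SmoothDensity where
  toFun : ∀ x : M, (Fin m → Γ.Alg x) → ℝ
  map_comp : ∀ (x : M) (T : Γ.Alg x →ₗ[ℝ] Γ.Alg x) (e : Fin m → Γ.Alg x),
    toFun x (fun i => T (e i)) = |LinearMap.det T| * toFun x e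
  pos : ∀ (x : M) (e : Fin m → Γ.Alg x), LinearIndependent ℝ e → 0 < toFun x e
  smooth : ∀ c : Γ.AdaptedChart,
    ContDiffOn ℝ ∞ (fun u : Eu n => toFun (c.φ u) (c.frame u)) c.φ.source

variable {Γ}

/-- The integral of a function over the fibre at `x` of the Lie algebroid, with respect to the
density `μ`. -/
def SmoothDensity.fibreIntegral (μ : Γ.SmoothDensity) (x : M) (h : Γ.Alg x → ℂ) : ℂ :=
  (μ.toFun x (Γ.algBasis x) : ℂ) * ∫ v : Eu m, h (∑ i, v i • Γ.algBasis x i)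

/-- The integral of a function over the fibre at `x` of the dual of the Lie algebroid, with
respect to the density dual to `μ`. -/
def SmoothDensity.dualFibreIntegral (μ : Γ.SmoothDensity) (x : M)
    (h : Module.Dual ℝ (Γ.Alg x) → ℂ) : ℂ :=
  ((μ.toFun x (Γ.algBasis x) : ℂ))⁻¹ * ∫ η : Eu m, h (∑ i, η i • (Γ.algBasis x).coord i)

open Classical in
/-- The coefficient at `v ∈ V`, in the parametrization `ψ (u, ·)` of the fibre `r⁻¹(φ u)`, of the
left-equivariant density `λ` defined by `μ`: with `g = ψ (u, v)`, it is the value of `μ` on the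
vectors obtained by translating `∂ψ/∂v_i (u, v)` by `g⁻¹` to the unit of `s g`. -/
def SubmersionChart.haarCoeff (c : Γ.SubmersionChart) (μ : Γ.SmoothDensity)
    (u : Eu n) (v : Eu m) : ℝ :=
  if h : u ∈ c.φ.source ∧ v ∈ c.V then
    μ.toFun (Γ.s (c.ψ (u, v))) (fun i =>
      ⟨(mfderiv 𝓘(ℝ, Eu m) 𝓘(ℝ, Eu (n + m))
          (fun w : Eu m => Γ.mul (Γ.inv (c.ψ (u, v))) (c.ψ (u, w))) v (stdVec i) : Eu (n + m)),
        Γ.mfderiv_mem_alg (F := fun w : Eu m => Γ.mul (Γ.inv (c.ψ (u, v))) (c.ψ (u, w)))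
          (Γ.inv_mul _)
          (Filter.eventually_of_mem (c.isOpen_V.mem_nhds h.2) (fun w hw => by
            rw [Γ.r_mul _ _ (by rw [Γ.s_inv, c.r_ψ u h.1 v h.2, c.r_ψ u h.1 w hw]),
              Γ.r_inv])) (stdVec i)⟩)
  else 0

/-- The left Haar system `(λ^x)` of `G` associated to `μ`: `λ^x` is the measure on `G`,
concentrated on `r⁻¹(x)`, of the left-equivariant density defined by `μ`. It is obtained by
gluing (as a least upper bound of measures) the measures `λ(ψ (u, v)) dv` given by the
parametrizations `ψ (u, ·)` of `r⁻¹(x)`, `φ u = x`. -/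
def SmoothDensity.haar [MeasurableSpace G] [BorelSpace G] (μ : Γ.SmoothDensity) (x : M) :
    Measure G :=
  ⨆ (c : Γ.SubmersionChart) (u : Eu n) (_ : u ∈ c.φ.source ∧ c.φ u = x),
    Measure.map (fun v : Eu m => c.ψ (u, v))
      ((volume.restrict c.V).withDensity (fun v => ENNReal.ofReal (c.haarCoeff μ u v)))

variable (Γ)

/-! ### The tangent groupoid -/

/-- The tangent groupoid `G × ℝ* ∪ 𝒢 × {0}`. -/
inductive TangentGroupoid : Type _
  | ofNe (g : G) (t : ℝ) (ht : t ≠ 0)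
  | ofZero (X : Γ.Algebroid)

variable {Γ}

/-- The domain `{(u, v, t) | u ∈ U, t v ∈ V}` of the chart of the tangent groupoid attached to an
adapted chart. -/
def AdaptedChart.tangentDomain (c : Γ.AdaptedChart) : Set (Eu n × Eu m × ℝ) :=
  {p | p.1 ∈ c.φ.source ∧ p.2.2 • p.2.1 ∈ c.V}

/-- The chart `θ (u, v) = (φ u, ∂ψ/∂v (u, 0) v)` of the Lie algebroid. -/
def AdaptedChart.θ (c : Γ.AdaptedChart) (u : Eu n) (v : Eu m) : Γ.Algebroid :=
  ⟨c.φ u, ∑ i, v i • c.frame u i⟩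

open Classical in
/-- The chart of the tangent groupoid attached to an adapted chart:
`(u, v, t) ↦ (ψ (u, t v), t)` for `t ≠ 0`, and `(u, v, 0) ↦ (θ (u, v), 0)`. -/
def AdaptedChart.tangentChart (c : Γ.AdaptedChart) (p : Eu n × Eu m × ℝ) : Γ.TangentGroupoid :=
  if ht : p.2.2 ≠ 0 then .ofNe (c.ψ (p.1, p.2.2 • p.2.1)) p.2.2 ht
  else .ofZero (c.θ p.1 p.2.1)

/-- The topology of the tangent groupoid: a set is open when its trace on `G × ℝ*` and its
inverse images by all the charts attached to adapted charts are open. -/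
instance : TopologicalSpace Γ.TangentGroupoid :=
  TopologicalSpace.coinduced
      (fun p : {p : G × ℝ // p.2 ≠ 0} => TangentGroupoid.ofNe p.1.1 p.1.2 p.2) inferInstance ⊔
    ⨆ c : Γ.AdaptedChart,
      TopologicalSpace.coinduced (fun p : c.tangentDomain => c.tangentChart p.1) inferInstance

open Classical in
/-- The elements of `C_c^∞(G̃)`: the functions on the tangent groupoid that are smooth in `G × ℝ*`
and in all the charts attached to adapted charts, and have compact support. -/
structure IsSmoothCompactlySupported (f : Γ.TangentGroupoid → ℂ) : Prop where
  smooth_ne : ContMDiffOn (𝓘(ℝ, Eu (n + m)).prod 𝓘(ℝ, ℝ)) 𝓘(ℝ, ℂ) ∞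
    (fun p : G × ℝ => if h : p.2 ≠ 0 then f (.ofNe p.1 p.2 h) else 0) {p | p.2 ≠ 0}
  smooth_chart : ∀ c : Γ.AdaptedChart,
    ContDiffOn ℝ ∞ (fun p => f (c.tangentChart p)) c.tangentDomain
  compact : HasCompactSupport f

/-- The restriction of a function to the fibre of the tangent groupoid at `t = 0`. -/
def restrictZero (f : Γ.TangentGroupoid → ℂ) : Γ.Algebroid → ℂ := fun X => f (.ofZero X)

/-- The convolution on the tangent groupoid: on the fibre `G × {t}`, `t ≠ 0`, it is the
convolution of the groupoid `G` for the Haar system `|t|⁻ᵐ λ`; on the fibre `𝒢 × {0}` it is the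
convolution of the bundle of vector groups `𝒢` for the Haar system `μ`. -/
def conv [MeasurableSpace G] [BorelSpace G] (μ : Γ.SmoothDensity)
    (f g : Γ.TangentGroupoid → ℂ) : Γ.TangentGroupoid → ℂ
  | .ofNe γ t ht =>
      ((|t| ^ m : ℝ) : ℂ)⁻¹ *
        ∫ η, f (.ofNe η t ht) * g (.ofNe (Γ.mul (Γ.inv η) γ) t ht) ∂(μ.haar (Γ.r γ))
  | .ofZero ⟨x, X⟩ =>
      μ.fibreIntegral x (fun Y => f (.ofZero ⟨x, Y⟩) * g (.ofZero ⟨x, X - Y⟩))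

/-- The commutator for the convolution. -/
def commutator [MeasurableSpace G] [BorelSpace G] (μ : Γ.SmoothDensity)
    (f g : Γ.TangentGroupoid → ℂ) : Γ.TangentGroupoid → ℂ :=
  fun z => conv μ f g z - conv μ g f z

/-- `∂h/∂t` at `t = 0` exists and equals `k`: at every point `(X, 0)` the function `h` is
differentiable, with differential `k(X) dt`. So the derivative of `h` at `(X, 0)` along any
tangent vector `∂/∂t` with `dt(∂/∂t) = 1` is `k(X)`. -/
def HasTimeDerivAtZero (h : Γ.TangentGroupoid → ℂ) (k : Γ.Algebroid → ℂ) : Prop :=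
  ∀ (c : Γ.AdaptedChart) (u : Eu n) (v : Eu m), u ∈ c.φ.source →
    HasFDerivAt (fun p : Eu n × Eu m × ℝ => h (c.tangentChart p))
      (k (c.θ u v) • (Complex.ofRealCLM.comp
        ((ContinuousLinearMap.snd ℝ (Eu m) ℝ).comp
          (ContinuousLinearMap.snd ℝ (Eu n) (Eu m × ℝ)))))
      (u, v, 0)

/-! ### The Poisson bracket -/

theorem exists_dualPoint [IsManifold 𝓘(ℝ, Eu (n + m)) ∞ G] [IsManifold 𝓘(ℝ, Eu n) ∞ M]
    (α : Γ.DualAlgebroid) : ∃ (q : Γ.AdaptedChart × Eu n × Eu m),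
      q.2.1 ∈ q.1.φ.source ∧ q.1.dualPoint q.2.1 q.2.2 = α := by
  obtain ⟨x, a⟩ := α
  obtain ⟨c, hc⟩ := Γ.exists_adaptedChart x
  obtain ⟨u, hu, rfl⟩ : ∃ u ∈ c.φ.source, c.φ u = x :=
    ⟨c.φ.symm x, c.φ.map_target hc, c.φ.right_inv hc⟩
  obtain ⟨η, hη⟩ := c.exists_dualPoint_eq hu a
  exact ⟨(c, u, η), hu, hη⟩

/-- The canonical (linear) Poisson bracket of functions on the dual `𝒢*` of the Lie algebroid. At
each point it is computed in coordinates `(u, η)` around that point; the value does not depend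
on the coordinates. -/
def poisson [IsManifold 𝓘(ℝ, Eu (n + m)) ∞ G] [IsManifold 𝓘(ℝ, Eu n) ∞ M]
    (F H : Γ.DualAlgebroid → ℂ) (α : Γ.DualAlgebroid) : ℂ :=
  let q := (exists_dualPoint α).choose
  q.1.localPoisson F H q.2.1 q.2.2

/-- The Fourier transform from functions on `𝒢` to functions on `𝒢*`:
`(ℱ f)(x, α) = ∫ exp(2πi α(Y)) f(x, Y) dμ_x(Y)`. -/
def fourier (μ : Γ.SmoothDensity) (f : Γ.Algebroid → ℂ) : Γ.DualAlgebroid → ℂ :=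
  fun α => μ.fibreIntegral α.1 (fun Y =>
    Complex.exp (2 * Real.pi * Complex.I * (α.2 Y : ℂ)) * f ⟨α.1, Y⟩)

/-- The inverse Fourier transform:
`(ℱ⁻¹ F)(x, X) = ∫ exp(-2πi α(X)) F(x, α) dμ*_x(α)`, with the dual density `μ*`. -/
def fourierInv (μ : Γ.SmoothDensity) (F : Γ.DualAlgebroid → ℂ) : Γ.Algebroid → ℂ :=
  fun X => μ.dualFibreIntegral X.1 (fun α =>
    Complex.exp (-(2 * Real.pi * Complex.I * (α X.2 : ℂ))) * F ⟨X.1, α⟩)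

/-- The Poisson bracket of the convolution algebra of functions of Schwartz type on the Lie
algebroid: `{f, g} = ℱ⁻¹ {ℱ f, ℱ g}`. -/
def schwartzPoisson [IsManifold 𝓘(ℝ, Eu (n + m)) ∞ G] [IsManifold 𝓘(ℝ, Eu n) ∞ M]
    (μ : Γ.SmoothDensity) (f g : Γ.Algebroid → ℂ) : Γ.Algebroid → ℂ :=
  fourierInv μ (poisson (fourier μ f) (fourier μ g))

end LieGroupoid

end

/-!
The commutator `[f, g]` vanishes on the fibre `t = 0`, where the convolution is that of a vector
group. If it is differentiable there, its differential is therefore a multiple of `dt`, and the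
proof consists in computing the factor in one adapted chart around each point.

Differentiability and the formula for the factor come from one integral. In an adapted chart
`(u, v) ↦ ψ(u, v)`, the substitution `η = ψ(u, t y)` absorbs the factor `|t|⁻ᵐ` and turns
`(f * g)(u, x, t)` into the integral over a fixed ball of
`f(u, y, t) g(σ(u, t y), t⁻¹ ζ(u, t y, t x), t) λ(u, t y)`. Here `σ` is the source map, `ζ` the
`v`-component of `ψ(u, y)⁻¹ ψ(u, x)` and `λ` the coefficient of the Haar system (`conv_tangentChart`,
`integral_haar`). By Hadamard's lemma (`contDiffOn_divTime`) the integrand is continuously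
differentiable across `t = 0`, also in its second argument `t⁻¹ ζ`. Its `t`-derivative at `t = 0`
(`hasDerivAt_convIntegrand`) involves three expansions to first order in `t`:

* `σ(u, t y) = u + t a(y) + ⋯`, where `a` is the anchor;
* `t⁻¹ ζ(u, t y, t x) = (x - y) - t B_u(y, x - y) + ⋯`, where `B_u` is the bilinear term of the
  product in the chart; its antisymmetrization is the bracket of the Lie algebroid
  (`hasDerivAt_divTime_quotScaled`, `bracketCoeff_eq`);
* `λ(u, t y) = ρ(u) + t (∂_{a(y)} ρ(u) - ρ(u) tr B_u(y, ·)) + ⋯`, where `ρ` is the coefficient of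
  the density (`hasDerivAt_lam`).

By the Leibniz rule the trace and the term in `B_u` combine, and with `F = f(u, ·, 0)` and
`K = g(u, ·, 0)` the `t`-derivative of `f * g` is (`isIntegralOf_convDerivMap`)
`ρ (∂ₜf ⋆ K + F ⋆ ∂ₜg + ∑ a_ij (y_i F) ⋆ ∂_{u_j} K - ∑ B_ijk (y_i F) ⋆ ∂_k (y_j K))`
`+ ∑ a_ij ∂_j ρ (y_i F) ⋆ K`.
The Fourier transform turns convolutions into products, `y_i` into `(2πi)⁻¹ ∂/∂η_i` and `∂_k` into
`-2πi η_k`. In the commutator the terms with `∂ₜ` cancel, `B_ijk` is replaced by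
`B_ijk - B_jik = c_ijk`, and the derivatives of `ρ` are those of the factor `ρ` in the Fourier
transform along the fibres. What remains is the Poisson bracket (`localPoisson_fourier`), and
Fourier inversion on each fibre gives the formula (`schwartzPoisson_restrictZero`).

The factor of `dt` does not depend on the chart, because the changes of charts of the tangent
groupoid are continuously differentiable and preserve `t` (`eq_of_hasFDerivAt_smul_dt`). So the
Poisson bracket and the Fourier transforms may each be computed in a chart of their own.
-/

noncomputable section

/-! ### Parametric integrals and division by the parameter -/

section Parametric

/-- The tube lemma, for a closed ball. -/
theorem exists_closedBall_prod_subset {E Y : Type*} [PseudoMetricSpace E] [TopologicalSpace Y]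
    {Ω : Set (E × Y)} (hΩ : IsOpen Ω) {K : Set Y}
    (hK : IsCompact K) {p₀ : E} (h : ∀ y ∈ K, (p₀, y) ∈ Ω) :
    ∃ r > 0, Metric.closedBall p₀ r ×ˢ K ⊆ Ω := by
  obtain ⟨A, B, hA, -, hpA, hKB, hAB⟩ := generalized_tube_lemma (isCompact_singleton (x := p₀)) hK
    hΩ (by rintro ⟨p, y⟩ ⟨hp, hy⟩; obtain rfl : p = p₀ := hp; exact h y hy)
  obtain ⟨r, hr, hrA⟩ := Metric.nhds_basis_closedBall.mem_iff.1 (hA.mem_nhds (hpA rfl))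
  exact ⟨r, hr, (Set.prod_mono hrA hKB).trans hAB⟩

variable {E F Y : Type*} [NormedAddCommGroup E] [NormedSpace ℝ E] [FiniteDimensional ℝ E]
  [NormedAddCommGroup F] [NormedSpace ℝ F]
  [NormedAddCommGroup Y] [NormedSpace ℝ Y] [FiniteDimensional ℝ Y]
  [MeasurableSpace Y] [BorelSpace Y]

theorem continuousAt_setIntegral_of_continuousOn {Ω : Set (E × Y)} (hΩ : IsOpen Ω) {K : Set Y}
    (hK : IsCompact K) {Φ : E × Y → F} (hΦ : ContinuousOn Φ Ω) {p₀ : E}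
    (h : ∀ y ∈ K, (p₀, y) ∈ Ω) (ν : Measure Y) [IsFiniteMeasureOnCompacts ν] :
    ContinuousAt (fun p => ∫ y in K, Φ (p, y) ∂ν) p₀ := by
  obtain ⟨r, hr, hrΩ⟩ := exists_closedBall_prod_subset hΩ hK h
  obtain ⟨C, hC⟩ := ((isCompact_closedBall p₀ r).prod hK).exists_bound_of_continuousOn
    (hΦ.mono hrΩ)
  have hmem : ∀ {p}, p ∈ Metric.closedBall p₀ r → Set.MapsTo (fun y : Y => (p, y)) K Ω :=
    fun hp y hy => hrΩ ⟨hp, hy⟩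
  refine continuousAt_of_dominated (bound := fun _ => C) ?_ ?_ ?_ ?_
  · filter_upwards [Metric.closedBall_mem_nhds p₀ hr] with p hp
    exact (hΦ.comp (by fun_prop) (hmem hp)).aestronglyMeasurable hK.measurableSet
  · filter_upwards [Metric.closedBall_mem_nhds p₀ hr] with p hp
    exact ae_restrict_of_forall_mem hK.measurableSet fun y hy => hC (p, y) ⟨hp, hy⟩
  · exact continuousOn_const.integrableOn_compact hK
  · refine ae_restrict_of_forall_mem hK.measurableSet fun y hy => ?_
    exact ContinuousAt.comp (f := fun p : E => (p, y)) (hΦ.continuousAt (hΩ.mem_nhds (h y hy)))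
      (by fun_prop)

theorem hasFDerivAt_setIntegral_of_contDiffOn {Ω : Set (E × Y)} (hΩ : IsOpen Ω) {K : Set Y}
    (hK : IsCompact K) {Φ : E × Y → F} (hΦ : ContDiffOn ℝ 1 Φ Ω) {p₀ : E}
    (h : ∀ y ∈ K, (p₀, y) ∈ Ω) (ν : Measure Y) [IsFiniteMeasureOnCompacts ν] :
    HasFDerivAt (fun p => ∫ y in K, Φ (p, y) ∂ν)
      (∫ y in K, (fderiv ℝ Φ (p₀, y)).comp (ContinuousLinearMap.inl ℝ E Y) ∂ν) p₀ := by
  obtain ⟨r, hr, hrΩ⟩ := exists_closedBall_prod_subset hΩ hK h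
  have hd : ContinuousOn (fun q => (fderiv ℝ Φ q).comp (ContinuousLinearMap.inl ℝ E Y)) Ω :=
    (hΦ.continuousOn_fderiv_of_isOpen hΩ le_rfl).clm_comp continuousOn_const
  obtain ⟨C, hC⟩ := ((isCompact_closedBall p₀ r).prod hK).exists_bound_of_continuousOn
    (hd.mono hrΩ)
  have hmem : ∀ {p}, p ∈ Metric.closedBall p₀ r → Set.MapsTo (fun y : Y => (p, y)) K Ω :=
    fun hp y hy => hrΩ ⟨hp, hy⟩
  have hp₀ : p₀ ∈ Metric.closedBall p₀ r := Metric.mem_closedBall_self hr.le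
  refine hasFDerivAt_integral_of_dominated_of_fderiv_le (𝕜 := ℝ) (bound := fun _ => C)
    (F' := fun p y => (fderiv ℝ Φ (p, y)).comp (ContinuousLinearMap.inl ℝ E Y))
    (Metric.closedBall_mem_nhds p₀ hr) ?_ ?_ ?_ ?_ ?_ ?_
  · filter_upwards [Metric.closedBall_mem_nhds p₀ hr] with p hp
    exact (hΦ.continuousOn.comp (by fun_prop) (hmem hp)).aestronglyMeasurable hK.measurableSet
  · exact (hΦ.continuousOn.comp (by fun_prop) (hmem hp₀)).integrableOn_compact hK
  · exact (hd.comp (by fun_prop) (hmem hp₀)).aestronglyMeasurable hK.measurableSet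
  · exact ae_restrict_of_forall_mem hK.measurableSet fun y hy p hp => hC (p, y) ⟨hp, hy⟩
  · exact continuousOn_const.integrableOn_compact hK
  · refine ae_restrict_of_forall_mem hK.measurableSet fun y hy p hp => ?_
    have h1 : HasFDerivAt Φ (fderiv ℝ Φ (p, y)) (p, y) :=
      ((hΦ.contDiffAt (hΩ.mem_nhds (hrΩ ⟨hp, hy⟩))).differentiableAt (by simp)).hasFDerivAt
    exact h1.comp p (hasFDerivAt_prodMk_left p y)

theorem contDiffAt_setIntegral_of_contDiffOn {Ω : Set (E × Y)} (hΩ : IsOpen Ω) {K : Set Y}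
    (hK : IsCompact K) {Φ : E × Y → F} (hΦ : ContDiffOn ℝ 1 Φ Ω) {p₀ : E}
    (h : ∀ y ∈ K, (p₀, y) ∈ Ω) (ν : Measure Y) [IsFiniteMeasureOnCompacts ν] :
    ContDiffAt ℝ 1 (fun p => ∫ y in K, Φ (p, y) ∂ν) p₀ := by
  obtain ⟨r, hr, hrΩ⟩ := exists_closedBall_prod_subset hΩ hK h
  have hmem : ∀ p ∈ Metric.ball p₀ r, ∀ y ∈ K, (p, y) ∈ Ω :=
    fun p hp y hy => hrΩ ⟨Metric.ball_subset_closedBall hp, hy⟩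
  have hd : ContinuousOn (fun q => (fderiv ℝ Φ q).comp (ContinuousLinearMap.inl ℝ E Y)) Ω :=
    (hΦ.continuousOn_fderiv_of_isOpen hΩ le_rfl).clm_comp continuousOn_const
  rw [contDiffAt_one_iff]
  refine ⟨_, Metric.ball p₀ r, Metric.ball_mem_nhds _ hr, ?_,
    fun p hp => hasFDerivAt_setIntegral_of_contDiffOn hΩ hK hΦ (hmem p hp) ν⟩
  exact fun p hp =>
    (continuousAt_setIntegral_of_continuousOn hΩ hK hd (hmem p hp) ν).continuousWithinAt

/-- The quotient `h(e, t) / t` of a function vanishing at `t = 0`, extended by `∂h/∂t` at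
`t = 0`. -/
def divTime (h : E × ℝ → F) (p : E × ℝ) : F :=
  if p.2 = 0 then fderiv ℝ h p (0, 1) else p.2⁻¹ • h p

/-- Hadamard's lemma: the quotient is, near `t = 0`, the integral
`∫₀¹ (∂h/∂t)(e, s t) ds`, so it is continuously differentiable there too. -/
theorem contDiffOn_divTime [CompleteSpace F] {h : E × ℝ → F} {Ω : Set (E × ℝ)} (hΩ : IsOpen Ω)
    (hh : ContDiffOn ℝ ∞ h Ω) (h0 : ∀ e, (e, (0 : ℝ)) ∈ Ω → h (e, 0) = 0) :
    ContDiffOn ℝ 1 (divTime h) Ω := by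
  rintro ⟨e₀, t₀⟩ hp
  refine ContDiffAt.contDiffWithinAt ?_
  by_cases ht : t₀ = 0
  · subst ht
    let m : (E × ℝ) × ℝ → E × ℝ := fun q => (q.1.1, q.2 * q.1.2)
    have hm : ContDiff ℝ ∞ m := by fun_prop
    have hΩ' : IsOpen (m ⁻¹' Ω) := hΩ.preimage hm.continuous
    have hΦ : ContDiffOn ℝ 1 (fun q => fderiv ℝ h (m q) (0, 1)) (m ⁻¹' Ω) := by
      have h1 : ContDiffOn ℝ 1 (fderiv ℝ h) Ω := hh.fderiv_of_isOpen hΩ (by decide)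
      exact (h1.comp (hm.of_le (by simp)).contDiffOn (fun _ hq => hq)).clm_apply contDiffOn_const
    have hK : ∀ s ∈ Set.Icc (0 : ℝ) 1, (((e₀, 0) : E × ℝ), s) ∈ m ⁻¹' Ω := by
      intro s _
      simpa [m] using hp
    refine (contDiffAt_setIntegral_of_contDiffOn hΩ' isCompact_Icc hΦ hK volume).congr_of_eventuallyEq
      ?_
    obtain ⟨r, hr, hrΩ⟩ := exists_closedBall_prod_subset hΩ' isCompact_Icc hK
    filter_upwards [Metric.closedBall_mem_nhds _ hr] with p hp'
    obtain ⟨e, t⟩ := p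
    have hs : ∀ s ∈ Set.Icc (0 : ℝ) 1, ((e, s * t) : E × ℝ) ∈ Ω := fun s hs =>
      hrΩ (a := ((e, t), s)) ⟨hp', hs⟩
    rw [integral_Icc_eq_integral_Ioc, ← intervalIntegral.integral_of_le zero_le_one]
    by_cases ht : t = 0
    · subst ht
      simp [divTime, m]
    · have hc : ContinuousOn (fun s : ℝ => fderiv ℝ h (e, s * t) (0, 1)) (Set.uIcc 0 1) := by
        rw [Set.uIcc_of_le zero_le_one]
        exact hΦ.continuousOn.comp (f := fun s : ℝ => (((e, t) : E × ℝ), s)) (by fun_prop) hs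
      have h2 : ∫ s in (0:ℝ)..1, t • fderiv ℝ h (e, s * t) (0, 1) = h (e, 1 * t) - h (e, 0 * t) := by
        refine intervalIntegral.integral_eq_sub_of_hasDerivAt (f := fun s => h (e, s * t)) ?_
          (hc.const_smul t).intervalIntegrable
        intro s hs'
        rw [Set.uIcc_of_le zero_le_one] at hs'
        have h3 : HasFDerivAt h (fderiv ℝ h (e, s * t)) (e, s * t) :=
          ((hh.contDiffAt (hΩ.mem_nhds (hs s hs'))).differentiableAt (by simp)).hasFDerivAt
        have h4 : HasDerivAt (fun s : ℝ => ((e, s * t) : E × ℝ)) (0, t) s := by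
          simpa using (hasDerivAt_const s e).prodMk ((hasDerivAt_id s).mul_const t)
        have h5 := h3.comp_hasDerivAt s h4
        have h6 : ((0, t) : E × ℝ) = t • ((0, 1) : E × ℝ) := by simp
        rwa [h6, map_smul] at h5
      have h00 : h (e, 0) = 0 := h0 e (by simpa using hs 0 (by simp))
      rw [intervalIntegral.integral_smul, one_mul, zero_mul, h00, sub_zero] at h2
      simp only [divTime, ht, if_false, m]
      rw [← h2, smul_smul, inv_mul_cancel₀ ht, one_smul]
  · have h1 : ContDiffAt ℝ 1 (fun p : E × ℝ => p.2⁻¹ • h p) (e₀, t₀) :=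
      (contDiffAt_snd.inv ht).smul ((hh.contDiffAt (hΩ.mem_nhds hp)).of_le (by simp))
    refine h1.congr_of_eventuallyEq ?_
    have h2 : ∀ᶠ p : E × ℝ in 𝓝 (e₀, t₀), p.2 ≠ 0 :=
      continuousAt_snd.eventually_ne ht
    filter_upwards [h2] with p hp'
    simp [divTime, hp']

/-- The `t`-derivative of `h(e, t) / t` at `t = 0` is half the second `t`-derivative of `h`. -/
theorem hasDerivAt_divTime [CompleteSpace F] {h : E × ℝ → F} {Ω : Set (E × ℝ)} (hΩ : IsOpen Ω)
    (hh : ContDiffOn ℝ ∞ h Ω) (h0 : ∀ e, (e, (0 : ℝ)) ∈ Ω → h (e, 0) = 0) {e : E}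
    (he : (e, (0 : ℝ)) ∈ Ω) {k : F}
    (hk : HasDerivAt (fun t : ℝ => fderiv ℝ h (e, t) (0, 1)) ((2 : ℝ) • k) 0) :
    HasDerivAt (fun t : ℝ => divTime h (e, t)) k 0 := by
  have hC := contDiffOn_divTime hΩ hh h0
  have hin : ∀ t : ℝ, HasDerivAt (fun t : ℝ => ((e, t) : E × ℝ)) (0, 1) t := fun t =>
    (hasDerivAt_const t e).prodMk (hasDerivAt_id t)
  have hnear : ∀ᶠ t : ℝ in 𝓝 0, ((e, t) : E × ℝ) ∈ Ω :=
    (hin 0).continuousAt.preimage_mem_nhds (hΩ.mem_nhds he)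
  -- `H` is the quotient along the line through `e` and `D` its derivative.
  let H : ℝ → F := fun t => divTime h (e, t)
  let D : ℝ → F := fun t => fderiv ℝ (divTime h) (e, t) (0, 1)
  have hHD : ∀ t : ℝ, ((e, t) : E × ℝ) ∈ Ω → HasDerivAt H (D t) t := fun t ht =>
    (((hC.contDiffAt (hΩ.mem_nhds ht)).differentiableAt (by simp)).hasFDerivAt).comp_hasDerivAt t
      (hin t)
  have hDc : ContinuousAt D 0 := by
    have h1 : ContinuousAt (fderiv ℝ (divTime h)) (e, 0) :=
      (hC.continuousOn_fderiv_of_isOpen hΩ le_rfl).continuousAt (hΩ.mem_nhds he)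
    exact ((ContinuousAt.comp (f := fun t : ℝ => ((e, t) : E × ℝ)) h1
      (hin 0).continuousAt).clm_apply continuousAt_const)
  -- Differentiating `h = t H` gives `∂h/∂t = H + t D`.
  have hderiv : ∀ᶠ t : ℝ in 𝓝 0, fderiv ℝ h (e, t) (0, 1) = H t + t • D t := by
    filter_upwards [hnear] with t ht
    have h1 : HasDerivAt (fun t : ℝ => h (e, t)) (fderiv ℝ h (e, t) (0, 1)) t :=
      (((hh.contDiffAt (hΩ.mem_nhds ht)).differentiableAt (by simp)).hasFDerivAt).comp_hasDerivAt t
        (hin t)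
    have h2 : HasDerivAt (fun t : ℝ => t • H t) (t • D t + (1 : ℝ) • H t) t :=
      (hasDerivAt_id t).smul (hHD t ht)
    have h3 : (fun s : ℝ => h (e, s)) =ᶠ[𝓝 t] fun s => s • H s := by
      have : ∀ᶠ s : ℝ in 𝓝 t, ((e, s) : E × ℝ) ∈ Ω :=
        (hin t).continuousAt.preimage_mem_nhds (hΩ.mem_nhds ht)
      filter_upwards [this] with s hs
      by_cases hs0 : s = 0
      · subst hs0; simp [h0 e hs]
      · simp [H, divTime, hs0]
    have h4 := (h1.congr_of_eventuallyEq h3.symm).unique h2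
    rw [h4, one_smul, add_comm]
  have hsum : HasDerivAt (fun t : ℝ => H t + t • D t) (D 0 + D 0) 0 := by
    refine (hHD 0 he).add ?_
    rw [hasDerivAt_iff_tendsto_slope]
    have : Filter.Tendsto D (𝓝[≠] 0) (𝓝 (D 0)) := hDc.mono_left nhdsWithin_le_nhds
    refine this.congr' ?_
    filter_upwards [self_mem_nhdsWithin] with t ht
    have : t ≠ 0 := ht
    simp [slope, this]
  have h5 := (hk.congr_of_eventuallyEq (hderiv.mono fun _ h => h.symm)).unique hsum
  have h6 : k = D 0 := by
    have : (2 : ℝ) • k = (2 : ℝ) • D 0 := by rw [h5, two_smul]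
    simpa using congrArg (fun z => (2 : ℝ)⁻¹ • z) this
  rw [h6]
  exact hHD 0 he

end Parametric

/-! ### The determinant near the identity -/

section Det

variable {m : ℕ}

theorem Eu.eq_sum_stdVec (v : Eu m) : v = ∑ i, v i • (stdVec i : Eu m) := by
  ext l; simp [stdVec, Pi.single_apply]

theorem ContinuousLinearMap.det_eq_matrix (A : Eu m →L[ℝ] Eu m) :
    A.det = (Matrix.of fun i j => (A (stdVec j)) i).det := by
  rw [ContinuousLinearMap.det, ← LinearMap.det_toMatrix (EuclideanSpace.basisFun (Fin m) ℝ).toBasis]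
  congr 1

theorem contDiff_det : ContDiff ℝ ∞ (ContinuousLinearMap.det : (Eu m →L[ℝ] Eu m) → ℝ) := by
  have h : (ContinuousLinearMap.det : (Eu m →L[ℝ] Eu m) → ℝ) =
      fun A => (Matrix.of fun i j => (A (stdVec j)) i).det :=
    funext ContinuousLinearMap.det_eq_matrix
  rw [h]
  simp only [Matrix.det_apply', Matrix.of_apply]
  refine ContDiff.sum fun σ _ => contDiff_const.mul (contDiff_prod fun i _ => ?_)
  exact (EuclideanSpace.proj (𝕜 := ℝ) (σ i)).contDiff.comp
    (ContinuousLinearMap.apply ℝ (Eu m) (stdVec i : Eu m)).contDiff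

/-- Jacobi's formula: the derivative of the determinant at the identity is the trace. -/
theorem hasDerivAt_det_id {A : ℝ → Eu m →L[ℝ] Eu m} {A' : Eu m →L[ℝ] Eu m} {t : ℝ}
    (hA : HasDerivAt A A' t) (h0 : A t = ContinuousLinearMap.id ℝ (Eu m)) :
    HasDerivAt (fun s => (A s).det) (∑ i, (A' (stdVec i)) i) t := by
  have hd : HasFDerivAt (ContinuousLinearMap.det : (Eu m →L[ℝ] Eu m) → ℝ)
      (fderiv ℝ ContinuousLinearMap.det (A t)) (A t) :=
    (contDiff_det.differentiable (by simp) (A t)).hasFDerivAt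
  have h1 := hd.comp_hasDerivAt t hA
  -- The derivative of the determinant at the identity is computed along the line `1 + s A'`.
  have hline : HasDerivAt (fun s : ℝ => A t + s • A') A' 0 := by
    simpa using ((hasDerivAt_id (0 : ℝ)).smul_const A').const_add (A t)
  have hd' : HasFDerivAt (ContinuousLinearMap.det : (Eu m →L[ℝ] Eu m) → ℝ)
      (fderiv ℝ ContinuousLinearMap.det (A t)) (A t + (0 : ℝ) • A') := by
    rw [show A t + (0 : ℝ) • A' = A t by ext v; simp]; exact hd
  have h2 := HasFDerivAt.comp_hasDerivAt (f := fun s : ℝ => A t + s • A') (0 : ℝ) hd' hline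
  have h3 : ∀ s : ℝ, (A t + s • A').det =
      (1 + s • (Matrix.of fun i j => (A' (stdVec j)) i)).det := by
    intro s
    rw [ContinuousLinearMap.det_eq_matrix, h0]
    congr 1
    ext i j
    simp [Matrix.one_apply, stdVec]
  have h4 : HasDerivAt (fun s : ℝ => (A t + s • A').det) (∑ i, (A' (stdVec i)) i) 0 := by
    rw [show (fun s : ℝ => (A t + s • A').det) = _ from
      funext fun s => (h3 s).trans (Matrix.det_one_add_smul s _)]
    have h5 := (((hasDerivAt_id (0 : ℝ)).const_mul
      (Matrix.trace (Matrix.of fun i j : Fin m => (A' (stdVec j)) i))).const_add 1).add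
      ((Polynomial.hasDerivAt (Matrix.det (1 + (Polynomial.X : Polynomial ℝ) •
        (Matrix.of fun i j : Fin m => (A' (stdVec j)) i).map Polynomial.C)).divX.divX
          (0 : ℝ)).mul ((hasDerivAt_id (0 : ℝ)).pow 2))
    refine h5.congr_deriv ?_
    simp [Matrix.trace]
  have h6 := h2.unique h4
  rw [h6] at h1
  exact h1

end Det

/-! ### Fourier analysis of Schwartz functions -/

section Schwartz

open SchwartzMap FourierTransform LineDeriv
open scoped Convolution

variable {m : ℕ}

/-- Multiplication of a Schwartz function by the `i`-th coordinate. -/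
def coordMul (i : Fin m) (S : 𝓢(Eu m, ℂ)) : 𝓢(Eu m, ℂ) :=
  smulLeftCLM ℂ (fun y : Eu m => inner ℝ y (stdVec i)) S

theorem inner_stdVec (y : Eu m) (i : Fin m) : inner ℝ y (stdVec i) = y i := by
  simp [stdVec, EuclideanSpace.inner_single_right]

theorem coordMul_apply (i : Fin m) (S : 𝓢(Eu m, ℂ)) (y : Eu m) :
    coordMul i S y = (y i : ℂ) * S y := by
  rw [coordMul, smulLeftCLM_apply_apply (by fun_prop), inner_stdVec, Complex.real_smul]

/-- The Leibniz rule for the product with a coordinate. -/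
theorem fderiv_coordMul (j : Fin m) (S : 𝓢(Eu m, ℂ)) (z w : Eu m) :
    fderiv ℝ (coordMul j S) z w = (w j : ℂ) * S z + (z j : ℂ) * fderiv ℝ S z w := by
  have h1 : ⇑(coordMul j S) = fun y : Eu m => ((y j : ℝ) : ℂ) * S y :=
    funext (coordMul_apply j S)
  have h2 : HasFDerivAt (fun y : Eu m => ((y j : ℝ) : ℂ))
      (Complex.ofRealCLM.comp (EuclideanSpace.proj (𝕜 := ℝ) j)) z :=
    (Complex.ofRealCLM.comp (EuclideanSpace.proj (𝕜 := ℝ) j)).hasFDerivAt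
  have h3 : HasFDerivAt (fun y : Eu m => ((y j : ℝ) : ℂ) * S y) _ z := h2.mul (S.hasFDerivAt z)
  rw [h1, h3.fderiv]
  simp
  ring

theorem fderiv_fourierInv (i : Fin m) (S : 𝓢(Eu m, ℂ)) (η : Eu m) :
    fderiv ℝ (𝓕⁻ S : 𝓢(Eu m, ℂ)) η (stdVec i) = 2 * Real.pi * Complex.I * 𝓕⁻ (coordMul i S) η := by
  have h := congrArg (fun T : 𝓢(Eu m, ℂ) => T η) (lineDerivOp_fourierInv_eq S (stdVec i))
  simp only [lineDerivOp_apply_eq_fderiv, fourierInv_smul] at h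
  exact h

theorem fourierInv_lineDeriv (k : Fin m) (S : 𝓢(Eu m, ℂ)) (η : Eu m) :
    𝓕⁻ (∂_{(stdVec k : Eu m)} S) η = -(2 * Real.pi * Complex.I) * ((η k : ℂ) * 𝓕⁻ S η) := by
  rw [fourierInv_lineDerivOp_eq]
  change -(2 * Real.pi * Complex.I) * coordMul k (𝓕⁻ S) η = _
  rw [coordMul_apply]

/-- The convolution of two scalar Schwartz functions. -/
def schwartzConv (S T : 𝓢(Eu m, ℂ)) : 𝓢(Eu m, ℂ) :=
  SchwartzMap.convolution (ContinuousLinearMap.mul ℂ ℂ) S T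

theorem fourierInv_schwartzConv (S T : 𝓢(Eu m, ℂ)) (η : Eu m) :
    𝓕⁻ (schwartzConv S T) η = 𝓕⁻ S η * 𝓕⁻ T η := by
  simp only [fourierInv_apply_eq, schwartzConv, fourier_convolution,
    compCLMOfContinuousLinearEquiv_apply, Function.comp_apply, pairing_apply_apply]
  rfl

theorem fourierInv_eq_integral (S : 𝓢(Eu m, ℂ)) (η : Eu m) :
    𝓕⁻ S η = ∫ y, Complex.exp (2 * Real.pi * Complex.I * (inner ℝ y η : ℝ)) * S y := by
  rw [fourierInv_coe, Real.fourierInv_eq']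
  refine integral_congr_ae (Filter.Eventually.of_forall fun y => ?_)
  simp only [smul_eq_mul]
  congr 2
  push_cast
  ring

theorem integral_exp_fourierInv (S : 𝓢(Eu m, ℂ)) (x : Eu m) :
    ∫ η, Complex.exp (-(2 * Real.pi * Complex.I * (inner ℝ η x : ℝ))) * 𝓕⁻ S η = S x := by
  have h : 𝓕 (𝓕⁻ S) x = S x := by rw [fourier_fourierInv_eq]
  rw [← h, fourier_coe, Real.fourier_eq']
  refine integral_congr_ae (Filter.Eventually.of_forall fun y => ?_)
  simp only [smul_eq_mul]
  congr 2
  push_cast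
  ring

/-- The Schwartz function `S` is `x ↦ ∫ H(x, y) dy`, the integrals being convergent. -/
structure IsIntegralOf (S : 𝓢(Eu m, ℂ)) (H : Eu m → Eu m → ℂ) : Prop where
  integrable : ∀ x, Integrable (H x)
  integral_eq : ∀ x, ∫ y, H x y = S x

theorem isIntegralOf_schwartzConv (S T : 𝓢(Eu m, ℂ)) :
    IsIntegralOf (schwartzConv S T) fun x y => S y * T (x - y) := by
  refine ⟨fun x => ?_, fun x => ?_⟩
  · refine S.integrable.mul_bdd (c := SchwartzMap.seminorm ℝ 0 0 T) ?_ ?_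
    · exact (T.continuous.comp (by fun_prop)).aestronglyMeasurable
    · exact Filter.Eventually.of_forall fun y => norm_le_seminorm ℝ T _
  · rw [schwartzConv, SchwartzMap.convolution_apply]
    rfl

namespace IsIntegralOf

variable {S T : 𝓢(Eu m, ℂ)} {H K : Eu m → Eu m → ℂ}

theorem congr (hS : IsIntegralOf S H) (h : ∀ x y, K x y = H x y) : IsIntegralOf S K := by
  rwa [show K = H from funext fun x => funext (h x)]

theorem add (hS : IsIntegralOf S H) (hT : IsIntegralOf T K) :
    IsIntegralOf (S + T) fun x y => H x y + K x y :=
  ⟨fun x => (hS.integrable x).add (hT.integrable x), fun x => by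
    rw [integral_add (hS.integrable x) (hT.integrable x), hS.integral_eq, hT.integral_eq]; rfl⟩

theorem sub (hS : IsIntegralOf S H) (hT : IsIntegralOf T K) :
    IsIntegralOf (S - T) fun x y => H x y - K x y :=
  ⟨fun x => (hS.integrable x).sub (hT.integrable x), fun x => by
    rw [integral_sub (hS.integrable x) (hT.integrable x), hS.integral_eq, hT.integral_eq]; rfl⟩

theorem smul (hS : IsIntegralOf S H) (a : ℂ) : IsIntegralOf (a • S) fun x y => a * H x y :=
  ⟨fun x => (hS.integrable x).const_mul a, fun x => by
    rw [integral_const_mul, hS.integral_eq]; rfl⟩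

theorem sum {ι : Type*} {s : Finset ι} {S : ι → 𝓢(Eu m, ℂ)} {H : ι → Eu m → Eu m → ℂ}
    (h : ∀ i, IsIntegralOf (S i) (H i)) :
    IsIntegralOf (∑ i ∈ s, S i) fun x y => ∑ i ∈ s, H i x y :=
  ⟨fun x => integrable_finsetSum _ fun i _ => (h i).integrable x, fun x => by
    rw [integral_finsetSum _ fun i _ => (h i).integrable x]
    simp [(h _).integral_eq]⟩

end IsIntegralOf

/-- The value at `η` of the Fourier transform with kernel `exp(2πi⟨y, η⟩)`, as a linear form. -/
def fourierAt (η : Eu m) : 𝓢(Eu m, ℂ) →ₗ[ℂ] ℂ where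
  toFun S := 𝓕⁻ S η
  map_add' S T := by rw [fourierInv_add]; rfl
  map_smul' a S := by rw [fourierInv_smul]; rfl

theorem fourierAt_apply (η : Eu m) (S : 𝓢(Eu m, ℂ)) : fourierAt η S = 𝓕⁻ S η := rfl

theorem fourierAt_schwartzConv (η : Eu m) (S T : 𝓢(Eu m, ℂ)) :
    fourierAt η (schwartzConv S T) = fourierAt η S * fourierAt η T := fourierInv_schwartzConv S T η

theorem fourierAt_lineDeriv (η : Eu m) (k : Fin m) (S : 𝓢(Eu m, ℂ)) :
    fourierAt η (∂_{(stdVec k : Eu m)} S) =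
      -(2 * Real.pi * Complex.I) * ((η k : ℂ) * fourierAt η S) := fourierInv_lineDeriv k S η

theorem fderiv_fourierAt (η : Eu m) (i : Fin m) (S : 𝓢(Eu m, ℂ)) :
    fderiv ℝ (fun η : Eu m => fourierAt η S) η (stdVec i) =
      2 * Real.pi * Complex.I * fourierAt η (coordMul i S) := fderiv_fourierInv i S η

theorem differentiableAt_fourierAt (η : Eu m) (S : 𝓢(Eu m, ℂ)) :
    DifferentiableAt ℝ (fun η : Eu m => fourierAt η S) η :=
  (𝓕⁻ S : 𝓢(Eu m, ℂ)).differentiableAt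

theorem fourierAt_eq_integral (η : Eu m) (S : 𝓢(Eu m, ℂ)) :
    fourierAt η S = ∫ y, Complex.exp (2 * Real.pi * Complex.I * (inner ℝ y η : ℝ)) * S y :=
  fourierInv_eq_integral S η

end Schwartz

namespace LieGroupoid

variable {n m : ℕ} {G M : Type*}
  [TopologicalSpace G] [ChartedSpace (Eu (n + m)) G]
  [TopologicalSpace M] [ChartedSpace (Eu n) M]
  {Γ : LieGroupoid n m G M}

/-! ### Frames and coordinates of the Lie algebroid -/

namespace AdaptedChart

variable (c : Γ.AdaptedChart)

theorem mem_source {u : Eu n} {v : Eu m} :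
    (u, v) ∈ c.ψ.source ↔ u ∈ c.φ.source ∧ v ∈ c.V := by
  rw [c.source_eq]; rfl

theorem zero_mem_source {u : Eu n} (hu : u ∈ c.φ.source) : (u, (0 : Eu m)) ∈ c.ψ.source :=
  c.mem_source.2 ⟨hu, c.zero_mem⟩

theorem symm_mem {g : G} (hg : g ∈ c.ψ.target) :
    (c.ψ.symm g).1 ∈ c.φ.source ∧ (c.ψ.symm g).2 ∈ c.V :=
  c.mem_source.1 (c.ψ.map_target hg)

theorem φ_fst_symm {g : G} (hg : g ∈ c.ψ.target) : c.φ (c.ψ.symm g).1 = Γ.r g := by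
  rw [← c.r_ψ _ (c.symm_mem hg).1 _ (c.symm_mem hg).2, Prod.mk.eta, c.ψ.right_inv hg]

theorem unit_mem_target {x : M} : Γ.unit x ∈ c.ψ.target ↔ x ∈ c.φ.target := by
  constructor
  · intro h
    rw [← Γ.r_unit x, ← c.φ_fst_symm h]
    exact c.φ.map_source (c.symm_mem h).1
  · intro h
    rw [← c.φ.right_inv h, ← c.ψ_zero (c.φ.map_target h)]
    exact c.ψ.map_source (c.zero_mem_source (c.φ.map_target h))

theorem mdifferentiableAt_ψ {p : Eu n × Eu m} (hp : p ∈ c.ψ.source) :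
    MDifferentiableAt 𝓘(ℝ, Eu n × Eu m) 𝓘(ℝ, Eu (n + m)) c.ψ p :=
  (c.smooth_ψ.contMDiffAt (c.ψ.open_source.mem_nhds hp)).mdifferentiableAt (by simp)

theorem mdifferentiableAt_ψ_symm {g : G} (hg : g ∈ c.ψ.target) :
    MDifferentiableAt 𝓘(ℝ, Eu (n + m)) 𝓘(ℝ, Eu n × Eu m) c.ψ.symm g :=
  (c.smooth_ψ_symm.contMDiffAt (c.ψ.open_target.mem_nhds hg)).mdifferentiableAt (by simp)

theorem mfderiv_symm_comp_mfderiv {p : Eu n × Eu m} (hp : p ∈ c.ψ.source) (w : Eu n × Eu m) :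
    mfderiv 𝓘(ℝ, Eu (n + m)) 𝓘(ℝ, Eu n × Eu m) c.ψ.symm (c.ψ p)
      (mfderiv 𝓘(ℝ, Eu n × Eu m) 𝓘(ℝ, Eu (n + m)) c.ψ p w) = w := by
  have h1 := mfderiv_comp (I := 𝓘(ℝ, Eu n × Eu m)) (I' := 𝓘(ℝ, Eu (n + m)))
    (I'' := 𝓘(ℝ, Eu n × Eu m)) p (c.mdifferentiableAt_ψ_symm (c.ψ.map_source hp))
    (c.mdifferentiableAt_ψ hp)
  have h2 : (c.ψ.symm ∘ c.ψ) =ᶠ[𝓝 p] id :=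
    Filter.eventually_of_mem (c.ψ.open_source.mem_nhds hp) (fun g hg => c.ψ.left_inv hg)
  rw [h2.mfderiv_eq, mfderiv_id] at h1
  exact (congrArg (fun T => T w) h1).symm

theorem mfderiv_comp_mfderiv_symm {p : Eu n × Eu m} (hp : p ∈ c.ψ.source) (w : Eu (n + m)) :
    mfderiv 𝓘(ℝ, Eu n × Eu m) 𝓘(ℝ, Eu (n + m)) c.ψ p
      (mfderiv 𝓘(ℝ, Eu (n + m)) 𝓘(ℝ, Eu n × Eu m) c.ψ.symm (c.ψ p) w) = w := by
  have hd := c.mdifferentiableAt_ψ hp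
  rw [← c.ψ.left_inv hp] at hd
  have h1 := mfderiv_comp (I := 𝓘(ℝ, Eu (n + m))) (I' := 𝓘(ℝ, Eu n × Eu m))
    (I'' := 𝓘(ℝ, Eu (n + m))) (c.ψ p) hd (c.mdifferentiableAt_ψ_symm (c.ψ.map_source hp))
  have h2 : (c.ψ ∘ c.ψ.symm) =ᶠ[𝓝 (c.ψ p)] id :=
    Filter.eventually_of_mem (c.ψ.open_target.mem_nhds (c.ψ.map_source hp))
      (fun g hg => c.ψ.right_inv hg)
  rw [h2.mfderiv_eq, mfderiv_id, c.ψ.left_inv hp] at h1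
  exact (congrArg (fun T => T w) h1).symm

theorem coe_frame {u : Eu n} (hu : u ∈ c.φ.source) (i : Fin m) :
    (c.frame u i).1 =
      mfderiv 𝓘(ℝ, Eu n × Eu m) 𝓘(ℝ, Eu (n + m)) c.ψ (u, 0) ((0, stdVec i) : Eu n × Eu m) := by
  simp only [frame, dif_pos hu]
  have h1 := mfderiv_comp (I := 𝓘(ℝ, Eu m)) (I' := 𝓘(ℝ, Eu n × Eu m))
    (I'' := 𝓘(ℝ, Eu (n + m))) (f := fun v : Eu m => (u, v)) (0 : Eu m)
    (c.mdifferentiableAt_ψ (c.zero_mem_source hu))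
    ((hasFDerivAt_prodMk_right u (0 : Eu m)).differentiableAt.mdifferentiableAt)
  rw [mfderiv_eq_fderiv (f := fun v : Eu m => (u, v)),
    (hasFDerivAt_prodMk_right u (0 : Eu m)).fderiv] at h1
  exact congrArg (fun T => T (stdVec i)) h1

theorem mfderiv_symm_frame {u : Eu n} (hu : u ∈ c.φ.source) (i : Fin m) :
    (mfderiv 𝓘(ℝ, Eu (n + m)) 𝓘(ℝ, Eu n × Eu m) c.ψ.symm (Γ.unit (c.φ u))
      (c.frame u i).1 : Eu n × Eu m) = (0, stdVec i) := by
  rw [c.coe_frame hu, ← c.ψ_zero hu]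
  exact c.mfderiv_symm_comp_mfderiv (c.zero_mem_source hu) _

/-- In the coordinates `(u, v)` the vectors of the Lie algebroid are vertical, because `r` is the
projection to `u`. -/
theorem fst_mfderiv_symm_alg {u : Eu n} (hu : u ∈ c.φ.source) (w : Γ.Alg (c.φ u)) :
    (mfderiv 𝓘(ℝ, Eu (n + m)) 𝓘(ℝ, Eu n × Eu m) c.ψ.symm (Γ.unit (c.φ u))
      w.1 : Eu n × Eu m).1 = 0 := by
  have hq : Γ.unit (c.φ u) ∈ c.ψ.target := c.unit_mem_target.2 (c.φ.map_source hu)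
  have hru : Γ.r (Γ.unit (c.φ u)) ∈ c.φ.target := by
    rw [Γ.r_unit]; exact c.φ.map_source hu
  have hdφ : MDifferentiableAt 𝓘(ℝ, Eu n) 𝓘(ℝ, Eu n) c.φ.symm (Γ.r (Γ.unit (c.φ u))) :=
    (c.smooth_φ_symm.contMDiffAt (c.φ.open_target.mem_nhds hru)).mdifferentiableAt (by simp)
  have hdr : MDifferentiableAt 𝓘(ℝ, Eu (n + m)) 𝓘(ℝ, Eu n) Γ.r (Γ.unit (c.φ u)) :=
    (Γ.contMDiff_r.mdifferentiable (by simp)) _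
  have h1 := mfderiv_comp (I := 𝓘(ℝ, Eu (n + m))) (I' := 𝓘(ℝ, Eu n × Eu m))
    (I'' := 𝓘(ℝ, Eu n)) (Γ.unit (c.φ u)) (g := (Prod.fst : Eu n × Eu m → Eu n))
    (differentiableAt_fst.mdifferentiableAt) (c.mdifferentiableAt_ψ_symm hq)
  have h2 := mfderiv_comp (I := 𝓘(ℝ, Eu (n + m))) (I' := 𝓘(ℝ, Eu n))
    (I'' := 𝓘(ℝ, Eu n)) (Γ.unit (c.φ u)) hdφ hdr
  have h3 : (Prod.fst ∘ c.ψ.symm) =ᶠ[𝓝 (Γ.unit (c.φ u))] (c.φ.symm ∘ Γ.r) := by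
    refine Filter.eventually_of_mem (c.ψ.open_target.mem_nhds hq) (fun g hg => ?_)
    change (c.ψ.symm g).1 = c.φ.symm (Γ.r g)
    rw [← c.φ_fst_symm hg, c.φ.left_inv (c.symm_mem hg).1]
  rw [h3.mfderiv_eq, h2, mfderiv_eq_fderiv, fderiv_fst] at h1
  have h6 := congrArg (fun T => T (w : TangentSpace 𝓘(ℝ, Eu (n + m)) (Γ.unit (c.φ u)))) h1
  refine Eq.trans h6.symm ?_
  have h7 : mfderiv 𝓘(ℝ, Eu (n + m)) 𝓘(ℝ, Eu n) Γ.r (Γ.unit (c.φ u)) w = 0 := w.2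
  change mfderiv 𝓘(ℝ, Eu n) 𝓘(ℝ, Eu n) c.φ.symm (Γ.r (Γ.unit (c.φ u)))
    (mfderiv 𝓘(ℝ, Eu (n + m)) 𝓘(ℝ, Eu n) Γ.r (Γ.unit (c.φ u)) w) = 0
  rw [h7]
  exact map_zero _

/-- The `v`-components of a vector of the Lie algebroid at `x`, in the frame of the chart. -/
def algCoord (x : M) : Γ.Alg x →ₗ[ℝ] Eu m :=
  let S : Eu (n + m) →L[ℝ] Eu n × Eu m :=
    mfderiv 𝓘(ℝ, Eu (n + m)) 𝓘(ℝ, Eu n × Eu m) c.ψ.symm (Γ.unit x)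
  (LinearMap.snd ℝ (Eu n) (Eu m)) ∘ₗ S.toLinearMap ∘ₗ (Γ.Alg x).subtype

theorem algCoord_sum_frame {u : Eu n} (hu : u ∈ c.φ.source) (v : Eu m) :
    c.algCoord (c.φ u) (∑ i, v i • c.frame u i) = v := by
  have hD : ∀ i, c.algCoord (c.φ u) (c.frame u i) = stdVec i := fun i =>
    congrArg Prod.snd (c.mfderiv_symm_frame hu i)
  rw [map_sum]
  simp only [map_smul, hD]
  ext l
  simp [stdVec, Pi.single_apply]

theorem sum_frame_algCoord {u : Eu n} (hu : u ∈ c.φ.source) (w : Γ.Alg (c.φ u)) :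
    ∑ i, (c.algCoord (c.φ u) w) i • c.frame u i = w := by
  let S : Eu (n + m) →L[ℝ] Eu n × Eu m :=
    mfderiv 𝓘(ℝ, Eu (n + m)) 𝓘(ℝ, Eu n × Eu m) c.ψ.symm (Γ.unit (c.φ u))
  have hinj : Function.Injective S := by
    intro a b hab
    have h1 := c.mfderiv_comp_mfderiv_symm (c.zero_mem_source hu) a
    have h2 := c.mfderiv_comp_mfderiv_symm (c.zero_mem_source hu) b
    rw [c.ψ_zero hu] at h1 h2
    exact h1.symm.trans ((congrArg _ hab).trans h2)
  apply Subtype.ext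
  apply hinj
  refine Prod.ext ?_ ?_
  · exact (c.fst_mfderiv_symm_alg hu _).trans (c.fst_mfderiv_symm_alg hu w).symm
  · exact c.algCoord_sum_frame hu _

/-- The frame of the Lie algebroid attached to an adapted chart, as a basis of the fibre. -/
def frameBasis {u : Eu n} (hu : u ∈ c.φ.source) : Module.Basis (Fin m) ℝ (Γ.Alg (c.φ u)) :=
  Module.Basis.ofEquivFun
    { toFun := fun w i => c.algCoord (c.φ u) w i
      map_add' := fun w w' => by ext i; simp
      map_smul' := fun a w => by ext i; simp
      invFun := fun v => ∑ i, v i • c.frame u i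
      left_inv := fun w => c.sum_frame_algCoord hu w
      right_inv := fun v => by
        have := c.algCoord_sum_frame hu (WithLp.toLp 2 v)
        ext i
        exact congrArg (fun z : Eu m => z i) this }

theorem coe_frameBasis {u : Eu n} (hu : u ∈ c.φ.source) : ⇑(c.frameBasis hu) = c.frame u := by
  ext1 i
  rw [frameBasis, Module.Basis.coe_ofEquivFun]
  change ∑ j, (Pi.single i (1 : ℝ) : Fin m → ℝ) j • c.frame u j = _
  simp [Pi.single_apply]

/-! ### The charts of the tangent groupoid -/

/-- The part of the tangent groupoid covered by the chart. -/
def tangentTarget : Set Γ.TangentGroupoid :=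
  {z | match z with
    | .ofNe g _ _ => g ∈ c.ψ.target
    | .ofZero X => X.1 ∈ c.φ.target}

/-- The `v`-coordinate of the chart of the tangent groupoid. -/
def tangentCoord : Γ.TangentGroupoid → Eu m
  | .ofNe g t _ => t⁻¹ • (c.ψ.symm g).2
  | .ofZero X => c.algCoord X.1 X.2

end AdaptedChart

/-- The projection `(r, t)` of the tangent groupoid. -/
def TangentGroupoid.proj : Γ.TangentGroupoid → M × ℝ
  | .ofNe g t _ => (Γ.r g, t)
  | .ofZero X => (X.1, 0)

namespace AdaptedChart

variable (c : Γ.AdaptedChart)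

theorem isOpen_tangentDomain : IsOpen c.tangentDomain :=
  (c.φ.open_source.preimage continuous_fst).inter
    (c.isOpen_V.preimage (continuous_snd.snd.smul continuous_snd.fst))

theorem mem_tangentDomain_zero {u : Eu n} (hu : u ∈ c.φ.source) (v : Eu m) :
    (u, v, (0 : ℝ)) ∈ c.tangentDomain := by
  refine ⟨hu, ?_⟩
  simpa using c.zero_mem

theorem tangentChart_ne {u : Eu n} {v : Eu m} {t : ℝ} (ht : t ≠ 0) :
    c.tangentChart (u, v, t) = .ofNe (c.ψ (u, t • v)) t ht := by
  simp [tangentChart, ht]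

theorem tangentChart_zero {u : Eu n} {v : Eu m} :
    c.tangentChart (u, v, 0) = .ofZero (c.θ u v) := by
  simp [tangentChart]

theorem tangentChart_mem_target {p : Eu n × Eu m × ℝ} (hp : p ∈ c.tangentDomain) :
    c.tangentChart p ∈ c.tangentTarget := by
  obtain ⟨u, v, t⟩ := p
  by_cases ht : t = 0
  · subst ht
    rw [tangentChart_zero]
    exact c.φ.map_source hp.1
  · rw [c.tangentChart_ne ht]
    exact c.ψ.map_source (c.mem_source.2 hp)

theorem tangentCoord_tangentChart {u : Eu n} {v : Eu m} {t : ℝ}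
    (hp : (u, v, t) ∈ c.tangentDomain) : c.tangentCoord (c.tangentChart (u, v, t)) = v := by
  by_cases ht : t = 0
  · subst ht
    rw [tangentChart_zero]
    exact c.algCoord_sum_frame hp.1 v
  · rw [c.tangentChart_ne ht]
    change t⁻¹ • (c.ψ.symm (c.ψ (u, t • v))).2 = v
    rw [c.ψ.left_inv (c.mem_source.2 hp)]
    simp [smul_smul, inv_mul_cancel₀ ht]

theorem proj_tangentChart {u : Eu n} {v : Eu m} {t : ℝ}
    (hp : (u, v, t) ∈ c.tangentDomain) : (c.tangentChart (u, v, t)).proj = (c.φ u, t) := by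
  by_cases ht : t = 0
  · subst ht
    rw [tangentChart_zero]
    rfl
  · rw [c.tangentChart_ne ht]
    change (Γ.r (c.ψ (u, t • v)), t) = _
    rw [c.r_ψ u hp.1 _ hp.2]

theorem proj_mem_target {z : Γ.TangentGroupoid} (hz : z ∈ c.tangentTarget) :
    z.proj.1 ∈ c.φ.target := by
  cases z with
  | ofNe g t ht =>
    change Γ.r g ∈ _
    rw [← c.φ_fst_symm hz]
    exact c.φ.map_source (c.symm_mem hz).1
  | ofZero X => exact hz

theorem tangentChart_tangentCoord {z : Γ.TangentGroupoid} (hz : z ∈ c.tangentTarget) :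
    c.tangentChart (c.φ.symm z.proj.1, c.tangentCoord z, z.proj.2) = z := by
  cases z with
  | ofNe g t ht =>
    change c.tangentChart (c.φ.symm (Γ.r g), t⁻¹ • (c.ψ.symm g).2, t) = _
    rw [c.tangentChart_ne ht, smul_smul, mul_inv_cancel₀ ht, one_smul,
      ← c.φ_fst_symm hz, c.φ.left_inv (c.symm_mem hz).1, Prod.mk.eta]
    congr 1
    exact c.ψ.right_inv hz
  | ofZero X =>
    obtain ⟨x, w⟩ := X
    obtain ⟨u, hu, rfl⟩ : ∃ u ∈ c.φ.source, c.φ u = x :=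
      ⟨c.φ.symm x, c.φ.map_target hz, c.φ.right_inv hz⟩
    change c.tangentChart (c.φ.symm (c.φ u), c.algCoord (c.φ u) w, 0) = _
    rw [c.φ.left_inv hu, tangentChart_zero, θ, c.sum_frame_algCoord hu]

end AdaptedChart

/-! ### Transition maps -/

namespace AdaptedChart

variable (c c' : Γ.AdaptedChart)

/-- The domain of the change of coordinates from `c` to `c'`. -/
def transDomain : Set (Eu n × Eu m) := c.ψ.source ∩ c.ψ ⁻¹' c'.ψ.target

/-- The change of coordinates from `c` to `c'`. -/
def trans (p : Eu n × Eu m) : Eu n × Eu m := c'.ψ.symm (c.ψ p)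

theorem isOpen_transDomain : IsOpen (c.transDomain c') :=
  c.ψ.isOpen_inter_preimage c'.ψ.open_target

theorem contDiffOn_trans : ContDiffOn ℝ ∞ (c.trans c') (c.transDomain c') := by
  rw [← contMDiffOn_iff_contDiffOn]
  exact c'.smooth_ψ_symm.comp (c.smooth_ψ.mono fun p hp => hp.1) (fun p hp => hp.2)

theorem trans_zero {u : Eu n} (hu : (u, (0 : Eu m)) ∈ c.transDomain c') :
    c.trans c' (u, 0) = (c'.φ.symm (c.φ u), 0) := by
  have h1 : c.ψ (u, 0) ∈ c'.ψ.target := hu.2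
  rw [c.ψ_zero (c.mem_source.1 hu.1).1] at h1
  have h2 := c'.unit_mem_target.1 h1
  have h3 := c'.ψ_zero (c'.φ.map_target h2)
  rw [c'.φ.right_inv h2] at h3
  rw [trans, c.ψ_zero (c.mem_source.1 hu.1).1, ← h3,
    c'.ψ.left_inv (c'.zero_mem_source (c'.φ.map_target h2))]

theorem coe_sum_frame {u : Eu n} (hu : u ∈ c.φ.source) (v : Eu m) :
    (∑ i, v i • c.frame u i).1 =
      mfderiv 𝓘(ℝ, Eu n × Eu m) 𝓘(ℝ, Eu (n + m)) c.ψ (u, 0) ((0, v) : Eu n × Eu m) := by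
  have h := c.mfderiv_comp_mfderiv_symm (c.zero_mem_source hu) (∑ i, v i • c.frame u i).1
  rw [c.ψ_zero hu] at h
  rw [← h]
  refine congrArg _ (Prod.ext ?_ ?_)
  · exact c.fst_mfderiv_symm_alg hu _
  · exact c.algCoord_sum_frame hu v

theorem mfderiv_symm_mfderiv {p : Eu n × Eu m} (hp : p ∈ c.transDomain c') (w : Eu n × Eu m) :
    mfderiv 𝓘(ℝ, Eu (n + m)) 𝓘(ℝ, Eu n × Eu m) c'.ψ.symm (c.ψ p)
      (mfderiv 𝓘(ℝ, Eu n × Eu m) 𝓘(ℝ, Eu (n + m)) c.ψ p w) = fderiv ℝ (c.trans c') p w := by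
  have h1 := mfderiv_comp (I := 𝓘(ℝ, Eu n × Eu m)) (I' := 𝓘(ℝ, Eu (n + m)))
    (I'' := 𝓘(ℝ, Eu n × Eu m)) p (c'.mdifferentiableAt_ψ_symm hp.2)
    (c.mdifferentiableAt_ψ hp.1)
  rw [mfderiv_eq_fderiv] at h1
  exact (congrArg (fun T => T w) h1).symm

/-- The `v`-component of the change of coordinates along `(u, t v)`; divided by `t` it is the
`v`-component of the change of coordinates of the tangent groupoid. -/
def transScaled (q : (Eu n × Eu m) × ℝ) : Eu m := (c.trans c' (q.1.1, q.2 • q.1.2)).2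

/-- The domain of the change of coordinates of the tangent groupoid. -/
def transScaledDomain : Set ((Eu n × Eu m) × ℝ) :=
  (fun q : (Eu n × Eu m) × ℝ => (q.1.1, q.2 • q.1.2)) ⁻¹' c.transDomain c'

theorem isOpen_transScaledDomain : IsOpen (c.transScaledDomain c') :=
  (c.isOpen_transDomain c').preimage (by fun_prop)

theorem contDiffOn_transScaled : ContDiffOn ℝ ∞ (c.transScaled c') (c.transScaledDomain c') :=
  ((c.contDiffOn_trans c').comp (f := fun q : (Eu n × Eu m) × ℝ => (q.1.1, q.2 • q.1.2))
    (by fun_prop) (fun _ hq => hq)).snd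

theorem transScaled_zero (e : Eu n × Eu m) (he : (e, (0 : ℝ)) ∈ c.transScaledDomain c') :
    c.transScaled c' (e, 0) = 0 := by
  have h : (e.1, (0 : ℝ) • e.2) ∈ c.transDomain c' := he
  rw [zero_smul] at h
  rw [transScaled]
  simp only [zero_smul]
  rw [c.trans_zero c' h]

theorem tangentChart_mem_target_iff {u : Eu n} {v : Eu m} {t : ℝ}
    (hp : (u, v, t) ∈ c.tangentDomain) :
    c.tangentChart (u, v, t) ∈ c'.tangentTarget ↔ ((u, v), t) ∈ c.transScaledDomain c' := by
  change _ ↔ (u, t • v) ∈ c.ψ.source ∧ c.ψ (u, t • v) ∈ c'.ψ.target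
  rw [and_iff_right (c.mem_source.2 hp)]
  by_cases ht : t = 0
  · subst ht
    rw [tangentChart_zero, zero_smul, c.ψ_zero hp.1, c'.unit_mem_target]
    rfl
  · rw [c.tangentChart_ne ht]
    rfl

/-- The `v`-component of the change of coordinates of the tangent groupoid is `transScaled` divided
by `t`; at `t = 0` this is the differential at the units, as for the frames. -/
theorem tangentCoord_tangentChart_eq_divTime {u : Eu n} {v : Eu m} {t : ℝ}
    (hp : ((u, v), t) ∈ c.transScaledDomain c') :
    c'.tangentCoord (c.tangentChart (u, v, t)) = divTime (c.transScaled c') ((u, v), t) := by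
  by_cases ht : t = 0
  · subst ht
    have hu0 : (u, (0 : ℝ) • v) ∈ c.transDomain c' := hp
    rw [zero_smul] at hu0
    have hu := (c.mem_source.1 hu0.1).1
    rw [tangentChart_zero]
    simp only [divTime, if_true]
    have h1 : HasFDerivAt (c.transScaled c') (fderiv ℝ (c.transScaled c') ((u, v), 0))
        ((u, v), 0) :=
      (((c.contDiffOn_transScaled c').contDiffAt
        ((c.isOpen_transScaledDomain c').mem_nhds hp)).differentiableAt (by simp)).hasFDerivAt
    have h2 : HasDerivAt (fun t : ℝ => (((u, v), t) : (Eu n × Eu m) × ℝ)) (0, 1) 0 :=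
      (hasDerivAt_const 0 _).prodMk (hasDerivAt_id 0)
    have h3 := h1.comp_hasDerivAt (0 : ℝ) h2
    have h4 : HasFDerivAt (c.trans c') (fderiv ℝ (c.trans c') (u, 0)) (u, (0 : ℝ) • v) := by
      rw [zero_smul]
      exact (((c.contDiffOn_trans c').contDiffAt
        ((c.isOpen_transDomain c').mem_nhds hu0)).differentiableAt (by simp)).hasFDerivAt
    have h5 : HasDerivAt (fun t : ℝ => ((u, t • v) : Eu n × Eu m)) (0, v) 0 := by
      simpa using (hasDerivAt_const (0 : ℝ) u).prodMk ((hasDerivAt_id (0 : ℝ)).smul_const v)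
    have h6 := (h4.comp_hasDerivAt (0 : ℝ) h5)
    have h7 : HasDerivAt (fun t : ℝ => (c.trans c' (u, t • v)).2)
        (fderiv ℝ (c.trans c') (u, 0) (0, v)).2 0 :=
      ((ContinuousLinearMap.snd ℝ (Eu n) (Eu m)).hasFDerivAt.comp_hasDerivAt (0 : ℝ) h6)
    let S : Eu (n + m) →L[ℝ] Eu n × Eu m :=
      mfderiv 𝓘(ℝ, Eu (n + m)) 𝓘(ℝ, Eu n × Eu m) c'.ψ.symm (Γ.unit (c.φ u))
    rw [h3.unique h7, ← c.mfderiv_symm_mfderiv c' hu0, c.ψ_zero hu]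
    exact congrArg (fun w : Eu (n + m) => (S w).2) (c.coe_sum_frame hu v)
  · rw [c.tangentChart_ne ht]
    simp [divTime, ht, tangentCoord, transScaled, trans]

/-- The change of coordinates of the tangent groupoid. -/
def tangentTrans (p : Eu n × Eu m × ℝ) : Eu n × Eu m × ℝ :=
  (c'.φ.symm (c.φ p.1), c'.tangentCoord (c.tangentChart p), p.2.2)

theorem tangentChart_tangentTrans {p : Eu n × Eu m × ℝ} (hp : p ∈ c.tangentDomain)
    (hp' : c.tangentChart p ∈ c'.tangentTarget) :
    c'.tangentChart (c.tangentTrans c' p) = c.tangentChart p := by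
  have h := c'.tangentChart_tangentCoord hp'
  rwa [c.proj_tangentChart hp] at h

/-- The part of the domain of the chart of the tangent groupoid that is covered by another
chart. -/
def tangentOverlap : Set (Eu n × Eu m × ℝ) :=
  c.tangentDomain ∩ c.tangentChart ⁻¹' c'.tangentTarget

theorem tangentOverlap_eq : c.tangentOverlap c' =
    c.tangentDomain ∩ (fun p : Eu n × Eu m × ℝ => ((p.1, p.2.1), p.2.2)) ⁻¹'
      c.transScaledDomain c' := by
  ext ⟨u, v, t⟩
  exact and_congr_right fun hp => c.tangentChart_mem_target_iff c' hp

theorem isOpen_tangentOverlap : IsOpen (c.tangentOverlap c') := by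
  rw [tangentOverlap_eq]
  exact c.isOpen_tangentDomain.inter ((c.isOpen_transScaledDomain c').preimage (by fun_prop))

/-- Hadamard's lemma makes the `v`-component of the changes of coordinates of the tangent groupoid
continuously differentiable across `t = 0`. -/
theorem contDiffOn_tangentCoord : ContDiffOn ℝ 1
    (fun p => c'.tangentCoord (c.tangentChart p)) (c.tangentOverlap c') := by
  have h1 := contDiffOn_divTime (c.isOpen_transScaledDomain c') (c.contDiffOn_transScaled c')
    (c.transScaled_zero c')
  rw [tangentOverlap_eq]
  refine (h1.comp (f := fun p : Eu n × Eu m × ℝ => ((p.1, p.2.1), p.2.2)) (by fun_prop)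
    (fun p hp => hp.2)).congr ?_
  rintro ⟨u, v, t⟩ hp
  exact c.tangentCoord_tangentChart_eq_divTime c' hp.2

theorem contDiffOn_tangentTrans :
    ContDiffOn ℝ 1 (c.tangentTrans c') (c.tangentOverlap c') := by
  refine ContDiffOn.prodMk ?_ ((c.contDiffOn_tangentCoord c').prodMk (by fun_prop))
  have h1 : ContDiffOn ℝ ∞ (fun u => c'.φ.symm (c.φ u)) (c.φ.source ∩ c.φ ⁻¹' c'.φ.target) := by
    rw [← contMDiffOn_iff_contDiffOn]
    exact c'.smooth_φ_symm.comp (c.smooth_φ.mono fun p hp => hp.1) (fun p hp => hp.2)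
  refine (h1.of_le (by simp)).comp (f := fun p : Eu n × Eu m × ℝ => p.1) (by fun_prop) ?_
  intro p hp
  have h2 := c'.proj_mem_target hp.2
  rw [c.proj_tangentChart hp.1] at h2
  exact ⟨hp.1.1, h2⟩

/-- The differential at `t = 0` of a function, if it is a multiple of `dt`, does not depend on the
chart of the tangent groupoid. -/
theorem eq_of_hasFDerivAt_smul_dt {h : Γ.TangentGroupoid → ℂ} {u u' : Eu n} {v v' : Eu m}
    {k k' : ℂ} (hu : u ∈ c.φ.source) (hu' : u' ∈ c'.φ.source) (huv : c.θ u v = c'.θ u' v')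
    (hk : HasFDerivAt (fun p : Eu n × Eu m × ℝ => h (c.tangentChart p))
      (k • (Complex.ofRealCLM.comp ((ContinuousLinearMap.snd ℝ (Eu m) ℝ).comp
          (ContinuousLinearMap.snd ℝ (Eu n) (Eu m × ℝ))))) (u, v, 0))
    (hk' : HasFDerivAt (fun p : Eu n × Eu m × ℝ => h (c'.tangentChart p))
      (k' • (Complex.ofRealCLM.comp ((ContinuousLinearMap.snd ℝ (Eu m) ℝ).comp
          (ContinuousLinearMap.snd ℝ (Eu n) (Eu m × ℝ))))) (u', v', 0)) : k = k' := by
  -- Both derivatives are taken along `t ↦ (u, v, t)`, whose image under the change of coordinates has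
  -- velocity with `t`-component `1`.
  have hdom := c.mem_tangentDomain_zero hu v
  have hp : (u, v, (0 : ℝ)) ∈ c.tangentOverlap c' := by
    refine ⟨hdom, ?_⟩
    change c.tangentChart (u, v, 0) ∈ c'.tangentTarget
    rw [tangentChart_zero, huv, ← tangentChart_zero]
    exact c'.tangentChart_mem_target (c'.mem_tangentDomain_zero hu' v')
  have hτ : c.tangentTrans c' (u, v, 0) = (u', v', 0) := by
    refine Prod.ext ?_ (Prod.ext ?_ rfl)
    · change c'.φ.symm (c.φ u) = u'
      have h1 : c.φ u = c'.φ u' := congrArg Sigma.fst huv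
      rw [h1, c'.φ.left_inv hu']
    · change c'.tangentCoord (c.tangentChart (u, v, 0)) = v'
      rw [tangentChart_zero, huv, ← tangentChart_zero,
        c'.tangentCoord_tangentChart (c'.mem_tangentDomain_zero hu' v')]
  have hd : HasFDerivAt (c.tangentTrans c') (fderiv ℝ (c.tangentTrans c') (u, v, 0)) (u, v, 0) :=
    (((c.contDiffOn_tangentTrans c').contDiffAt
      ((c.isOpen_tangentOverlap c').mem_nhds hp)).differentiableAt (by simp)).hasFDerivAt
  have hline : HasDerivAt (fun t : ℝ => ((u, v, t) : Eu n × Eu m × ℝ)) (0, 0, 1) 0 :=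
    (hasDerivAt_const _ _).prodMk ((hasDerivAt_const _ _).prodMk (hasDerivAt_id _))
  have hc := hd.comp_hasDerivAt (0 : ℝ) hline
  have ht : (fderiv ℝ (c.tangentTrans c') (u, v, 0) (0, 0, 1)).2.2 = 1 := by
    have h1 := (hasFDerivAt_snd.comp_hasDerivAt (0 : ℝ) hc)
    have h2 := (hasFDerivAt_snd.comp_hasDerivAt (0 : ℝ) h1)
    exact h2.unique (hasDerivAt_id (0 : ℝ))
  rw [← hτ] at hk'
  have h1 := hk'.comp_hasDerivAt (0 : ℝ) hc
  have h2 := hk.comp_hasDerivAt (0 : ℝ) hline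
  have h3 : (fun t : ℝ => h (c.tangentChart (u, v, t))) =ᶠ[𝓝 0]
      fun t => h (c'.tangentChart (c.tangentTrans c' (u, v, t))) := by
    filter_upwards [hline.continuousAt.preimage_mem_nhds
      ((c.isOpen_tangentOverlap c').mem_nhds hp)] with t ht
    rw [c.tangentChart_tangentTrans c' ht.1 ht.2]
  have h4 := h2.unique (h1.congr_of_eventuallyEq h3)
  simpa [ht] using h4

end AdaptedChart

/-! ### The topology of the tangent groupoid and compact supports -/

theorem t2Space_base [T2Space G] (Γ : LieGroupoid n m G M) : T2Space M :=
  T2Space.of_injective_continuous (f := Γ.unit)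
    (fun x y h => by rw [← Γ.r_unit x, h, Γ.r_unit]) Γ.contMDiff_unit.continuous

theorem isOpen_tangentGroupoid {O : Set Γ.TangentGroupoid}
    (h1 : IsOpen {p : G × ℝ | ∃ h : p.2 ≠ 0, TangentGroupoid.ofNe p.1 p.2 h ∈ O})
    (h2 : ∀ c : Γ.AdaptedChart, IsOpen (c.tangentDomain ∩ c.tangentChart ⁻¹' O)) : IsOpen O := by
  refine isOpen_sup.2 ⟨?_, isOpen_iSup_iff.2 fun c => ?_⟩
  · rw [isOpen_coinduced]
    convert h1.preimage continuous_subtype_val using 1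
    ext p
    exact ⟨fun h => ⟨p.2, h⟩, fun ⟨_, h⟩ => h⟩
  · rw [isOpen_coinduced]
    convert (h2 c).preimage continuous_subtype_val using 1
    ext p
    exact ⟨fun h => ⟨p.2, h⟩, fun h => h.2⟩

theorem TangentGroupoid.continuous_proj :
    Continuous (TangentGroupoid.proj : Γ.TangentGroupoid → M × ℝ) := by
  rw [continuous_def]
  intro O hO
  refine isOpen_tangentGroupoid ?_ fun c => ?_
  · have h1 : Continuous (fun p : G × ℝ => (Γ.r p.1, p.2)) :=
      (Γ.contMDiff_r.continuous.comp continuous_fst).prodMk continuous_snd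
    convert (hO.preimage h1).inter (isOpen_ne.preimage (continuous_snd : Continuous
      (Prod.snd : G × ℝ → ℝ)) : IsOpen (Prod.snd ⁻¹' {t : ℝ | t ≠ 0})) using 1
    ext p
    exact ⟨fun ⟨h, h'⟩ => ⟨h', h⟩, fun ⟨h, h'⟩ => ⟨h', h⟩⟩
  · have h1 : ContinuousOn (fun p : Eu n × Eu m × ℝ => (c.φ p.1, p.2.2)) c.tangentDomain :=
      (c.φ.continuousOn.comp continuousOn_fst fun p hp => hp.1).prodMk
        (by fun_prop)
    convert h1.isOpen_inter_preimage c.isOpen_tangentDomain hO using 1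
    ext ⟨u, v, t⟩
    refine and_congr_right fun hp => ?_
    simp only [Set.mem_preimage]
    rw [c.proj_tangentChart hp]

namespace AdaptedChart

variable (c : Γ.AdaptedChart)

/-- The points of the tangent groupoid with `‖v‖ < R` in a chart form an open set. -/
theorem isOpen_tangentBall (R : ℝ) :
    IsOpen (c.tangentTarget ∩ {z : Γ.TangentGroupoid | ‖c.tangentCoord z‖ < R}) := by
  refine isOpen_tangentGroupoid ?_ fun c' => ?_
  · have h1 : ContinuousOn (fun p : G × ℝ => p.2⁻¹ • (c.ψ.symm p.1).2)
        ((c.ψ.target : Set G) ×ˢ {t : ℝ | t ≠ 0}) :=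
      (continuousOn_snd.inv₀ fun p hp => hp.2).smul
        ((c.ψ.symm.continuousOn.comp continuousOn_fst fun p hp => hp.1).snd)
    convert h1.isOpen_inter_preimage (c.ψ.open_target.prod isOpen_ne)
      (Metric.isOpen_ball (x := (0 : Eu m)) (ε := R)) using 1
    ext p
    simp only [Set.mem_inter_iff, Set.mem_preimage, mem_ball_zero_iff]
    exact ⟨fun ⟨h, h'⟩ => ⟨⟨h'.1, h⟩, h'.2⟩, fun ⟨h, h'⟩ => ⟨h.2, h.1, h'⟩⟩
  · have h1 := (c'.contDiffOn_tangentCoord c).continuousOn.isOpen_inter_preimage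
      (c'.isOpen_tangentOverlap c) (Metric.isOpen_ball (x := (0 : Eu m)) (ε := R))
    have h2 : c'.tangentDomain ∩ c'.tangentChart ⁻¹'
        (c.tangentTarget ∩ {z : Γ.TangentGroupoid | ‖c.tangentCoord z‖ < R}) =
        c'.tangentOverlap c ∩ (fun p => c.tangentCoord (c'.tangentChart p)) ⁻¹'
          Metric.ball (0 : Eu m) R := by
      ext p
      simp only [Set.mem_inter_iff, Set.mem_preimage, mem_ball_zero_iff, tangentOverlap,
        Set.mem_ofPred_eq, and_assoc]
    rwa [h2]

/-- Over a neighbourhood of a point of `M` and for small `t`, the support of a compactly supported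
function lies in the chart, with bounded `v`-coordinate: by compactness, since this is so near
each point of the support. -/
theorem exists_support_bound [T2Space M] {f : Γ.TangentGroupoid → ℂ} (hf : HasCompactSupport f)
    {u₀ : Eu n} (hu₀ : u₀ ∈ c.φ.source) :
    ∃ δ > 0, ∃ R > 0, Metric.ball u₀ δ ⊆ c.φ.source ∧
      ∀ z, f z ≠ 0 → ∀ u ∈ Metric.ball u₀ δ, ∀ t : ℝ, |t| < δ → z.proj = (c.φ u, t) →
        z ∈ c.tangentTarget ∧ ‖c.tangentCoord z‖ < R := by
  obtain ⟨N, hN, R, hNR⟩ : ∃ N ∈ 𝓝 (c.φ u₀, (0 : ℝ)), ∃ R : ℝ, ∀ z ∈ tsupport f, z.proj ∈ N →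
      z ∈ c.tangentTarget ∧ ‖c.tangentCoord z‖ < R := by
    refine hf.isCompact.induction_on (p := fun S => ∃ N ∈ 𝓝 (c.φ u₀, (0 : ℝ)), ∃ R : ℝ, ∀ z ∈ S,
      z.proj ∈ N → z ∈ c.tangentTarget ∧ ‖c.tangentCoord z‖ < R) ?_ ?_ ?_ ?_
    · exact ⟨Set.univ, Filter.univ_mem, 0, fun z hz => hz.elim⟩
    · rintro S T hST ⟨N, hN, R, h⟩
      exact ⟨N, hN, R, fun z hz => h z (hST hz)⟩
    · rintro S T ⟨N, hN, R, h⟩ ⟨N', hN', R', h'⟩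
      refine ⟨N ∩ N', Filter.inter_mem hN hN', max R R', ?_⟩
      rintro z (hz | hz) hzN
      · exact ⟨(h z hz hzN.1).1, (h z hz hzN.1).2.trans_le (le_max_left _ _)⟩
      · exact ⟨(h' z hz hzN.2).1, (h' z hz hzN.2).2.trans_le (le_max_right _ _)⟩
    · intro z _
      -- A point over `(φ u₀, 0)` has a neighbourhood with bounded `v`; any other point has a
      -- neighbourhood whose projection avoids a neighbourhood of `(φ u₀, 0)`.
      by_cases hz : z.proj = (c.φ u₀, 0)
      · have hmem : z ∈ c.tangentTarget := by
          cases z with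
          | ofNe g t ht => exact absurd (congrArg Prod.snd hz) ht
          | ofZero X =>
            change X.1 ∈ c.φ.target
            rw [show X.1 = c.φ u₀ from congrArg Prod.fst hz]
            exact c.φ.map_source hu₀
        refine ⟨_, mem_nhdsWithin_of_mem_nhds ((c.isOpen_tangentBall
          (‖c.tangentCoord z‖ + 1)).mem_nhds ⟨hmem, lt_add_one ‖c.tangentCoord z‖⟩), Set.univ,
          Filter.univ_mem, ‖c.tangentCoord z‖ + 1, fun z' hz' _ => hz'⟩
      · obtain ⟨A, B, hA, hB, hzA, hB0, hAB⟩ := t2_separation hz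
        refine ⟨_, mem_nhdsWithin_of_mem_nhds ((hA.preimage
          TangentGroupoid.continuous_proj).mem_nhds hzA), B, hB.mem_nhds hB0, 0, ?_⟩
        exact fun z' hz' hz'' => (Set.disjoint_left.1 hAB hz' hz'').elim
  have hcont : ContinuousAt (fun p : Eu n × ℝ => (c.φ p.1, p.2)) (u₀, 0) :=
    (ContinuousAt.comp (x := (u₀, (0 : ℝ))) (f := Prod.fst)
      (c.φ.continuousAt hu₀) continuousAt_fst).prodMk continuousAt_snd
  have hnear : ∀ᶠ p : Eu n × ℝ in 𝓝 (u₀, 0), (c.φ p.1, p.2) ∈ N ∧ p.1 ∈ c.φ.source :=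
    (hcont.eventually hN).and (continuousAt_fst.eventually (c.φ.open_source.mem_nhds hu₀))
  obtain ⟨δ, hδ, hδN⟩ := Metric.eventually_nhds_iff_ball.1 hnear
  refine ⟨δ, hδ, max R 1, lt_max_of_lt_right one_pos, fun u hu => ?_, fun z hz u hu t ht hzp => ?_⟩
  · exact (hδN (u, 0) (by rw [← ball_prod_same]; exact ⟨hu, Metric.mem_ball_self hδ⟩)).2
  · have h1 := hNR z (subset_tsupport f hz) (by
      rw [hzp]
      exact (hδN (u, t) (by
        rw [← ball_prod_same]; exact ⟨hu, by simpa using ht⟩)).1)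
    exact ⟨h1.1, h1.2.trans_le (le_max_left _ _)⟩

end AdaptedChart

/-! ### The groupoid operations in an adapted chart -/

theorem inv_mul_cancel_left' (g h : G) (hgh : Γ.s g = Γ.r h) :
    Γ.mul (Γ.inv g) (Γ.mul g h) = h := by
  rw [← Γ.mul_assoc _ _ _ (Γ.s_inv g) hgh, Γ.inv_mul, hgh, Γ.unit_mul]

theorem inv_unit (x : M) : Γ.inv (Γ.unit x) = Γ.unit x := by
  have h := Γ.mul_inv (Γ.unit x)
  have h1 := Γ.unit_mul (Γ.inv (Γ.unit x))
  rw [Γ.r_inv, Γ.s_unit] at h1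
  rw [h1, Γ.r_unit] at h
  exact h

namespace AdaptedChart

variable (c : Γ.AdaptedChart)

/-- The source map in the coordinates of an adapted chart. -/
def src (p : Eu n × Eu m) : Eu n := c.φ.symm (Γ.s (c.ψ p))

/-- The points of the chart whose source lies in `φ(U)`. -/
def srcDomain : Set (Eu n × Eu m) := c.ψ.source ∩ (fun p => Γ.s (c.ψ p)) ⁻¹' c.φ.target

theorem isOpen_srcDomain : IsOpen c.srcDomain :=
  c.ψ.isOpen_inter_preimage (c.φ.open_target.preimage Γ.contMDiff_s.continuous)

theorem contDiffOn_src : ContDiffOn ℝ ∞ c.src c.srcDomain := by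
  rw [← contMDiffOn_iff_contDiffOn]
  exact c.smooth_φ_symm.comp (Γ.contMDiff_s.comp_contMDiffOn (c.smooth_ψ.mono fun p hp => hp.1))
    (fun p hp => hp.2)

theorem zero_mem_srcDomain {u : Eu n} (hu : u ∈ c.φ.source) : (u, (0 : Eu m)) ∈ c.srcDomain := by
  refine ⟨c.zero_mem_source hu, ?_⟩
  change Γ.s (c.ψ (u, 0)) ∈ c.φ.target
  rw [c.ψ_zero hu, Γ.s_unit]
  exact c.φ.map_source hu

theorem src_zero {u : Eu n} (hu : u ∈ c.φ.source) : c.src (u, 0) = u := by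
  rw [src, c.ψ_zero hu, Γ.s_unit, c.φ.left_inv hu]

theorem src_mem {p : Eu n × Eu m} (hp : p ∈ c.srcDomain) : c.src p ∈ c.φ.source :=
  c.φ.map_target hp.2

theorem φ_src {p : Eu n × Eu m} (hp : p ∈ c.srcDomain) : c.φ (c.src p) = Γ.s (c.ψ p) :=
  c.φ.right_inv hp.2

/-- The element `ψ(u, y)⁻¹ ψ(u, x)`. -/
def quotElt (p : Eu n × Eu m × Eu m) : G :=
  Γ.mul (Γ.inv (c.ψ (p.1, p.2.1))) (c.ψ (p.1, p.2.2))

/-- The coordinates of `ψ(u, y)⁻¹ ψ(u, x)`. -/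
def quot (p : Eu n × Eu m × Eu m) : Eu n × Eu m := c.ψ.symm (c.quotElt p)

/-- The triples `(u, y, x)` for which `ψ(u, y)⁻¹ ψ(u, x)` lies in the chart. -/
def quotDomain : Set (Eu n × Eu m × Eu m) :=
  (c.φ.source ×ˢ c.V ×ˢ c.V) ∩ c.quotElt ⁻¹' c.ψ.target

theorem contMDiffOn_quotElt : ContMDiffOn 𝓘(ℝ, Eu n × Eu m × Eu m) 𝓘(ℝ, Eu (n + m)) ∞
    c.quotElt (c.φ.source ×ˢ c.V ×ˢ c.V) := by
  have h1 : ContMDiffOn 𝓘(ℝ, Eu n × Eu m × Eu m) 𝓘(ℝ, Eu (n + m)) ∞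
      (fun p : Eu n × Eu m × Eu m => c.ψ (p.1, p.2.1)) (c.φ.source ×ˢ c.V ×ˢ c.V) :=
    c.smooth_ψ.comp (f := fun p : Eu n × Eu m × Eu m => (p.1, p.2.1))
      (contMDiffOn_iff_contDiffOn.2 (by fun_prop)) (fun p hp => c.mem_source.2 ⟨hp.1, hp.2.1⟩)
  have h2 : ContMDiffOn 𝓘(ℝ, Eu n × Eu m × Eu m) 𝓘(ℝ, Eu (n + m)) ∞
      (fun p : Eu n × Eu m × Eu m => c.ψ (p.1, p.2.2)) (c.φ.source ×ˢ c.V ×ˢ c.V) :=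
    c.smooth_ψ.comp (f := fun p : Eu n × Eu m × Eu m => (p.1, p.2.2))
      (contMDiffOn_iff_contDiffOn.2 (by fun_prop)) (fun p hp => c.mem_source.2 ⟨hp.1, hp.2.2⟩)
  refine Γ.contMDiffOn_mul.comp ((Γ.contMDiff_inv.comp_contMDiffOn h1).prodMk h2) ?_
  intro p hp
  change Γ.s (Γ.inv (c.ψ (p.1, p.2.1))) = Γ.r (c.ψ (p.1, p.2.2))
  rw [Γ.s_inv, c.r_ψ _ hp.1 _ hp.2.1, c.r_ψ _ hp.1 _ hp.2.2]

theorem isOpen_quotDomain : IsOpen c.quotDomain :=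
  c.contMDiffOn_quotElt.continuousOn.isOpen_inter_preimage
    (c.φ.open_source.prod (c.isOpen_V.prod c.isOpen_V)) c.ψ.open_target

theorem contDiffOn_quot : ContDiffOn ℝ ∞ c.quot c.quotDomain := by
  rw [← contMDiffOn_iff_contDiffOn]
  exact c.smooth_ψ_symm.comp (c.contMDiffOn_quotElt.mono fun p hp => hp.1) (fun p hp => hp.2)

theorem r_quotElt {p : Eu n × Eu m × Eu m} (hp : p ∈ c.φ.source ×ˢ c.V ×ˢ c.V) :
    Γ.r (c.quotElt p) = Γ.s (c.ψ (p.1, p.2.1)) := by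
  rw [quotElt, Γ.r_mul _ _ (by rw [Γ.s_inv, c.r_ψ _ hp.1 _ hp.2.1, c.r_ψ _ hp.1 _ hp.2.2]),
    Γ.r_inv]

theorem ψ_quot {p : Eu n × Eu m × Eu m} (hp : p ∈ c.quotDomain) : c.ψ (c.quot p) = c.quotElt p :=
  c.ψ.right_inv hp.2

theorem quot_mem {p : Eu n × Eu m × Eu m} (hp : p ∈ c.quotDomain) : c.quot p ∈ c.ψ.source :=
  c.ψ.map_target hp.2

theorem mem_srcDomain_of_mem_quotDomain {p : Eu n × Eu m × Eu m} (hp : p ∈ c.quotDomain) :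
    (p.1, p.2.1) ∈ c.srcDomain := by
  refine ⟨c.mem_source.2 ⟨hp.1.1, hp.1.2.1⟩, ?_⟩
  change Γ.s (c.ψ (p.1, p.2.1)) ∈ c.φ.target
  rw [← c.r_quotElt hp.1, ← c.φ_fst_symm hp.2]
  exact c.φ.map_source (c.symm_mem hp.2).1

theorem fst_quot {p : Eu n × Eu m × Eu m} (hp : p ∈ c.quotDomain) :
    (c.quot p).1 = c.src (p.1, p.2.1) := by
  rw [src, ← c.r_quotElt hp.1, ← c.φ_fst_symm hp.2, c.φ.left_inv (c.symm_mem hp.2).1]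
  rfl

theorem quotElt_diag {u : Eu n} {y : Eu m} : c.quotElt (u, y, y) = Γ.unit (Γ.s (c.ψ (u, y))) :=
  Γ.inv_mul _

theorem diag_mem_quotDomain {p : Eu n × Eu m} (hp : p ∈ c.srcDomain) :
    (p.1, p.2, p.2) ∈ c.quotDomain := by
  have h := c.mem_source.1 hp.1
  refine ⟨⟨h.1, h.2, h.2⟩, ?_⟩
  change c.quotElt (p.1, p.2, p.2) ∈ c.ψ.target
  rw [quotElt_diag, c.unit_mem_target]
  exact hp.2

theorem quot_diag {p : Eu n × Eu m} (hp : p ∈ c.srcDomain) :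
    c.quot (p.1, p.2, p.2) = (c.src p, 0) := by
  rw [quot, quotElt_diag, ← c.φ_src hp, ← c.ψ_zero (c.src_mem hp),
    c.ψ.left_inv (c.zero_mem_source (c.src_mem hp))]

theorem quotElt_zero {u : Eu n} {x : Eu m} (h : (u, x) ∈ c.ψ.source) :
    c.quotElt (u, 0, x) = c.ψ (u, x) := by
  have hux := c.mem_source.1 h
  change Γ.mul (Γ.inv (c.ψ (u, 0))) (c.ψ (u, x)) = _
  rw [c.ψ_zero hux.1, inv_unit, ← c.r_ψ u hux.1 x hux.2, Γ.unit_mul]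

theorem zero_mem_quotDomain {u : Eu n} {x : Eu m} (h : (u, x) ∈ c.ψ.source) :
    (u, (0 : Eu m), x) ∈ c.quotDomain := by
  have hux := c.mem_source.1 h
  refine ⟨⟨hux.1, c.zero_mem, hux.2⟩, ?_⟩
  change c.quotElt (u, 0, x) ∈ c.ψ.target
  rw [c.quotElt_zero h]
  exact c.ψ.map_source h

theorem quot_zero {u : Eu n} {x : Eu m} (h : (u, x) ∈ c.ψ.source) :
    c.quot (u, 0, x) = (u, x) := by
  rw [quot, c.quotElt_zero h, c.ψ.left_inv h]

/-- The element `ψ(u, y) ψ(σ(u, y), w)`, where `σ(u, y)` is the source of `ψ(u, y)`. -/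
def prodElt (p : Eu n × Eu m × Eu m) : G :=
  Γ.mul (c.ψ (p.1, p.2.1)) (c.ψ (c.src (p.1, p.2.1), p.2.2))

/-- The `v`-component of the coordinates of `ψ(u, y) ψ(σ(u, y), w)`. -/
def prodSnd (p : Eu n × Eu m × Eu m) : Eu m := (c.ψ.symm (c.prodElt p)).2

/-- The triples `(u, y, w)` for which `ψ(u, y)` and `ψ(σ(u, y), w)` are defined. -/
def preProdDomain : Set (Eu n × Eu m × Eu m) :=
  {p | (p.1, p.2.1) ∈ c.srcDomain ∧ p.2.2 ∈ c.V}

/-- The triples `(u, y, w)` for which `ψ(u, y) ψ(σ(u, y), w)` lies in the chart. -/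
def prodDomain : Set (Eu n × Eu m × Eu m) := c.preProdDomain ∩ c.prodElt ⁻¹' c.ψ.target

theorem isOpen_preProdDomain : IsOpen c.preProdDomain :=
  (c.isOpen_srcDomain.preimage (f := fun p : Eu n × Eu m × Eu m => (p.1, p.2.1))
    (by fun_prop)).inter (c.isOpen_V.preimage continuous_snd.snd)

theorem s_eq_r_prodElt {p : Eu n × Eu m × Eu m} (hp : p ∈ c.preProdDomain) :
    Γ.s (c.ψ (p.1, p.2.1)) = Γ.r (c.ψ (c.src (p.1, p.2.1), p.2.2)) := by
  rw [c.r_ψ _ (c.src_mem hp.1) _ hp.2, c.φ_src hp.1]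

theorem contMDiffOn_prodElt : ContMDiffOn 𝓘(ℝ, Eu n × Eu m × Eu m) 𝓘(ℝ, Eu (n + m)) ∞
    c.prodElt c.preProdDomain := by
  have h1 : ContMDiffOn 𝓘(ℝ, Eu n × Eu m × Eu m) 𝓘(ℝ, Eu (n + m)) ∞
      (fun p : Eu n × Eu m × Eu m => c.ψ (p.1, p.2.1)) c.preProdDomain :=
    c.smooth_ψ.comp (f := fun p : Eu n × Eu m × Eu m => (p.1, p.2.1))
      (contMDiffOn_iff_contDiffOn.2 (by fun_prop)) (fun p hp => hp.1.1)
  have h2 : ContMDiffOn 𝓘(ℝ, Eu n × Eu m × Eu m) 𝓘(ℝ, Eu (n + m)) ∞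
      (fun p : Eu n × Eu m × Eu m => c.ψ (c.src (p.1, p.2.1), p.2.2)) c.preProdDomain := by
    refine c.smooth_ψ.comp
      (f := fun p : Eu n × Eu m × Eu m => (c.src (p.1, p.2.1), p.2.2))
      (contMDiffOn_iff_contDiffOn.2 (ContDiffOn.prodMk ?_ (by fun_prop)))
      (fun p hp => c.mem_source.2 ⟨c.src_mem hp.1, hp.2⟩)
    exact c.contDiffOn_src.comp (f := fun p : Eu n × Eu m × Eu m => (p.1, p.2.1))
      (by fun_prop) (fun p hp => hp.1)
  exact Γ.contMDiffOn_mul.comp (h1.prodMk h2) (fun p hp => c.s_eq_r_prodElt hp)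

theorem isOpen_prodDomain : IsOpen c.prodDomain :=
  c.contMDiffOn_prodElt.continuousOn.isOpen_inter_preimage c.isOpen_preProdDomain c.ψ.open_target

theorem contDiffOn_prodSnd : ContDiffOn ℝ ∞ c.prodSnd c.prodDomain := by
  have h : ContDiffOn ℝ ∞ (fun p => c.ψ.symm (c.prodElt p)) c.prodDomain := by
    rw [← contMDiffOn_iff_contDiffOn]
    exact c.smooth_ψ_symm.comp (c.contMDiffOn_prodElt.mono fun p hp => hp.1) (fun p hp => hp.2)
  exact h.snd

theorem r_prodElt {p : Eu n × Eu m × Eu m} (hp : p ∈ c.preProdDomain) :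
    Γ.r (c.prodElt p) = c.φ p.1 := by
  rw [prodElt, Γ.r_mul _ _ (c.s_eq_r_prodElt hp), c.r_ψ _ (c.mem_source.1 hp.1.1).1 _
    (c.mem_source.1 hp.1.1).2]

theorem symm_prodElt {p : Eu n × Eu m × Eu m} (hp : p ∈ c.prodDomain) :
    c.ψ.symm (c.prodElt p) = (p.1, c.prodSnd p) := by
  refine Prod.ext ?_ rfl
  have h := c.φ_fst_symm hp.2
  rw [c.r_prodElt hp.1] at h
  exact c.φ.injOn (c.symm_mem hp.2).1 (c.mem_source.1 hp.1.1.1).1 h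

theorem ψ_prodSnd {p : Eu n × Eu m × Eu m} (hp : p ∈ c.prodDomain) :
    c.ψ (p.1, c.prodSnd p) = c.prodElt p := by
  rw [← c.symm_prodElt hp, c.ψ.right_inv hp.2]

theorem prodElt_zero {p : Eu n × Eu m} (hp : p ∈ c.srcDomain) :
    c.prodElt (p.1, p.2, 0) = c.ψ p := by
  change Γ.mul (c.ψ p) (c.ψ (c.src p, 0)) = _
  rw [c.ψ_zero (c.src_mem hp), c.φ_src hp, Γ.mul_unit]

theorem zero_mem_prodDomain {p : Eu n × Eu m} (hp : p ∈ c.srcDomain) :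
    (p.1, p.2, (0 : Eu m)) ∈ c.prodDomain := by
  refine ⟨⟨hp, c.zero_mem⟩, ?_⟩
  change c.prodElt (p.1, p.2, 0) ∈ c.ψ.target
  rw [c.prodElt_zero hp]
  exact c.ψ.map_source hp.1

theorem prodSnd_zero {p : Eu n × Eu m} (hp : p ∈ c.srcDomain) :
    c.prodSnd (p.1, p.2, 0) = p.2 := by
  rw [prodSnd, c.prodElt_zero hp, c.ψ.left_inv hp.1]

theorem quotElt_prodSnd {p : Eu n × Eu m × Eu m} (hp : p ∈ c.prodDomain) :
    c.quotElt (p.1, p.2.1, c.prodSnd p) = c.ψ (c.src (p.1, p.2.1), p.2.2) := by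
  rw [quotElt]
  simp only
  rw [c.ψ_prodSnd hp, prodElt, inv_mul_cancel_left' _ _ (c.s_eq_r_prodElt hp.1)]

theorem quot_prodSnd {p : Eu n × Eu m × Eu m} (hp : p ∈ c.prodDomain) :
    c.quot (p.1, p.2.1, c.prodSnd p) = (c.src (p.1, p.2.1), p.2.2) := by
  rw [quot, c.quotElt_prodSnd hp,
    c.ψ.left_inv (c.mem_source.2 ⟨c.src_mem hp.1.1, hp.1.2⟩)]

/-- The inclusion `w ↦ (0, 0, w)`. -/
def inThird : Eu m →L[ℝ] Eu n × Eu m × Eu m :=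
  (ContinuousLinearMap.inr ℝ (Eu n) (Eu m × Eu m)).comp (ContinuousLinearMap.inr ℝ (Eu m) (Eu m))

/-- The differential at `x = y` of the `v`-component of `ψ(u, y)⁻¹ ψ(u, x)`: the left translation
by `ψ(u, y)⁻¹` on vectors tangent to the fibres of `r`, in the coordinates. -/
def quotDeriv (p : Eu n × Eu m) : Eu m →L[ℝ] Eu m :=
  (fderiv ℝ (fun q => (c.quot q).2) (p.1, p.2, p.2)).comp inThird

/-- The differential at `w = 0` of the `v`-component of `ψ(u, y) ψ(σ(u, y), w)`: the matrix of the
left-invariant vector fields in the coordinates `(u, v)`. -/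
def prodDeriv (p : Eu n × Eu m) : Eu m →L[ℝ] Eu m :=
  (fderiv ℝ c.prodSnd (p.1, p.2, 0)).comp inThird

theorem contDiffOn_quotDeriv : ContDiffOn ℝ ∞ c.quotDeriv c.srcDomain := by
  have h1 : ContDiffOn ℝ ∞ (fderiv ℝ (fun q => (c.quot q).2)) c.quotDomain :=
    c.contDiffOn_quot.snd.fderiv_of_isOpen c.isOpen_quotDomain (by simp)
  exact (h1.comp (f := fun p : Eu n × Eu m => (p.1, p.2, p.2)) (by fun_prop)
    (fun p hp => c.diag_mem_quotDomain hp)).clm_comp contDiffOn_const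

theorem contDiffOn_prodDeriv : ContDiffOn ℝ ∞ c.prodDeriv c.srcDomain := by
  have h1 : ContDiffOn ℝ ∞ (fderiv ℝ c.prodSnd) c.prodDomain :=
    c.contDiffOn_prodSnd.fderiv_of_isOpen c.isOpen_prodDomain (by simp)
  exact (h1.comp (f := fun p : Eu n × Eu m => (p.1, p.2, (0 : Eu m))) (by fun_prop)
    (fun p hp => c.zero_mem_prodDomain hp)).clm_comp contDiffOn_const

theorem hasFDerivAt_inThird (u : Eu n) (y x : Eu m) :
    HasFDerivAt (fun w : Eu m => ((u, y, w) : Eu n × Eu m × Eu m)) inThird x :=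
  (hasFDerivAt_prodMk_right u (y, x)).comp x (hasFDerivAt_prodMk_right y x)

theorem hasFDerivAt_quot_snd {p : Eu n × Eu m × Eu m} (hp : p ∈ c.quotDomain) :
    HasFDerivAt (fun q => (c.quot q).2) (fderiv ℝ (fun q => (c.quot q).2) p) p :=
  ((c.contDiffOn_quot.snd.contDiffAt (c.isOpen_quotDomain.mem_nhds hp)).differentiableAt
    (by simp)).hasFDerivAt

theorem hasFDerivAt_prodSnd {p : Eu n × Eu m × Eu m} (hp : p ∈ c.prodDomain) :
    HasFDerivAt c.prodSnd (fderiv ℝ c.prodSnd p) p :=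
  ((c.contDiffOn_prodSnd.contDiffAt (c.isOpen_prodDomain.mem_nhds hp)).differentiableAt
    (by simp)).hasFDerivAt

/-- The translations by `ψ(u, y)⁻¹` and by `ψ(u, y)` are inverse to each other. -/
theorem quotDeriv_comp_prodDeriv {p : Eu n × Eu m} (hp : p ∈ c.srcDomain) :
    (c.quotDeriv p).comp (c.prodDeriv p) = ContinuousLinearMap.id ℝ (Eu m) := by
  have h1 : HasFDerivAt (fun w : Eu m => c.prodSnd (p.1, p.2, w)) (c.prodDeriv p) 0 :=
    HasFDerivAt.comp (g := c.prodSnd) (f := fun w : Eu m => (p.1, p.2, w)) (0 : Eu m)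
      (c.hasFDerivAt_prodSnd (c.zero_mem_prodDomain hp)) (hasFDerivAt_inThird p.1 p.2 0)
  have h2 : HasFDerivAt (fun x : Eu m => (c.quot (p.1, p.2, x)).2) (c.quotDeriv p)
      (c.prodSnd (p.1, p.2, 0)) := by
    rw [c.prodSnd_zero hp]
    exact (c.hasFDerivAt_quot_snd (c.diag_mem_quotDomain hp)).comp p.2
      (hasFDerivAt_inThird p.1 p.2 p.2)
  have h3 := h2.comp (0 : Eu m) h1
  refine h3.unique ((hasFDerivAt_id (𝕜 := ℝ) (0 : Eu m)).congr_of_eventuallyEq ?_)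
  have hc : ContinuousAt (fun w : Eu m => ((p.1, p.2, w) : Eu n × Eu m × Eu m)) 0 := by fun_prop
  filter_upwards [hc.preimage_mem_nhds (c.isOpen_prodDomain.mem_nhds (c.zero_mem_prodDomain hp))]
    with w hw
  change (c.quot (p.1, p.2, c.prodSnd (p.1, p.2, w))).2 = w
  rw [c.quot_prodSnd (p := (p.1, p.2, w)) hw]

theorem quotDeriv_zero {u : Eu n} (hu : u ∈ c.φ.source) :
    c.quotDeriv (u, 0) = ContinuousLinearMap.id ℝ (Eu m) := by
  have h2 : HasFDerivAt (fun x : Eu m => (c.quot (u, 0, x)).2) (c.quotDeriv (u, 0)) 0 :=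
    HasFDerivAt.comp (g := fun q => (c.quot q).2) (f := fun w : Eu m => (u, (0 : Eu m), w))
      (0 : Eu m) (c.hasFDerivAt_quot_snd (c.diag_mem_quotDomain (c.zero_mem_srcDomain hu)))
      (hasFDerivAt_inThird u 0 0)
  refine h2.unique ((hasFDerivAt_id (𝕜 := ℝ) (0 : Eu m)).congr_of_eventuallyEq ?_)
  filter_upwards [c.isOpen_V.mem_nhds c.zero_mem] with x hx
  rw [c.quot_zero (c.mem_source.2 ⟨hu, hx⟩)]
  rfl

theorem prodDeriv_zero {u : Eu n} (hu : u ∈ c.φ.source) :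
    c.prodDeriv (u, 0) = ContinuousLinearMap.id ℝ (Eu m) := by
  have h := c.quotDeriv_comp_prodDeriv (c.zero_mem_srcDomain hu)
  rwa [c.quotDeriv_zero hu, ContinuousLinearMap.id_comp] at h

/-- The second-order part of the product: `B_u(y, w)` is the bilinear term of the expansion
`v + w + B_u(v, w) + ⋯` of the `v`-component of `ψ(u, v) ψ(σ(u, v), w)`. -/
def prodBilin (u : Eu n) (y w : Eu m) : Eu m :=
  fderiv ℝ c.prodDeriv (u, 0) (0, y) w

theorem hasFDerivAt_quotDeriv {p : Eu n × Eu m} (hp : p ∈ c.srcDomain) :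
    HasFDerivAt c.quotDeriv (fderiv ℝ c.quotDeriv p) p :=
  ((c.contDiffOn_quotDeriv.contDiffAt (c.isOpen_srcDomain.mem_nhds hp)).differentiableAt
    (by simp)).hasFDerivAt

theorem hasFDerivAt_prodDeriv {p : Eu n × Eu m} (hp : p ∈ c.srcDomain) :
    HasFDerivAt c.prodDeriv (fderiv ℝ c.prodDeriv p) p :=
  ((c.contDiffOn_prodDeriv.contDiffAt (c.isOpen_srcDomain.mem_nhds hp)).differentiableAt
    (by simp)).hasFDerivAt

/-- Differentiate `quotDeriv_comp_prodDeriv` at the origin, where both factors are the identity. -/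
theorem fderiv_quotDeriv_zero {u : Eu n} (hu : u ∈ c.φ.source) (y w : Eu m) :
    fderiv ℝ c.quotDeriv (u, 0) (0, y) w = -c.prodBilin u y w := by
  have h0 := c.zero_mem_srcDomain hu
  have h1 := (c.hasFDerivAt_quotDeriv h0).clm_comp (c.hasFDerivAt_prodDeriv h0)
  have h2 := h1.unique ((hasFDerivAt_const (ContinuousLinearMap.id ℝ (Eu m))
    ((u, 0) : Eu n × Eu m)).congr_of_eventuallyEq (by
      filter_upwards [c.isOpen_srcDomain.mem_nhds h0] with p hp
      exact c.quotDeriv_comp_prodDeriv hp))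
  have h3 := congrArg (fun T => T ((0, y) : Eu n × Eu m) w) h2
  simp [c.quotDeriv_zero hu, c.prodDeriv_zero hu] at h3
  rw [prodBilin]
  exact eq_neg_of_add_eq_zero_right h3

/-! ### The product to second order -/

/-- The `v`-component of `ψ(u, t y)⁻¹ ψ(u, t x)`. -/
def quotScaled (q : (Eu n × Eu m × Eu m) × ℝ) : Eu m :=
  (c.quot (q.1.1, q.2 • q.1.2.1, q.2 • q.1.2.2)).2

/-- The `(u, y, x, t)` for which `ψ(u, t y)⁻¹ ψ(u, t x)` lies in the chart. -/
def quotScaledDomain : Set ((Eu n × Eu m × Eu m) × ℝ) :=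
  (fun q : (Eu n × Eu m × Eu m) × ℝ => (q.1.1, q.2 • q.1.2.1, q.2 • q.1.2.2)) ⁻¹' c.quotDomain

theorem isOpen_quotScaledDomain : IsOpen c.quotScaledDomain :=
  c.isOpen_quotDomain.preimage (by fun_prop)

theorem contDiffOn_quotScaled : ContDiffOn ℝ ∞ c.quotScaled c.quotScaledDomain :=
  (c.contDiffOn_quot.comp
    (f := fun q : (Eu n × Eu m × Eu m) × ℝ => (q.1.1, q.2 • q.1.2.1, q.2 • q.1.2.2))
    (by fun_prop) (fun _ hq => hq)).snd

theorem mem_quotScaledDomain_zero {u : Eu n} (hu : u ∈ c.φ.source) (y x : Eu m) :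
    ((u, y, x), (0 : ℝ)) ∈ c.quotScaledDomain := by
  change (u, (0 : ℝ) • y, (0 : ℝ) • x) ∈ c.quotDomain
  rw [zero_smul, zero_smul]
  exact c.zero_mem_quotDomain (c.zero_mem_source hu)

theorem quotScaled_zero (e : Eu n × Eu m × Eu m) (he : (e, (0 : ℝ)) ∈ c.quotScaledDomain) :
    c.quotScaled (e, 0) = 0 := by
  have h : (e.1, (0 : ℝ) • e.2.1, (0 : ℝ) • e.2.2) ∈ c.quotDomain := he
  rw [quotScaled]
  simp only [zero_smul] at h ⊢
  rw [c.quot_zero (c.zero_mem_source h.1.1)]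

theorem contDiffOn_divTime_quotScaled : ContDiffOn ℝ 1 (divTime c.quotScaled) c.quotScaledDomain :=
  contDiffOn_divTime c.isOpen_quotScaledDomain c.contDiffOn_quotScaled c.quotScaled_zero

theorem hasDerivAt_scaled (u : Eu n) (y x : Eu m) (t : ℝ) :
    HasDerivAt (fun t : ℝ => ((u, t • y, t • x) : Eu n × Eu m × Eu m)) (0, y, x) t := by
  simpa using (hasDerivAt_const t u).prodMk
    (((hasDerivAt_id t).smul_const y).prodMk ((hasDerivAt_id t).smul_const x))

theorem fderiv_quotScaled {u : Eu n} {y x : Eu m} {t : ℝ}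
    (h : ((u, y, x), t) ∈ c.quotScaledDomain) :
    fderiv ℝ c.quotScaled ((u, y, x), t) (0, 1) =
      fderiv ℝ (fun q => (c.quot q).2) (u, t • y, t • x) (0, y, x) := by
  have h1 : HasFDerivAt c.quotScaled (fderiv ℝ c.quotScaled ((u, y, x), t)) ((u, y, x), t) :=
    ((c.contDiffOn_quotScaled.contDiffAt (c.isOpen_quotScaledDomain.mem_nhds h)).differentiableAt
      (by simp)).hasFDerivAt
  have h2 : HasDerivAt (fun t : ℝ => (((u, y, x), t) : (Eu n × Eu m × Eu m) × ℝ)) (0, 1) t :=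
    (hasDerivAt_const _ _).prodMk (hasDerivAt_id t)
  have h3 := (c.hasFDerivAt_quot_snd h).comp_hasDerivAt t (hasDerivAt_scaled u y x t)
  exact (h1.comp_hasDerivAt t h2).unique h3

theorem fderiv_quot_diag {p : Eu n × Eu m} (hp : p ∈ c.srcDomain) (y : Eu m) :
    fderiv ℝ (fun q => (c.quot q).2) (p.1, p.2, p.2) (0, y, y) = 0 := by
  have h1 : HasDerivAt (fun t : ℝ => ((p.1, p.2 + t • y, p.2 + t • y) : Eu n × Eu m × Eu m))
      (0, y, y) 0 := by
    have h := ((hasDerivAt_id (0 : ℝ)).smul_const y).const_add p.2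
    simpa using (hasDerivAt_const (0 : ℝ) p.1).prodMk (h.prodMk h)
  have h2 : HasFDerivAt (fun q => (c.quot q).2)
      (fderiv ℝ (fun q => (c.quot q).2) (p.1, p.2, p.2))
      (p.1, p.2 + (0 : ℝ) • y, p.2 + (0 : ℝ) • y) := by
    simpa using c.hasFDerivAt_quot_snd (c.diag_mem_quotDomain hp)
  have h3 := HasFDerivAt.comp_hasDerivAt
    (f := fun t : ℝ => ((p.1, p.2 + t • y, p.2 + t • y) : Eu n × Eu m × Eu m)) (0 : ℝ) h2 h1
  refine h3.unique ((hasDerivAt_const (0 : ℝ) (0 : Eu m)).congr_of_eventuallyEq ?_)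
  have hc : ContinuousAt (fun t : ℝ => ((p.1, p.2 + t • y) : Eu n × Eu m)) 0 := by fun_prop
  have hmem : c.srcDomain ∈ 𝓝 ((p.1, p.2 + (0 : ℝ) • y) : Eu n × Eu m) := by
    simpa using c.isOpen_srcDomain.mem_nhds hp
  filter_upwards [hc.preimage_mem_nhds hmem] with t ht
  exact congrArg Prod.snd (c.quot_diag (p := (p.1, p.2 + t • y)) ht)

theorem fderiv_quot_zero {u : Eu n} {x : Eu m} (h : (u, x) ∈ c.ψ.source) (w : Eu m) :
    fderiv ℝ (fun q => (c.quot q).2) (u, 0, x) (0, 0, w) = w := by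
  have h2 : HasFDerivAt (fun x : Eu m => (c.quot (u, 0, x)).2)
      ((fderiv ℝ (fun q => (c.quot q).2) (u, 0, x)).comp inThird) x :=
    HasFDerivAt.comp (g := fun q => (c.quot q).2) (f := fun w : Eu m => (u, (0 : Eu m), w))
      x (c.hasFDerivAt_quot_snd (c.zero_mem_quotDomain h)) (hasFDerivAt_inThird u 0 x)
  have h3 := h2.unique ((hasFDerivAt_id (𝕜 := ℝ) x).congr_of_eventuallyEq (by
    filter_upwards [c.isOpen_V.mem_nhds (c.mem_source.1 h).2] with x' hx'
    rw [c.quot_zero (c.mem_source.2 ⟨(c.mem_source.1 h).1, hx'⟩)]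
    rfl))
  exact congrArg (fun T => T w) h3

theorem divTime_quotScaled_zero {u : Eu n} (hu : u ∈ c.φ.source) (y x : Eu m) :
    divTime c.quotScaled ((u, y, x), 0) = x - y := by
  have h1 : ((0, y, x) : Eu n × Eu m × Eu m) = (0, y, y) + (0, 0, x - y) := by simp
  have h2 := c.fderiv_quot_diag (c.zero_mem_srcDomain hu) y
  simp only [divTime, if_true]
  rw [c.fderiv_quotScaled (c.mem_quotScaledDomain_zero hu y x), zero_smul, zero_smul, h1, map_add,
    c.fderiv_quot_zero (c.zero_mem_source hu), h2, zero_add]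

/-- The first-order term in `t` of the `v`-component of `ψ(u, t y)⁻¹ ψ(u, t x)` divided by `t`. The
second differential of `(y, x) ↦ quot (u, y, x)` at the origin is symmetric, vanishes on the
diagonal directions and on the directions `(0, x)`, so only its cross term is left. -/
theorem hasDerivAt_divTime_quotScaled {u : Eu n} (hu : u ∈ c.φ.source) (y x : Eu m) :
    HasDerivAt (fun t : ℝ => divTime c.quotScaled ((u, y, x), t)) (-c.prodBilin u y (x - y)) 0 := by
  refine hasDerivAt_divTime c.isOpen_quotScaledDomain c.contDiffOn_quotScaled c.quotScaled_zero
    (c.mem_quotScaledDomain_zero hu y x) ?_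
  let ζ : Eu n × Eu m × Eu m → Eu m := fun q => (c.quot q).2
  have hmem : ∀ a b : Eu m, c.quotDomain ∈ 𝓝 ((u, (0 : ℝ) • a, (0 : ℝ) • b) : Eu n × Eu m × Eu m) :=
    fun a b => c.isOpen_quotDomain.mem_nhds (c.mem_quotScaledDomain_zero hu a b)
  have hnear : ∀ a b : Eu m, ∀ᶠ t : ℝ in 𝓝 0, (u, t • a, t • b) ∈ c.quotDomain := fun a b =>
    (hasDerivAt_scaled u a b 0).continuousAt.preimage_mem_nhds (hmem a b)
  have hsrc : ∀ a : Eu m, ∀ᶠ t : ℝ in 𝓝 0, (u, t • a) ∈ c.srcDomain := fun a =>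
    (hnear a a).mono fun t ht => c.mem_srcDomain_of_mem_quotDomain ht
  let L := fderiv ℝ ζ
  let Q := fderiv ℝ L (u, 0, 0)
  have h0 : ((u, 0, 0) : Eu n × Eu m × Eu m) ∈ c.quotDomain :=
    c.zero_mem_quotDomain (c.zero_mem_source hu)
  have hL : HasFDerivAt L Q (u, 0, 0) :=
    ((((c.contDiffOn_quot.snd.fderiv_of_isOpen c.isOpen_quotDomain (m := ∞) (by simp))).contDiffAt
      (c.isOpen_quotDomain.mem_nhds h0)).differentiableAt (by simp)).hasFDerivAt
  have hLine : ∀ a b : Eu m, ∀ w, HasDerivAt (fun t : ℝ => L (u, t • a, t • b) w)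
      (Q (0, a, b) w) 0 := by
    intro a b w
    have h1 : HasFDerivAt L Q (u, (0 : ℝ) • a, (0 : ℝ) • b) := by simpa using hL
    have h2 := HasFDerivAt.comp_hasDerivAt
      (f := fun t : ℝ => ((u, t • a, t • b) : Eu n × Eu m × Eu m)) (0 : ℝ) h1
      (hasDerivAt_scaled u a b 0)
    simpa using h2.clm_apply (hasDerivAt_const (0 : ℝ) w)
  have hsymm : ∀ a b, Q a b = Q b a := by
    have h1 : ContDiffAt ℝ ∞ ζ (u, 0, 0) :=
      c.contDiffOn_quot.snd.contDiffAt (c.isOpen_quotDomain.mem_nhds h0)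
    exact fun a b => (h1.isSymmSndFDerivAt (by
      rw [minSmoothness_of_isRCLikeNormedField]; decide)) a b
  -- `ζ` is constant along the diagonal and linear in `x` where `y = 0`.
  have hdd : Q (0, y, y) (0, y, y) = 0 := by
    refine (hLine y y (0, y, y)).unique ((hasDerivAt_const (0 : ℝ) (0 : Eu m)).congr_of_eventuallyEq
      ?_)
    filter_upwards [hsrc y] with t ht
    exact c.fderiv_quot_diag ht y
  have hee : Q (0, 0, x - y) (0, 0, x - y) = 0 := by
    refine (hLine 0 (x - y) (0, 0, x - y)).unique
      ((hasDerivAt_const (0 : ℝ) (x - y)).congr_of_eventuallyEq ?_)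
    filter_upwards [hnear 0 (x - y)] with t ht
    rw [smul_zero]
    exact c.fderiv_quot_zero (c.mem_source.2 ⟨ht.1.1, ht.1.2.2⟩) _
  have hde : Q (0, y, y) (0, 0, x - y) = -c.prodBilin u y (x - y) := by
    rw [← c.fderiv_quotDeriv_zero hu]
    refine (hLine y y (0, 0, x - y)).unique ?_
    have h1 : HasFDerivAt c.quotDeriv (fderiv ℝ c.quotDeriv (u, 0)) (u, (0 : ℝ) • y) := by
      simpa using c.hasFDerivAt_quotDeriv (c.zero_mem_srcDomain hu)
    have h2 : HasDerivAt (fun t : ℝ => ((u, t • y) : Eu n × Eu m)) (0, y) 0 := by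
      simpa using (hasDerivAt_const (0 : ℝ) u).prodMk ((hasDerivAt_id (0 : ℝ)).smul_const y)
    have h3 := HasFDerivAt.comp_hasDerivAt (f := fun t : ℝ => ((u, t • y) : Eu n × Eu m)) (0 : ℝ)
      h1 h2
    have h4 := h3.clm_apply (hasDerivAt_const (0 : ℝ) (x - y))
    rw [map_zero, add_zero] at h4
    exact h4
  have hw : ((0, y, x) : Eu n × Eu m × Eu m) = (0, y, y) + (0, 0, x - y) := by simp
  have hQ : Q (0, y, x) (0, y, x) = (2 : ℝ) • -c.prodBilin u y (x - y) := by
    rw [hw]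
    simp only [map_add, _root_.add_apply]
    rw [hdd, hee, hsymm (0, 0, x - y), hde, two_smul, zero_add, add_zero]
  rw [← hQ]
  refine (hLine y x (0, y, x)).congr_of_eventuallyEq ?_
  filter_upwards [hnear y x] with t ht
  exact c.fderiv_quotScaled ht

theorem hasFDerivAt_src {p : Eu n × Eu m} (hp : p ∈ c.srcDomain) :
    HasFDerivAt c.src (fderiv ℝ c.src p) p :=
  ((c.contDiffOn_src.contDiffAt (c.isOpen_srcDomain.mem_nhds hp)).differentiableAt
    (by simp)).hasFDerivAt

theorem anchorCoeff_eq {u : Eu n} (hu : u ∈ c.φ.source) (i : Fin m) (j : Fin n) :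
    c.anchorCoeff i j u = (fderiv ℝ c.src (u, 0) (0, stdVec i)) j := by
  have h1 := (c.hasFDerivAt_src (c.zero_mem_srcDomain hu)).comp (0 : Eu m)
    (hasFDerivAt_prodMk_right u (0 : Eu m))
  exact congrArg (fun T : Eu m →L[ℝ] Eu n => T (stdVec i) j) h1.fderiv

/-! ### The bracket of left-invariant vector fields -/

/-- The left-invariant vector field of `e_i` in the coordinates `(u, v)`. -/
def leftFieldCoord (i : Fin m) (p : Eu n × Eu m) : Eu n × Eu m := (0, c.prodDeriv p (stdVec i))

/-- In the coordinates, left translation of the curve `w ↦ ψ(σ(u, v), w)` in the fibre of `r` gives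
the curve `w ↦ (u, prodSnd (u, v, w))`. -/
theorem leftField_eq (i : Fin m) {p : Eu n × Eu m} (hp : p ∈ c.srcDomain) :
    c.leftField i (c.ψ p) = mfderiv 𝓘(ℝ, Eu n × Eu m) 𝓘(ℝ, Eu (n + m)) c.ψ p
      (c.leftFieldCoord i p) := by
  have h1 : HasFDerivAt (fun w : Eu m => c.prodSnd (p.1, p.2, w)) (c.prodDeriv p) 0 :=
    HasFDerivAt.comp (g := c.prodSnd) (f := fun w : Eu m => (p.1, p.2, w)) (0 : Eu m)
      (c.hasFDerivAt_prodSnd (c.zero_mem_prodDomain hp)) (hasFDerivAt_inThird p.1 p.2 0)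
  have h2 : HasFDerivAt (fun w : Eu m => ((p.1, c.prodSnd (p.1, p.2, w)) : Eu n × Eu m))
      ((0 : Eu m →L[ℝ] Eu n).prod (c.prodDeriv p)) 0 :=
    (hasFDerivAt_const p.1 (0 : Eu m)).prodMk h1
  have h0 : ((p.1, c.prodSnd (p.1, p.2, 0)) : Eu n × Eu m) = p := by rw [c.prodSnd_zero hp]
  have h3 := mfderiv_comp_of_eq (I := 𝓘(ℝ, Eu m)) (I' := 𝓘(ℝ, Eu n × Eu m))
    (I'' := 𝓘(ℝ, Eu (n + m))) (g := c.ψ)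
    (f := fun w : Eu m => ((p.1, c.prodSnd (p.1, p.2, w)) : Eu n × Eu m)) (x := (0 : Eu m))
    (c.mdifferentiableAt_ψ hp.1) h2.differentiableAt.mdifferentiableAt h0
  have h4 : (fun v : Eu m => Γ.mul (c.ψ p) (c.ψ (c.φ.symm (Γ.s (c.ψ p)), v))) =ᶠ[𝓝 0]
      c.ψ ∘ fun w : Eu m => ((p.1, c.prodSnd (p.1, p.2, w)) : Eu n × Eu m) := by
    have hc : ContinuousAt (fun w : Eu m => ((p.1, p.2, w) : Eu n × Eu m × Eu m)) 0 := by fun_prop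
    filter_upwards [hc.preimage_mem_nhds
      (c.isOpen_prodDomain.mem_nhds (c.zero_mem_prodDomain hp))] with w hw
    exact (c.ψ_prodSnd (p := (p.1, p.2, w)) hw).symm
  rw [leftField, h4.mfderiv_eq, h3, mfderiv_eq_fderiv, h2.fderiv]
  exact congrArg (fun q : Eu n × Eu m => (mfderiv 𝓘(ℝ, Eu n × Eu m) 𝓘(ℝ, Eu (n + m)) c.ψ q
    (c.leftFieldCoord i p) : Eu (n + m))) h0

variable [IsManifold 𝓘(ℝ, Eu (n + m)) ∞ G]

/-- The structure functions of the bracket are the antisymmetrization of the second-order part of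
the product. The bracket of vector fields is natural for `ψ⁻¹`, so it is computed in the
coordinates, where the left-invariant fields are the columns of `prodDeriv`. -/
theorem bracketCoeff_eq {u : Eu n} (hu : u ∈ c.φ.source) (i j k : Fin m) :
    c.bracketCoeff i j k u =
      (c.prodBilin u (stdVec i) (stdVec j)) k - (c.prodBilin u (stdVec j) (stdVec i)) k := by
  have h0 := c.zero_mem_srcDomain hu
  have hq : Γ.unit (c.φ u) ∈ c.ψ.target := c.unit_mem_target.2 (c.φ.map_source hu)
  have hqs : c.ψ.symm (Γ.unit (c.φ u)) = (u, 0) := by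
    rw [← c.ψ_zero hu, c.ψ.left_inv (c.zero_mem_source hu)]
  have hinv : ∀ p ∈ c.ψ.source, ∀ w : Eu n × Eu m,
      (mfderiv 𝓘(ℝ, Eu (n + m)) 𝓘(ℝ, Eu n × Eu m) c.ψ.symm (c.ψ p)).inverse w =
        mfderiv 𝓘(ℝ, Eu n × Eu m) 𝓘(ℝ, Eu (n + m)) c.ψ p w := by
    intro p hp w
    exact congrArg (fun T : (Eu n × Eu m) →L[ℝ] Eu (n + m) => T w)
      (ContinuousLinearMap.inverse_eq (M := Eu (n + m)) (M₂ := Eu n × Eu m)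
        (ContinuousLinearMap.ext fun w => c.mfderiv_symm_comp_mfderiv hp w)
        (ContinuousLinearMap.ext fun w => c.mfderiv_comp_mfderiv_symm hp w))
  have hfield : ∀ i : Fin m, c.leftField i =ᶠ[𝓝 (Γ.unit (c.φ u))]
      VectorField.mpullback 𝓘(ℝ, Eu (n + m)) 𝓘(ℝ, Eu n × Eu m) c.ψ.symm (c.leftFieldCoord i) := by
    intro i
    have hopen : IsOpen (c.ψ.symm.source ∩ c.ψ.symm ⁻¹' c.srcDomain) :=
      c.ψ.symm.isOpen_inter_preimage c.isOpen_srcDomain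
    filter_upwards [hopen.mem_nhds ⟨hq, by simpa [hqs] using h0⟩] with g hg
    have h1 := c.leftField_eq i hg.2
    have hg' : c.ψ (c.ψ.symm g) = g := c.ψ.right_inv hg.1
    have h2 := hinv (c.ψ.symm g) hg.2.1 (c.leftFieldCoord i (c.ψ.symm g))
    rw [hg'] at h2
    rw [hg'] at h1
    exact h1.trans h2.symm
  have hdiff : ∀ i : Fin m, HasFDerivAt (c.leftFieldCoord i)
      ((0 : Eu n × Eu m →L[ℝ] Eu n).prod
        ((fderiv ℝ c.prodDeriv (u, 0)).flip (stdVec i))) (u, 0) := by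
    intro i
    refine (hasFDerivAt_const (0 : Eu n) ((u, 0) : Eu n × Eu m)).prodMk ?_
    have := (c.hasFDerivAt_prodDeriv h0).clm_apply
      (hasFDerivAt_const (stdVec i : Eu m) ((u, 0) : Eu n × Eu m))
    simpa using this
  have hmd : ∀ i : Fin m, MDifferentiableAt 𝓘(ℝ, Eu n × Eu m) 𝓘(ℝ, Eu n × Eu m).tangent
      (fun p => (⟨p, c.leftFieldCoord i p⟩ : TangentBundle 𝓘(ℝ, Eu n × Eu m) (Eu n × Eu m)))
      (c.ψ.symm (Γ.unit (c.φ u))) := by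
    intro i
    rw [hqs]
    have h1 : ContDiffAt ℝ ∞ (c.leftFieldCoord i) (u, 0) :=
      contDiffAt_const.prodMk ((c.contDiffOn_prodDeriv.contDiffAt
        (c.isOpen_srcDomain.mem_nhds h0)).clm_apply contDiffAt_const)
    exact (contMDiffAt_vectorSpace_iff_contDiffAt.2 h1).mdifferentiableAt (by simp)
  have : IsManifold 𝓘(ℝ, Eu (n + m)) (minSmoothness ℝ 2) G := by
    rw [minSmoothness_of_isRCLikeNormedField]
    exact IsManifold.of_le (n := ∞) (by decide)
  have hb := VectorField.mpullback_mlieBracket (I := 𝓘(ℝ, Eu (n + m))) (I' := 𝓘(ℝ, Eu n × Eu m))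
    (n := ∞) (f := c.ψ.symm) (V := c.leftFieldCoord i) (W := c.leftFieldCoord j)
    (x₀ := Γ.unit (c.φ u)) (hmd i) (hmd j)
    (c.smooth_ψ_symm.contMDiffAt (c.ψ.open_target.mem_nhds hq)) (by
      rw [minSmoothness_of_isRCLikeNormedField]; decide)
  have hlie : VectorField.mlieBracket 𝓘(ℝ, Eu n × Eu m) (c.leftFieldCoord i) (c.leftFieldCoord j)
      (u, 0) = (0, c.prodBilin u (stdVec i) (stdVec j) - c.prodBilin u (stdVec j) (stdVec i)) := by
    have h1 : VectorField.lieBracketWithin ℝ (c.leftFieldCoord i) (c.leftFieldCoord j) Set.univ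
        (u, 0) = (0, c.prodBilin u (stdVec i) (stdVec j) - c.prodBilin u (stdVec j) (stdVec i)) := by
      rw [VectorField.lieBracketWithin_univ, VectorField.lieBracket, (hdiff i).fderiv,
        (hdiff j).fderiv]
      simp [leftFieldCoord, c.prodDeriv_zero hu, prodBilin]
    exact (congrFun (VectorField.mlieBracketWithin_eq_lieBracketWithin (𝕜 := ℝ)
      (V := c.leftFieldCoord i) (W := c.leftFieldCoord j) (s := Set.univ)) (u, 0)).trans h1
  let S : Eu (n + m) →L[ℝ] Eu n × Eu m :=
    mfderiv 𝓘(ℝ, Eu (n + m)) 𝓘(ℝ, Eu n × Eu m) c.ψ.symm (Γ.unit (c.φ u))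
  have h1 := hinv (u, 0) (c.zero_mem_source hu)
    (0, c.prodBilin u (stdVec i) (stdVec j) - c.prodBilin u (stdVec j) (stdVec i))
  have h2 := c.mfderiv_symm_comp_mfderiv (c.zero_mem_source hu)
    (0, c.prodBilin u (stdVec i) (stdVec j) - c.prodBilin u (stdVec j) (stdVec i))
  rw [← h1, c.ψ_zero hu] at h2
  have h3 : VectorField.mlieBracket 𝓘(ℝ, Eu (n + m)) (c.leftField i) (c.leftField j)
      (Γ.unit (c.φ u)) = S.inverse (0, c.prodBilin u (stdVec i) (stdVec j) -
        c.prodBilin u (stdVec j) (stdVec i)) := by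
    rw [(hfield i).mlieBracket_vectorField_eq (hfield j), ← hb]
    refine Eq.trans (congrArg (fun q : Eu n × Eu m => S.inverse (VectorField.mlieBracket
      𝓘(ℝ, Eu n × Eu m) (c.leftFieldCoord i) (c.leftFieldCoord j) q)) hqs) ?_
    exact congrArg (fun w : Eu n × Eu m => S.inverse w) hlie
  refine (congrArg (fun w : Eu (n + m) => (S w).2 k) h3).trans ?_
  exact congrArg (fun w : Eu n × Eu m => w.2 k) h2

end AdaptedChart

/-! ### Densities in a frame -/

/-- The linear combinations `v ↦ ∑ vᵢ eᵢ` of a family of vectors. -/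
def comb {W : Type*} [AddCommGroup W] [Module ℝ W] (e : Fin m → W) : Eu m →ₗ[ℝ] W where
  toFun v := ∑ i, v i • e i
  map_add' v w := by simp [add_smul, Finset.sum_add_distrib]
  map_smul' a v := by simp [Finset.smul_sum, smul_smul]

theorem comb_apply {W : Type*} [AddCommGroup W] [Module ℝ W] (e : Fin m → W) (v : Eu m) :
    comb e v = ∑ i, v i • e i := rfl

theorem comb_stdVec {W : Type*} [AddCommGroup W] [Module ℝ W] (e : Fin m → W) (i : Fin m) :
    comb e (stdVec i) = e i := by
  simp [comb_apply, stdVec]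

/-- The coordinates in a basis, as a linear isomorphism with `ℝᵐ`. -/
def combEquiv {W : Type*} [AddCommGroup W] [Module ℝ W] (b : Module.Basis (Fin m) ℝ W) :
    Eu m ≃ₗ[ℝ] W :=
  (WithLp.linearEquiv 2 ℝ (Fin m → ℝ)).trans b.equivFun.symm

theorem combEquiv_apply {W : Type*} [AddCommGroup W] [Module ℝ W] (b : Module.Basis (Fin m) ℝ W)
    (v : Eu m) : combEquiv b v = comb b v := by
  simp [combEquiv, comb_apply, Module.Basis.equivFun_symm_apply]

namespace SmoothDensity

variable (μ : Γ.SmoothDensity)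

theorem toFun_combEquiv {x : M} (b : Module.Basis (Fin m) ℝ (Γ.Alg x)) (R : Eu m →ₗ[ℝ] Eu m) :
    μ.toFun x (fun i => combEquiv b (R (stdVec i))) = |LinearMap.det R| * μ.toFun x b := by
  have h1 := μ.map_comp x ((combEquiv b).toLinearMap ∘ₗ R ∘ₗ (combEquiv b).symm.toLinearMap) b
  rw [LinearMap.det_conj] at h1
  rw [← h1]
  congr 1
  ext1 i
  have h2 : (combEquiv b).symm (b i) = stdVec i := by
    rw [LinearEquiv.symm_apply_eq, combEquiv_apply, comb_stdVec]
  simp [h2]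

theorem toFun_comb {x : M} (e : Fin m → Γ.Alg x) (K : Eu m →ₗ[ℝ] Eu m) :
    μ.toFun x (fun i => comb e (K (stdVec i))) = |LinearMap.det K| * μ.toFun x e := by
  let b := Γ.algBasis x
  let R : Eu m →ₗ[ℝ] Eu m := (combEquiv b).symm.toLinearMap ∘ₗ comb e
  have hR : ∀ v, combEquiv b (R v) = comb e v := fun v => by simp [R]
  have h1 := μ.toFun_combEquiv b (R ∘ₗ K)
  have h2 := μ.toFun_combEquiv b R
  simp only [LinearMap.comp_apply, hR, comb_stdVec] at h1 h2
  rw [h1, h2, LinearMap.det_comp, abs_mul]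
  ring

theorem toFun_congr {x x' : M} (h : x = x') {e : Fin m → Γ.Alg x} {e' : Fin m → Γ.Alg x'}
    (he : ∀ i, ((e i).1 : Eu (n + m)) = (e' i).1) : μ.toFun x e = μ.toFun x' e' := by
  subst h
  congr 1
  ext1 i
  exact Subtype.ext (he i)

/-- The integral over a fibre of the Lie algebroid may be computed in any basis. -/
theorem fibreIntegral_eq {x : M} (e : Module.Basis (Fin m) ℝ (Γ.Alg x)) (h : Γ.Alg x → ℂ) :
    μ.fibreIntegral x h = (μ.toFun x e : ℂ) * ∫ v : Eu m, h (comb e v) := by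
  let b := Γ.algBasis x
  let R : Eu m →ₗ[ℝ] Eu m := (combEquiv b).symm.toLinearMap ∘ₗ (combEquiv e).toLinearMap
  have hR : ∀ v, comb b (R v) = comb e v := fun v => by
    rw [← combEquiv_apply, ← combEquiv_apply]; simp [R]
  have h2 := μ.toFun_combEquiv b R
  simp only [combEquiv_apply, hR, comb_stdVec] at h2
  have hinj : Function.Injective R :=
    (combEquiv b).symm.injective.comp (combEquiv e).injective
  have hsurj : Function.Surjective R :=
    (combEquiv b).symm.surjective.comp (combEquiv e).surjective
  have h3 := integral_image_eq_integral_abs_det_fderiv_smul (s := Set.univ) (f := R)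
    (f' := fun _ => LinearMap.toContinuousLinearMap R) (volume : Measure (Eu m))
    MeasurableSet.univ (fun v _ => ((LinearMap.toContinuousLinearMap R).hasFDerivAt).hasFDerivWithinAt)
    hinj.injOn (fun v => h (comb b v))
  rw [Set.image_univ, hsurj.range_eq, Measure.restrict_univ, integral_smul] at h3
  change (μ.toFun x b : ℂ) * ∫ v : Eu m, h (comb b v) = _
  rw [h3, h2]
  simp only [hR]
  rw [Complex.real_smul]
  push_cast
  have h4 : (LinearMap.toContinuousLinearMap R).det = LinearMap.det R := rfl
  rw [h4]
  ring

/-- The coefficient of the density in the frame of an adapted chart. -/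
def coeff (c : Γ.AdaptedChart) (u : Eu n) : ℝ := μ.toFun (c.φ u) (c.frame u)

end SmoothDensity

/-! ### The Haar system in a chart -/

namespace SubmersionChart

variable (c : Γ.SubmersionChart) (μ : Γ.SmoothDensity)

theorem mem_source {u : Eu n} {v : Eu m} :
    (u, v) ∈ c.ψ.source ↔ u ∈ c.φ.source ∧ v ∈ c.V := by
  rw [c.source_eq]; rfl

/-- The velocities `∂ψ/∂vᵢ`, translated to the unit of the source. -/
def velocity (u : Eu n) (v : Eu m) (i : Fin m) : Eu (n + m) :=
  mfderiv 𝓘(ℝ, Eu m) 𝓘(ℝ, Eu (n + m))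
    (fun w : Eu m => Γ.mul (Γ.inv (c.ψ (u, v))) (c.ψ (u, w))) v (stdVec i)

theorem velocity_mem {u : Eu n} {v : Eu m} (hu : u ∈ c.φ.source) (hv : v ∈ c.V) (i : Fin m) :
    c.velocity u v i ∈ Γ.Alg (Γ.s (c.ψ (u, v))) :=
  Γ.mfderiv_mem_alg (F := fun w : Eu m => Γ.mul (Γ.inv (c.ψ (u, v))) (c.ψ (u, w)))
    (Γ.inv_mul _)
    (Filter.eventually_of_mem (c.isOpen_V.mem_nhds hv) (fun w hw => by
      rw [Γ.r_mul _ _ (by rw [Γ.s_inv, c.r_ψ u hu v hv, c.r_ψ u hu w hw]),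
        Γ.r_inv])) (stdVec i)

theorem haarCoeff_eq {u : Eu n} {v : Eu m} (hu : u ∈ c.φ.source) (hv : v ∈ c.V) :
    c.haarCoeff μ u v =
      μ.toFun (Γ.s (c.ψ (u, v))) (fun i => ⟨c.velocity u v i, c.velocity_mem hu hv i⟩) := by
  rw [haarCoeff, dif_pos ⟨hu, hv⟩]
  rfl

theorem mdifferentiableAt_translate {g : G} {u : Eu n} {v : Eu m} (hu : u ∈ c.φ.source)
    (hv : v ∈ c.V) (hg : Γ.r g = c.φ u) :
    MDifferentiableAt 𝓘(ℝ, Eu m) 𝓘(ℝ, Eu (n + m))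
      (fun w : Eu m => Γ.mul (Γ.inv g) (c.ψ (u, w))) v := by
  have h1 : ContMDiffOn 𝓘(ℝ, Eu m) 𝓘(ℝ, Eu (n + m)) ∞
      (fun w : Eu m => Γ.mul (Γ.inv g) (c.ψ (u, w))) c.V := by
    have h2 : ContMDiffOn 𝓘(ℝ, Eu m) 𝓘(ℝ, Eu (n + m)) ∞ (fun w : Eu m => c.ψ (u, w)) c.V :=
      c.smooth_ψ.comp (f := fun w : Eu m => (u, w))
        (contMDiffOn_iff_contDiffOn.2 (by fun_prop)) (fun w hw => c.mem_source.2 ⟨hu, hw⟩)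
    refine Γ.contMDiffOn_mul.comp (contMDiffOn_const.prodMk h2) ?_
    intro w hw
    change Γ.s (Γ.inv g) = Γ.r (c.ψ (u, w))
    rw [Γ.s_inv, hg, c.r_ψ u hu w hw]
  exact (h1.contMDiffAt (c.isOpen_V.mem_nhds hv)).mdifferentiableAt (by simp)

/-- The change of variables of the coefficients of the left-equivariant density. -/
theorem haarCoeff_comp (c' : Γ.SubmersionChart) {u u' : Eu n} {v' : Eu m} {κ : Eu m → Eu m}
    {κ' : Eu m →L[ℝ] Eu m} (hu : u ∈ c.φ.source) (hu' : u' ∈ c'.φ.source) (hv : κ v' ∈ c.V)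
    (hv' : v' ∈ c'.V) (hκ : HasFDerivAt κ κ' v')
    (h : ∀ᶠ w in 𝓝 v', c'.ψ (u', w) = c.ψ (u, κ w)) :
    c'.haarCoeff μ u' v' = |κ'.det| * c.haarCoeff μ u (κ v') := by
  have h0 := h.self_of_nhds
  have hd := c.mdifferentiableAt_translate hu hv (c.r_ψ u hu _ hv)
  let A : Eu m →L[ℝ] Eu (n + m) := mfderiv 𝓘(ℝ, Eu m) 𝓘(ℝ, Eu (n + m))
    (fun w : Eu m => Γ.mul (Γ.inv (c.ψ (u, κ v'))) (c.ψ (u, w))) (κ v')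
  have hvel : ∀ i, c'.velocity u' v' i = A (κ' (stdVec i)) := by
    intro i
    have h1 := mfderiv_comp (I := 𝓘(ℝ, Eu m)) (I' := 𝓘(ℝ, Eu m)) (I'' := 𝓘(ℝ, Eu (n + m))) v' hd
      hκ.differentiableAt.mdifferentiableAt
    rw [mfderiv_eq_fderiv, hκ.fderiv] at h1
    have h2 : (fun w : Eu m => Γ.mul (Γ.inv (c'.ψ (u', v'))) (c'.ψ (u', w))) =ᶠ[𝓝 v']
        (fun w : Eu m => Γ.mul (Γ.inv (c.ψ (u, κ v'))) (c.ψ (u, w))) ∘ κ := by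
      filter_upwards [h] with w hw
      rw [hw, h0]
      rfl
    rw [velocity, h2.mfderiv_eq, h1]
    rfl
  rw [c.haarCoeff_eq μ hu hv, c'.haarCoeff_eq μ hu' hv']
  have h3 := μ.toFun_comb (fun i => (⟨c.velocity u (κ v') i, c.velocity_mem hu hv i⟩ :
    Γ.Alg (Γ.s (c.ψ (u, κ v'))))) κ'.toLinearMap
  refine Eq.trans ?_ h3
  refine μ.toFun_congr (by rw [h0]) fun i => ?_
  have h4 : ∀ w : Eu m, A w = ∑ j, w j • A (stdVec j) := by
    intro w
    have h5 : w = ∑ j, w j • (stdVec j : Eu m) := by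
      ext l; simp [stdVec, Pi.single_apply]
    conv_lhs => rw [h5, map_sum]
    simp
  refine (hvel i).trans ((h4 _).trans ?_)
  simp only [comb_apply]
  rw [AddSubmonoidClass.coe_finsetSum]
  rfl

theorem continuousOn_slice {u : Eu n} (hu : u ∈ c.φ.source) :
    ContinuousOn (fun v : Eu m => c.ψ (u, v)) c.V :=
  c.ψ.continuousOn.comp (by fun_prop) (fun v hv => c.mem_source.2 ⟨hu, hv⟩)

/-- The part of `r⁻¹(φ u)` parametrized by the chart. -/
def slice (u : Eu n) : Set G := c.ψ.target ∩ Γ.r ⁻¹' {c.φ u}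

theorem mem_slice {u : Eu n} (hu : u ∈ c.φ.source) {g : G} (hg : g ∈ c.slice u) :
    (c.ψ.symm g).2 ∈ c.V ∧ c.ψ (u, (c.ψ.symm g).2) = g := by
  have h1 := c.mem_source.1 (show ((c.ψ.symm g).1, (c.ψ.symm g).2) ∈ c.ψ.source from
    c.ψ.map_target hg.1)
  have h2 := c.r_ψ _ h1.1 _ h1.2
  rw [Prod.mk.eta, c.ψ.right_inv hg.1, show Γ.r g = c.φ u from hg.2] at h2
  have h3 : u = (c.ψ.symm g).1 := c.φ.injOn hu h1.1 h2
  refine ⟨h1.2, ?_⟩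
  conv_lhs => rw [h3]
  rw [Prod.mk.eta, c.ψ.right_inv hg.1]

theorem mem_slice_of_mem {u : Eu n} (hu : u ∈ c.φ.source) {v : Eu m} (hv : v ∈ c.V) :
    c.ψ (u, v) ∈ c.slice u :=
  ⟨c.ψ.map_source (c.mem_source.2 ⟨hu, hv⟩), c.r_ψ u hu v hv⟩

variable [MeasurableSpace G] [BorelSpace G]

/-- The measure of the left-equivariant density on the part of `r⁻¹(φ u)` parametrized by the
chart. -/
def chartMeasure (u : Eu n) : Measure G :=
  Measure.map (fun v : Eu m => c.ψ (u, v))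
    ((volume.restrict c.V).withDensity (fun v => ENNReal.ofReal (c.haarCoeff μ u v)))

theorem aemeasurable_slice {u : Eu n} (hu : u ∈ c.φ.source) :
    AEMeasurable (fun v : Eu m => c.ψ (u, v))
      ((volume.restrict c.V).withDensity (fun v => ENNReal.ofReal (c.haarCoeff μ u v))) :=
  ((c.continuousOn_slice hu).aemeasurable c.isOpen_V.measurableSet).mono_ac
    (withDensity_absolutelyContinuous _ _)

theorem chartMeasure_apply {u : Eu n} (hu : u ∈ c.φ.source) {s : Set G} (hs : MeasurableSet s) :
    c.chartMeasure μ u s =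
      ∫⁻ v in (fun v => c.ψ (u, v)) ⁻¹' s ∩ c.V, ENNReal.ofReal (c.haarCoeff μ u v) := by
  rw [chartMeasure, Measure.map_apply_of_aemeasurable (c.aemeasurable_slice μ hu) hs,
    withDensity_apply', Measure.restrict_restrict' c.isOpen_V.measurableSet]

theorem measurableSet_slice_preimage {u : Eu n} (hu : u ∈ c.φ.source) {s : Set G}
    (hs : MeasurableSet s) : MeasurableSet ((fun v => c.ψ (u, v)) ⁻¹' s ∩ c.V) := by
  have h1 : Measurable (c.V.domRestrict fun v : Eu m => c.ψ (u, v)) :=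
    (continuousOn_iff_continuous_domRestrict.1 (c.continuousOn_slice hu)).measurable
  have h2 := c.isOpen_V.measurableSet.subtype_image (h1 hs)
  convert h2 using 1
  ext v
  simp [and_comm]

theorem measurableSet_slice [T1Space M] (u : Eu n) : MeasurableSet (c.slice u) :=
  c.ψ.open_target.measurableSet.inter
    (isClosed_singleton.preimage Γ.contMDiff_r.continuous).measurableSet

/-- The measures of the left-equivariant density in two charts agree where both are defined, by
the change of variables formula. -/
theorem chartMeasure_restrict_le [T1Space M] (c' : Γ.SubmersionChart) {u u' : Eu n}
    (hu : u ∈ c.φ.source) (hu' : u' ∈ c'.φ.source) (huu' : c'.φ u' = c.φ u) :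
    (c'.chartMeasure μ u').restrict (c.slice u) ≤ c.chartMeasure μ u := by
  refine Measure.le_iff.2 fun s hs => ?_
  rw [Measure.restrict_apply hs, c'.chartMeasure_apply μ hu' (hs.inter (c.measurableSet_slice u)),
    c.chartMeasure_apply μ hu hs]
  set A' := (fun v => c'.ψ (u', v)) ⁻¹' (s ∩ c.slice u) ∩ c'.V with hA'
  have hA'm : MeasurableSet A' :=
    c'.measurableSet_slice_preimage hu' (hs.inter (c.measurableSet_slice u))
  -- `κ` is the change of coordinates on the fibre of `r`.
  let κ : Eu m → Eu m := fun v => (c.ψ.symm (c'.ψ (u', v))).2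
  have hκeq : ∀ v ∈ c'.V, c'.ψ (u', v) ∈ c.ψ.target →
      κ v ∈ c.V ∧ c.ψ (u, κ v) = c'.ψ (u', v) := fun v hv hvt =>
    c.mem_slice hu ⟨hvt, by
      rw [Set.mem_preimage, Set.mem_singleton_iff, c'.r_ψ u' hu' v hv, huu']⟩
  have hO : IsOpen (c'.V ∩ (fun v => c'.ψ (u', v)) ⁻¹' c.ψ.target) :=
    (c'.continuousOn_slice hu').isOpen_inter_preimage c'.isOpen_V c.ψ.open_target
  have hκd : ContDiffOn ℝ ∞ κ (c'.V ∩ (fun v => c'.ψ (u', v)) ⁻¹' c.ψ.target) := by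
    have h1 : ContMDiffOn 𝓘(ℝ, Eu m) 𝓘(ℝ, Eu (n + m)) ∞ (fun v : Eu m => c'.ψ (u', v)) c'.V :=
      c'.smooth_ψ.comp (f := fun w : Eu m => (u', w))
        (contMDiffOn_iff_contDiffOn.2 (by fun_prop)) (fun w hw => c'.mem_source.2 ⟨hu', hw⟩)
    have h2 : ContDiffOn ℝ ∞ (fun v => c.ψ.symm (c'.ψ (u', v)))
        (c'.V ∩ (fun v => c'.ψ (u', v)) ⁻¹' c.ψ.target) := by
      rw [← contMDiffOn_iff_contDiffOn]
      exact c.smooth_ψ_symm.comp (h1.mono fun v hv => hv.1) (fun v hv => hv.2)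
    exact h2.snd
  have hκ' : ∀ v ∈ A', HasFDerivAt κ (fderiv ℝ κ v) v := fun v hv =>
    ((hκd.contDiffAt (hO.mem_nhds ⟨hv.2, hv.1.2.1⟩)).differentiableAt (by simp)).hasFDerivAt
  have hinj : Set.InjOn κ A' := by
    intro v hv w hw hvw
    have h1 := (hκeq v hv.2 hv.1.2.1).2
    rw [hvw, (hκeq w hw.2 hw.1.2.1).2] at h1
    exact (congrArg Prod.snd (c'.ψ.injOn (c'.mem_source.2 ⟨hu', hw.2⟩)
      (c'.mem_source.2 ⟨hu', hv.2⟩) h1)).symm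
  have hlin := lintegral_image_eq_lintegral_abs_det_fderiv_mul (volume : Measure (Eu m)) hA'm
    (fun v hv => (hκ' v hv).hasFDerivWithinAt) hinj (fun v => ENNReal.ofReal (c.haarCoeff μ u v))
  have hcongr : ∫⁻ v in A', ENNReal.ofReal (c'.haarCoeff μ u' v) =
      ∫⁻ v in A', ENNReal.ofReal |(fderiv ℝ κ v).det| * ENNReal.ofReal (c.haarCoeff μ u (κ v)) := by
    refine setLIntegral_congr_fun hA'm fun v hv => ?_
    have h1 := c.haarCoeff_comp μ c' hu hu' (hκeq v hv.2 hv.1.2.1).1 hv.2 (hκ' v hv) (by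
      filter_upwards [hO.mem_nhds ⟨hv.2, hv.1.2.1⟩] with w hw
      exact (hκeq w hw.1 hw.2).2.symm)
    simp only [h1]
    rw [ENNReal.ofReal_mul (abs_nonneg _)]
  rw [hcongr, ← hlin]
  refine lintegral_mono_set ?_
  rintro _ ⟨v, hv, rfl⟩
  have h1 := hκeq v hv.2 hv.1.2.1
  refine ⟨?_, h1.1⟩
  change c.ψ (u, κ v) ∈ s
  rw [h1.2]
  exact hv.1.1

theorem chartMeasure_restrict_slice [T1Space M] {u : Eu n} (hu : u ∈ c.φ.source) :
    (c.chartMeasure μ u).restrict (c.slice u) = c.chartMeasure μ u := by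
  refine Measure.ext fun s hs => ?_
  rw [Measure.restrict_apply hs, c.chartMeasure_apply μ hu hs,
    c.chartMeasure_apply μ hu (hs.inter (c.measurableSet_slice u))]
  congr 2
  ext v
  exact ⟨fun h => ⟨h.1.1, h.2⟩, fun h => ⟨⟨h.1, c.mem_slice_of_mem hu h.2⟩, h.2⟩⟩

/-- In each chart the Haar system, a supremum over all charts, is the measure of the left-equivariant
density. -/
theorem haar_restrict_slice [T1Space M] {u : Eu n} (hu : u ∈ c.φ.source) :
    (μ.haar (c.φ u)).restrict (c.slice u) = c.chartMeasure μ u := by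
  have hT := c.measurableSet_slice u
  have hle : ∀ (c' : Γ.SubmersionChart) (u' : Eu n), u' ∈ c'.φ.source ∧ c'.φ u' = c.φ u →
      c'.chartMeasure μ u' ≤ μ.haar (c.φ u) := fun c' u' h =>
    le_iSup_of_le c' (le_iSup_of_le u' (le_iSup_of_le h le_rfl))
  -- Each measure in the supremum is bounded by that of `c` on the slice, and by the supremum off it.
  have hub : μ.haar (c.φ u) ≤ c.chartMeasure μ u + (μ.haar (c.φ u)).restrict (c.slice u)ᶜ := by
    refine iSup_le fun c' => iSup_le fun u' => iSup_le fun h => ?_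
    change c'.chartMeasure μ u' ≤ _
    rw [← Measure.restrict_add_restrict_compl (μ := c'.chartMeasure μ u') hT]
    exact add_le_add (c.chartMeasure_restrict_le μ c' hu h.1 h.2)
      (Measure.restrict_mono le_rfl (hle c' u' h))
  refine le_antisymm ?_ ?_
  · have h1 := Measure.restrict_mono (le_refl (c.slice u)) hub
    rw [Measure.restrict_add, c.chartMeasure_restrict_slice μ hu,
      Measure.restrict_restrict hT, Set.inter_compl_self, Measure.restrict_empty, add_zero] at h1
    exact h1
  · rw [← c.chartMeasure_restrict_slice μ hu]
    exact Measure.restrict_mono le_rfl (hle c u ⟨hu, rfl⟩)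

end SubmersionChart

/-- The measure `λ^x` is concentrated on `r⁻¹(x)`. -/
theorem SmoothDensity.haar_restrict_fibre [T1Space M] [MeasurableSpace G] [BorelSpace G]
    (μ : Γ.SmoothDensity) (x : M) : (μ.haar x).restrict (Γ.r ⁻¹' {x}) = μ.haar x := by
  have hm : MeasurableSet (Γ.r ⁻¹' {x}) :=
    (isClosed_singleton.preimage Γ.contMDiff_r.continuous).measurableSet
  refine le_antisymm Measure.restrict_le_self ?_
  conv_lhs => rw [haar]
  refine iSup_le fun c => iSup_le fun u => iSup_le fun h => ?_
  change c.chartMeasure μ u ≤ _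
  rw [← c.chartMeasure_restrict_slice μ h.1]
  refine Measure.restrict_mono ?_ ?_
  · rw [← h.2]
    exact fun g hg => hg.2
  · exact le_iSup_of_le c (le_iSup_of_le u (le_iSup_of_le h le_rfl))

/-- The integral for the Haar system of a function supported in a compact part of a chart. -/
theorem SubmersionChart.integral_haar [T1Space M] [T2Space G] [MeasurableSpace G] [BorelSpace G]
    (c : Γ.SubmersionChart) (μ : Γ.SmoothDensity) {u : Eu n} (hu : u ∈ c.φ.source)
    {A : Set (Eu m)} (hA : IsCompact A) (hAV : A ⊆ c.V)
    (hlam : ContinuousOn (c.haarCoeff μ u) A) (hpos : ∀ v ∈ A, 0 ≤ c.haarCoeff μ u v) {F : G → ℂ}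
    (hF : ContinuousOn F (Γ.r ⁻¹' {c.φ u}))
    (hF0 : ∀ g, Γ.r g = c.φ u → F g ≠ 0 → ∃ v ∈ A, g = c.ψ (u, v)) :
    ∫ g, F g ∂(μ.haar (c.φ u)) = ∫ v in A, (c.haarCoeff μ u v : ℂ) * F (c.ψ (u, v)) := by
  let f : Eu m → G := fun v => c.ψ (u, v)
  have hfA : IsCompact (f '' A) := hA.image_of_continuousOn ((c.continuousOn_slice hu).mono hAV)
  have hT : MeasurableSet (f '' A) := hfA.isClosed.measurableSet
  have hm : MeasurableSet (Γ.r ⁻¹' {c.φ u}) :=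
    (isClosed_singleton.preimage Γ.contMDiff_r.continuous).measurableSet
  have hsub : f '' A ⊆ c.slice u := by
    rintro _ ⟨v, hv, rfl⟩
    exact c.mem_slice_of_mem hu (hAV hv)
  have hsub' : f '' A ⊆ Γ.r ⁻¹' {c.φ u} := fun g hg => (hsub hg).2
  have hpre : f ⁻¹' (f '' A) ∩ c.V = A := by
    ext v
    constructor
    · rintro ⟨⟨w, hw, hwv⟩, hv⟩
      have := congrArg Prod.snd (c.ψ.injOn (c.mem_source.2 ⟨hu, hAV hw⟩)
        (c.mem_source.2 ⟨hu, hv⟩) hwv)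
      rwa [← show w = v from this]
    · exact fun hv => ⟨⟨v, hv, rfl⟩, hAV hv⟩
  have hmap : (μ.haar (c.φ u)).restrict (f '' A) = Measure.map f
      ((volume.restrict A).withDensity (fun v => ENNReal.ofReal (c.haarCoeff μ u v))) := by
    have h1 : (μ.haar (c.φ u)).restrict (f '' A) = (c.chartMeasure μ u).restrict (f '' A) := by
      rw [← c.haar_restrict_slice μ hu, Measure.restrict_restrict hT, Set.inter_eq_left.2 hsub]
    rw [h1, SubmersionChart.chartMeasure,
      Measure.restrict_map_of_aemeasurable (c.aemeasurable_slice μ hu) hT, restrict_withDensity',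
      Measure.restrict_restrict' c.isOpen_V.measurableSet, hpre]
  have hae : AEMeasurable f
      ((volume.restrict A).withDensity (fun v => ENNReal.ofReal (c.haarCoeff μ u v))) :=
    (((c.continuousOn_slice hu).mono hAV).aemeasurable hA.measurableSet).mono_ac
      (withDensity_absolutelyContinuous _ _)
  have hFm : AEStronglyMeasurable F (Measure.map f
      ((volume.restrict A).withDensity (fun v => ENNReal.ofReal (c.haarCoeff μ u v)))) := by
    rw [← hmap]
    exact (hF.mono hsub').aestronglyMeasurable hT
  rw [← μ.haar_restrict_fibre (c.φ u),
    setIntegral_eq_of_subset_of_forall_sdiff_eq_zero hm hsub' (fun g hg => by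
      by_contra h0
      obtain ⟨v, hv, rfl⟩ := hF0 g hg.1 h0
      exact hg.2 ⟨v, hv, rfl⟩), hmap, integral_map hae hFm,
    integral_withDensity_eq_integral_toReal_smul₀
      ((hlam.aemeasurable hA.measurableSet).ennreal_ofReal)
      (Filter.Eventually.of_forall fun _ => ENNReal.ofReal_lt_top)]
  refine setIntegral_congr_fun hA.measurableSet fun v hv => ?_
  rw [ENNReal.toReal_ofReal (hpos v hv), Complex.real_smul]

namespace AdaptedChart

variable (c : Γ.AdaptedChart) (μ : Γ.SmoothDensity)

/-- The velocities `∂ψ/∂vᵢ` at `ψ(u, y)`, translated to the unit of the source, are the columns of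
`quotDeriv` in the frame there. -/
theorem haarCoeff_adapted {p : Eu n × Eu m} (hp : p ∈ c.srcDomain) :
    c.toSubmersionChart.haarCoeff μ p.1 p.2 = |(c.quotDeriv p).det| * μ.coeff c (c.src p) := by
  obtain ⟨u, y⟩ := p
  have huy := c.mem_source.1 hp.1
  have hσ := c.src_mem hp
  have hdq := c.diag_mem_quotDomain hp
  rw [c.haarCoeff_eq μ huy.1 huy.2]
  refine Eq.trans ?_ (μ.toFun_comb (c.frame (c.src (u, y))) (c.quotDeriv (u, y)).toLinearMap)
  refine μ.toFun_congr (c.φ_src hp).symm fun i => ?_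
  have h1 : HasFDerivAt (fun x : Eu m => (c.quot (u, y, x)).2) (c.quotDeriv (u, y)) y :=
    HasFDerivAt.comp (g := fun q => (c.quot q).2) (f := fun w : Eu m => (u, y, w))
      y (c.hasFDerivAt_quot_snd hdq) (hasFDerivAt_inThird u y y)
  have h2 : HasFDerivAt (fun x : Eu m => ((c.src (u, y), (c.quot (u, y, x)).2) : Eu n × Eu m))
      ((0 : Eu m →L[ℝ] Eu n).prod (c.quotDeriv (u, y))) y :=
    (hasFDerivAt_const (c.src (u, y)) y).prodMk h1
  have h0 : ((c.src (u, y), (c.quot (u, y, y)).2) : Eu n × Eu m) = (c.src (u, y), 0) := by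
    rw [c.quot_diag hp]
  have h3 := mfderiv_comp_of_eq (I := 𝓘(ℝ, Eu m)) (I' := 𝓘(ℝ, Eu n × Eu m))
    (I'' := 𝓘(ℝ, Eu (n + m))) (g := c.ψ)
    (f := fun x : Eu m => ((c.src (u, y), (c.quot (u, y, x)).2) : Eu n × Eu m)) (x := y)
    (c.mdifferentiableAt_ψ (c.zero_mem_source hσ)) h2.differentiableAt.mdifferentiableAt h0
  have h4 : (fun x : Eu m => Γ.mul (Γ.inv (c.ψ (u, y))) (c.ψ (u, x))) =ᶠ[𝓝 y]
      c.ψ ∘ fun x : Eu m => ((c.src (u, y), (c.quot (u, y, x)).2) : Eu n × Eu m) := by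
    have hc : ContinuousAt (fun w : Eu m => ((u, y, w) : Eu n × Eu m × Eu m)) y := by fun_prop
    filter_upwards [hc.preimage_mem_nhds (c.isOpen_quotDomain.mem_nhds hdq)] with x hx
    have h5 := c.ψ_quot (p := (u, y, x)) hx
    have h6 := c.fst_quot (p := (u, y, x)) hx
    change c.quotElt (u, y, x) = c.ψ (c.src (u, y), (c.quot (u, y, x)).2)
    rw [← h5, ← h6]
  change (mfderiv 𝓘(ℝ, Eu m) 𝓘(ℝ, Eu (n + m))
    (fun w : Eu m => Γ.mul (Γ.inv (c.ψ (u, y))) (c.ψ (u, w))) y (stdVec i) : Eu (n + m)) = _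
  rw [h4.mfderiv_eq, h3, mfderiv_eq_fderiv, h2.fderiv]
  refine Eq.trans ?_ (c.coe_sum_frame hσ (c.quotDeriv (u, y) (stdVec i))).symm
  exact congrArg (fun q : Eu n × Eu m => (mfderiv 𝓘(ℝ, Eu n × Eu m) 𝓘(ℝ, Eu (n + m)) c.ψ q
    ((0, c.quotDeriv (u, y) (stdVec i)) : Eu n × Eu m) : Eu (n + m))) h0

end AdaptedChart

/-! ### The convolution in a chart of the tangent groupoid -/

namespace AdaptedChart

variable (c : Γ.AdaptedChart) (μ : Γ.SmoothDensity)

/-- The coefficient of the Haar system in an adapted chart, for `p` in `lamDomain`: the absolute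
value of the Jacobian is left out, so that the function is smooth. -/
def lam (p : Eu n × Eu m) : ℝ := (c.quotDeriv p).det * μ.coeff c (c.src p)

/-- The points near the units, where the Jacobian of the coefficient of the Haar system is
positive. -/
def lamDomain : Set (Eu n × Eu m) :=
  c.srcDomain ∩ (fun p => (c.quotDeriv p).det) ⁻¹' Set.Ioi 0

theorem contDiffOn_det_quotDeriv : ContDiffOn ℝ ∞ (fun p => (c.quotDeriv p).det) c.srcDomain :=
  contDiff_det.comp_contDiffOn c.contDiffOn_quotDeriv

theorem isOpen_lamDomain : IsOpen c.lamDomain :=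
  c.contDiffOn_det_quotDeriv.continuousOn.isOpen_inter_preimage c.isOpen_srcDomain isOpen_Ioi

theorem contDiffOn_coeff : ContDiffOn ℝ ∞ (μ.coeff c) c.φ.source := μ.smooth c

theorem contDiffOn_lam : ContDiffOn ℝ ∞ (c.lam μ) c.srcDomain :=
  c.contDiffOn_det_quotDeriv.mul ((c.contDiffOn_coeff μ).comp c.contDiffOn_src
    (fun _ hp => c.src_mem hp))

theorem coeff_pos {u : Eu n} (hu : u ∈ c.φ.source) : 0 < μ.coeff c u := by
  refine μ.pos _ _ ?_
  rw [← c.coe_frameBasis hu]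
  exact (c.frameBasis hu).linearIndependent

theorem haarCoeff_eq_lam {p : Eu n × Eu m} (hp : p ∈ c.lamDomain) :
    c.toSubmersionChart.haarCoeff μ p.1 p.2 = c.lam μ p := by
  rw [c.haarCoeff_adapted μ hp.1, lam, abs_of_pos hp.2]

theorem lam_nonneg {p : Eu n × Eu m} (hp : p ∈ c.lamDomain) : 0 ≤ c.lam μ p :=
  mul_nonneg (le_of_lt hp.2) (c.coeff_pos μ (c.src_mem hp.1)).le

theorem lam_zero {u : Eu n} (hu : u ∈ c.φ.source) : c.lam μ (u, 0) = μ.coeff c u := by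
  rw [lam, c.quotDeriv_zero hu, c.src_zero hu, ContinuousLinearMap.det]
  simp

theorem zero_mem_lamDomain {u : Eu n} (hu : u ∈ c.φ.source) : (u, (0 : Eu m)) ∈ c.lamDomain := by
  refine ⟨c.zero_mem_srcDomain hu, ?_⟩
  change 0 < (c.quotDeriv (u, 0)).det
  rw [c.quotDeriv_zero hu, ContinuousLinearMap.det]
  simp

/-- The anchor in coordinates. -/
def anchor (u : Eu n) (y : Eu m) : Eu n := fderiv ℝ c.src (u, 0) (0, y)

theorem hasDerivAt_ray (u : Eu n) (y : Eu m) :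
    HasDerivAt (fun t : ℝ => ((u, t • y) : Eu n × Eu m)) (0, y) 0 := by
  simpa using (hasDerivAt_const (0 : ℝ) u).prodMk ((hasDerivAt_id (0 : ℝ)).smul_const y)

theorem hasDerivAt_src {u : Eu n} (hu : u ∈ c.φ.source) (y : Eu m) :
    HasDerivAt (fun t : ℝ => c.src (u, t • y)) (c.anchor u y) 0 := by
  have h1 : HasFDerivAt c.src (fderiv ℝ c.src (u, 0)) (u, (0 : ℝ) • y) := by
    simpa using c.hasFDerivAt_src (c.zero_mem_srcDomain hu)
  exact HasFDerivAt.comp_hasDerivAt (f := fun t : ℝ => ((u, t • y) : Eu n × Eu m)) (0 : ℝ) h1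
    (hasDerivAt_ray u y)

/-- The first-order term in `t` of the coefficient of the Haar system along a ray: minus the trace of
`B_u(y, ·)` comes from the Jacobian, and the derivative of the density along the anchor from the
displacement of the source. -/
theorem hasDerivAt_lam {u : Eu n} (hu : u ∈ c.φ.source) (y : Eu m) :
    HasDerivAt (fun t : ℝ => c.lam μ (u, t • y))
      (-(∑ i, (c.prodBilin u y (stdVec i)) i) * μ.coeff c u +
        fderiv ℝ (μ.coeff c) u (c.anchor u y)) 0 := by
  have h1 : HasFDerivAt c.quotDeriv (fderiv ℝ c.quotDeriv (u, 0)) (u, (0 : ℝ) • y) := by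
    simpa using c.hasFDerivAt_quotDeriv (c.zero_mem_srcDomain hu)
  have h2 := HasFDerivAt.comp_hasDerivAt (f := fun t : ℝ => ((u, t • y) : Eu n × Eu m)) (0 : ℝ) h1
    (hasDerivAt_ray u y)
  have h3 := hasDerivAt_det_id h2 (by
    change c.quotDeriv (u, (0 : ℝ) • y) = _
    rw [zero_smul, c.quotDeriv_zero hu])
  have h4 : HasFDerivAt (μ.coeff c) (fderiv ℝ (μ.coeff c) u) (c.src (u, (0 : ℝ) • y)) := by
    rw [zero_smul, c.src_zero hu]
    exact (((c.contDiffOn_coeff μ).contDiffAt (c.φ.open_source.mem_nhds hu)).differentiableAt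
      (by simp)).hasFDerivAt
  have h5 := HasFDerivAt.comp_hasDerivAt (f := fun t : ℝ => c.src (u, t • y)) (0 : ℝ) h4
    (c.hasDerivAt_src hu y)
  refine (h3.mul h5).congr_deriv ?_
  change (∑ i, (fderiv ℝ c.quotDeriv (u, 0) (0, y) (stdVec i)) i) *
      μ.coeff c (c.src (u, (0 : ℝ) • y)) + (c.quotDeriv (u, (0 : ℝ) • y)).det *
      fderiv ℝ (μ.coeff c) u (c.anchor u y) = _
  simp only [zero_smul, c.quotDeriv_zero hu, c.src_zero hu, c.fderiv_quotDeriv_zero hu]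
  simp [ContinuousLinearMap.det]

/-- A function on the tangent groupoid in the chart. -/
def pull (f : Γ.TangentGroupoid → ℂ) (p : Eu n × Eu m × ℝ) : ℂ := f (c.tangentChart p)

/-- The integrand of the convolution in the chart: with `y` rescaled by `t`, it is continuously
differentiable in all variables, also at `t = 0`. -/
def convIntegrand (f g : Γ.TangentGroupoid → ℂ) (q : (Eu n × Eu m × ℝ) × Eu m) : ℂ :=
  c.pull f (q.1.1, q.2, q.1.2.2) *
    c.pull g (c.src (q.1.1, q.1.2.2 • q.2),
      divTime c.quotScaled ((q.1.1, q.2, q.1.2.1), q.1.2.2), q.1.2.2) *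
    (c.lam μ (q.1.1, q.1.2.2 • q.2) : ℂ)

/-- The domain of the integrand of the convolution in the chart. -/
def convDomain : Set ((Eu n × Eu m × ℝ) × Eu m) :=
  (fun q : (Eu n × Eu m × ℝ) × Eu m => (q.1.1, q.1.2.2 • q.2)) ⁻¹' c.lamDomain ∩
  (fun q : (Eu n × Eu m × ℝ) × Eu m => ((q.1.1, q.2, q.1.2.1), q.1.2.2)) ⁻¹' c.quotScaledDomain

theorem isOpen_convDomain : IsOpen c.convDomain :=
  (c.isOpen_lamDomain.preimage (by fun_prop)).inter
    (c.isOpen_quotScaledDomain.preimage (by fun_prop))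

theorem mem_convDomain_zero {u : Eu n} (hu : u ∈ c.φ.source) (x y : Eu m) :
    ((u, x, (0 : ℝ)), y) ∈ c.convDomain := by
  refine ⟨?_, c.mem_quotScaledDomain_zero hu y x⟩
  change (u, (0 : ℝ) • y) ∈ c.lamDomain
  rw [zero_smul]
  exact c.zero_mem_lamDomain hu

theorem smul_divTime_quotScaled {u : Eu n} {x y : Eu m} {t : ℝ}
    (h : ((u, y, x), t) ∈ c.quotScaledDomain) :
    t • divTime c.quotScaled ((u, y, x), t) = c.quotScaled ((u, y, x), t) := by
  by_cases ht : t = 0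
  · subst ht
    rw [zero_smul, c.quotScaled_zero _ h]
  · simp [divTime, ht]

theorem quot_eq_of_mem {u : Eu n} {x y : Eu m} {t : ℝ}
    (h : ((u, y, x), t) ∈ c.quotScaledDomain) :
    c.quot (u, t • y, t • x) =
      (c.src (u, t • y), t • divTime c.quotScaled ((u, y, x), t)) := by
  rw [c.smul_divTime_quotScaled h]
  exact Prod.ext (c.fst_quot h) rfl

theorem mem_tangentDomain_of_convDomain {u : Eu n} {x y : Eu m} {t : ℝ}
    (h : ((u, x, t), y) ∈ c.convDomain) :
    (u, y, t) ∈ c.tangentDomain ∧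
      (c.src (u, t • y), divTime c.quotScaled ((u, y, x), t), t) ∈ c.tangentDomain := by
  refine ⟨⟨h.2.1.1, h.2.1.2.1⟩, ⟨c.src_mem h.1.1, ?_⟩⟩
  have h1 : c.quot (u, t • y, t • x) ∈ c.ψ.source := c.quot_mem h.2
  have h2 := c.quot_eq_of_mem h.2
  rw [h2] at h1
  exact (c.mem_source.1 h1).2

variable {f g : Γ.TangentGroupoid → ℂ}

/-- One derivative across `t = 0` is all that differentiation under the integral sign needs. -/
theorem contDiffOn_convIntegrand (hf : IsSmoothCompactlySupported f)
    (hg : IsSmoothCompactlySupported g) :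
    ContDiffOn ℝ 1 (c.convIntegrand μ f g) c.convDomain := by
  have h1 : ContDiffOn ℝ 1 (fun q : (Eu n × Eu m × ℝ) × Eu m =>
      c.pull f (q.1.1, q.2, q.1.2.2)) c.convDomain :=
    ((hf.smooth_chart c).of_le (by simp)).comp (by fun_prop)
      (fun q hq => (c.mem_tangentDomain_of_convDomain hq).1)
  have hs : ContDiffOn ℝ 1 (fun q : (Eu n × Eu m × ℝ) × Eu m =>
      c.src (q.1.1, q.1.2.2 • q.2)) c.convDomain :=
    (c.contDiffOn_src.of_le (by simp)).comp
      (f := fun q : (Eu n × Eu m × ℝ) × Eu m => (q.1.1, q.1.2.2 • q.2)) (by fun_prop)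
      (fun q hq => hq.1.1)
  have hz : ContDiffOn ℝ 1 (fun q : (Eu n × Eu m × ℝ) × Eu m =>
      divTime c.quotScaled ((q.1.1, q.2, q.1.2.1), q.1.2.2)) c.convDomain :=
    c.contDiffOn_divTime_quotScaled.comp
      (f := fun q : (Eu n × Eu m × ℝ) × Eu m => ((q.1.1, q.2, q.1.2.1), q.1.2.2)) (by fun_prop)
      (fun q hq => hq.2)
  have h2 : ContDiffOn ℝ 1 (fun q : (Eu n × Eu m × ℝ) × Eu m =>
      c.pull g (c.src (q.1.1, q.1.2.2 • q.2),
        divTime c.quotScaled ((q.1.1, q.2, q.1.2.1), q.1.2.2), q.1.2.2)) c.convDomain :=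
    ((hg.smooth_chart c).of_le (by simp)).comp (hs.prodMk (hz.prodMk (by fun_prop)))
      (fun q hq => (c.mem_tangentDomain_of_convDomain hq).2)
  have h3 : ContDiffOn ℝ 1 (fun q : (Eu n × Eu m × ℝ) × Eu m =>
      (c.lam μ (q.1.1, q.1.2.2 • q.2) : ℂ)) c.convDomain :=
    Complex.ofRealCLM.contDiff.comp_contDiffOn
      (((c.contDiffOn_lam μ).of_le (by simp)).comp
        (f := fun q : (Eu n × Eu m × ℝ) × Eu m => (q.1.1, q.1.2.2 • q.2)) (by fun_prop)
        (fun q hq => hq.1.1))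
  exact (h1.mul h2).mul h3

/-- The `t`-derivative at `t = 0` of the integrand of the convolution. -/
def convIntegrandDeriv (f g : Γ.TangentGroupoid → ℂ) (u : Eu n) (x y : Eu m) : ℂ :=
  (fderiv ℝ (c.pull f) (u, y, 0) (0, 0, 1) * c.pull g (u, x - y, 0) +
    c.pull f (u, y, 0) * fderiv ℝ (c.pull g) (u, x - y, 0)
      (c.anchor u y, -c.prodBilin u y (x - y), 1)) * (μ.coeff c u : ℂ) +
  c.pull f (u, y, 0) * c.pull g (u, x - y, 0) *
    ((-(∑ i, (c.prodBilin u y (stdVec i)) i) * μ.coeff c u +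
        fderiv ℝ (μ.coeff c) u (c.anchor u y) : ℝ) : ℂ)

theorem hasFDerivAt_pull (hf : IsSmoothCompactlySupported f) {p : Eu n × Eu m × ℝ}
    (hp : p ∈ c.tangentDomain) : HasFDerivAt (c.pull f) (fderiv ℝ (c.pull f) p) p :=
  (((hf.smooth_chart c).contDiffAt (c.isOpen_tangentDomain.mem_nhds hp)).differentiableAt
    (by simp)).hasFDerivAt

theorem hasDerivAt_convIntegrand (hf : IsSmoothCompactlySupported f)
    (hg : IsSmoothCompactlySupported g) {u : Eu n} (hu : u ∈ c.φ.source) (x y : Eu m) :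
    HasDerivAt (fun t : ℝ => c.convIntegrand μ f g ((u, x, t), y))
      (c.convIntegrandDeriv μ f g u x y) 0 := by
  have h1 : HasDerivAt (fun t : ℝ => c.pull f (u, y, t))
      (fderiv ℝ (c.pull f) (u, y, 0) (0, 0, 1)) 0 :=
    HasFDerivAt.comp_hasDerivAt (f := fun t : ℝ => ((u, y, t) : Eu n × Eu m × ℝ)) (0 : ℝ)
      (c.hasFDerivAt_pull hf (c.mem_tangentDomain_zero hu y))
      ((hasDerivAt_const _ _).prodMk ((hasDerivAt_const _ _).prodMk (hasDerivAt_id _)))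
  have hz := c.hasDerivAt_divTime_quotScaled hu y x
  have h2 : HasDerivAt (fun t : ℝ => c.pull g (c.src (u, t • y),
      divTime c.quotScaled ((u, y, x), t), t)) (fderiv ℝ (c.pull g) (u, x - y, 0)
      (c.anchor u y, -c.prodBilin u y (x - y), 1)) 0 := by
    have h3 : HasFDerivAt (c.pull g) (fderiv ℝ (c.pull g) (u, x - y, 0))
        (c.src (u, (0 : ℝ) • y), divTime c.quotScaled ((u, y, x), 0), (0 : ℝ)) := by
      rw [zero_smul, c.src_zero hu, c.divTime_quotScaled_zero hu]
      exact c.hasFDerivAt_pull hg (c.mem_tangentDomain_zero hu _)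
    exact HasFDerivAt.comp_hasDerivAt (f := fun t : ℝ => (c.src (u, t • y),
      divTime c.quotScaled ((u, y, x), t), t)) (0 : ℝ) h3
      ((c.hasDerivAt_src hu y).prodMk (hz.prodMk (hasDerivAt_id _)))
  have h4 := (c.hasDerivAt_lam μ hu y).ofReal_comp
  have h5 := (h1.mul h2).mul h4
  simp only [Pi.mul_apply, zero_smul, c.src_zero hu, c.divTime_quotScaled_zero hu,
    c.lam_zero μ hu] at h5
  exact h5

theorem pull_zero (f : Γ.TangentGroupoid → ℂ) (u : Eu n) (v : Eu m) :
    c.pull f (u, v, 0) = f (.ofZero (c.θ u v)) := by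
  rw [pull, tangentChart_zero]

theorem convIntegrand_zero {u : Eu n} (hu : u ∈ c.φ.source) (x y : Eu m) :
    c.convIntegrand μ f g ((u, x, 0), y) =
      c.pull f (u, y, 0) * c.pull g (u, x - y, 0) * (μ.coeff c u : ℂ) := by
  simp only [convIntegrand, zero_smul, c.src_zero hu, c.divTime_quotScaled_zero hu,
    c.lam_zero μ hu]

/-- The support of `f` in the chart is bounded locally uniformly near a point of the fibre
`t = 0`. -/
theorem exists_pull_eq_zero [T2Space G] (hf : IsSmoothCompactlySupported f)
    {u : Eu n} (hu : u ∈ c.φ.source) :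
    ∃ δ > 0, ∃ R : ℝ, Metric.ball u δ ⊆ c.φ.source ∧ ∀ u' ∈ Metric.ball u δ, ∀ (y : Eu m) (t : ℝ),
      |t| < δ → (u', y, t) ∈ c.tangentDomain → R ≤ ‖y‖ → c.pull f (u', y, t) = 0 := by
  have : T2Space M := t2Space_base Γ
  obtain ⟨δ, hδ, R, -, hball, hsupp⟩ := c.exists_support_bound hf.compact hu
  refine ⟨δ, hδ, R, hball, fun u' hu' y t ht hdom hR => ?_⟩
  by_contra h
  have h1 := (hsupp _ h u' hu' t ht (c.proj_tangentChart hdom)).2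
  rw [c.tangentCoord_tangentChart hdom] at h1
  exact absurd hR (not_le.2 h1)

theorem exists_pull_eventuallyEq_zero [T2Space G] (hf : IsSmoothCompactlySupported f)
    {u : Eu n} (hu : u ∈ c.φ.source) :
    ∃ R : ℝ, ∀ y, R < ‖y‖ → c.pull f =ᶠ[𝓝 (u, y, (0 : ℝ))] fun _ => 0 := by
  obtain ⟨δ, hδ, R, -, hzero⟩ := c.exists_pull_eq_zero hf hu
  refine ⟨R, fun y hy => ?_⟩
  have hR : ∀ᶠ p : Eu n × Eu m × ℝ in 𝓝 (u, y, (0 : ℝ)), R < ‖p.2.1‖ :=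
    (show Continuous fun p : Eu n × Eu m × ℝ => ‖p.2.1‖ by
      fun_prop).continuousAt.eventually_const_lt hy
  filter_upwards [hR, c.isOpen_tangentDomain.mem_nhds (c.mem_tangentDomain_zero hu y),
    Metric.ball_mem_nhds (u, y, (0 : ℝ)) hδ] with p hp hpd hpδ
  obtain ⟨u', x', t⟩ := p
  rw [Metric.mem_ball, Prod.dist_eq, Prod.dist_eq, max_lt_iff, max_lt_iff] at hpδ
  exact hzero u' hpδ.1 x' t (by simpa using hpδ.2.2) hpd hp.le

/-- The derivative of the integrand of the convolution vanishes outside a ball. -/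
theorem exists_convIntegrandDeriv_eq_zero [T2Space G] (hf : IsSmoothCompactlySupported f)
    {u : Eu n} (hu : u ∈ c.φ.source) :
    ∃ R : ℝ, ∀ x y, R < ‖y‖ → c.convIntegrandDeriv μ f g u x y = 0 := by
  obtain ⟨R, hR⟩ := c.exists_pull_eventuallyEq_zero hf hu
  refine ⟨R, fun x y hy => ?_⟩
  have h1 := hR y hy
  rw [convIntegrandDeriv, h1.fderiv_eq, h1.eq_of_nhds]
  simp

variable [MeasurableSpace G] [BorelSpace G]

theorem conv_tangentChart_zero {u : Eu n} (hu : u ∈ c.φ.source) (x : Eu m) :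
    conv μ f g (c.tangentChart (u, x, 0)) =
      (μ.coeff c u : ℂ) * ∫ y, c.pull f (u, y, 0) * c.pull g (u, x - y, 0) := by
  rw [tangentChart_zero]
  change μ.fibreIntegral (c.φ u) (fun Y => f (.ofZero ⟨c.φ u, Y⟩) *
    g (.ofZero ⟨c.φ u, (∑ i, x i • c.frame u i) - Y⟩)) = _
  rw [μ.fibreIntegral_eq (c.frameBasis hu), c.coe_frameBasis hu]
  congr 1
  refine integral_congr_ae (Filter.Eventually.of_forall fun y => ?_)
  simp only [pull_zero, θ, comb_apply]
  congr 4
  rw [← Finset.sum_sub_distrib]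
  refine Finset.sum_congr rfl fun i _ => ?_
  rw [← sub_smul]
  rfl

open scoped Pointwise in
/-- The convolution in a chart of the tangent groupoid, near `t = 0`, as an integral over a fixed
ball. The substitution `v = t y` absorbs the factor `|t|⁻ᵐ`. -/
theorem conv_tangentChart [T1Space M] [T2Space G] (hf : IsSmoothCompactlySupported f)
    (hg : IsSmoothCompactlySupported g) {u : Eu n} {x : Eu m} {t R : ℝ} (hR : 0 ≤ R)
    (hdom : ∀ y ∈ Metric.closedBall (0 : Eu m) R, ((u, x, t), y) ∈ c.convDomain)
    (hsupp : ∀ z, f z ≠ 0 → z.proj = (c.φ u, t) →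
      z ∈ c.tangentTarget ∧ ‖c.tangentCoord z‖ ≤ R) :
    conv μ f g (c.tangentChart (u, x, t)) =
      ∫ y in Metric.closedBall 0 R, c.convIntegrand μ f g ((u, x, t), y) := by
  have h0 := hdom 0 (by simpa using hR)
  have hu : u ∈ c.φ.source := h0.2.1.1
  have hx : t • x ∈ c.V := h0.2.1.2.2
  by_cases ht : t = 0
  · subst ht
    rw [c.conv_tangentChart_zero μ hu]
    simp only [c.convIntegrand_zero μ hu]
    rw [integral_mul_const, mul_comm, setIntegral_eq_integral_of_forall_compl_eq_zero]
    intro y hy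
    by_contra h
    have h1 := (hsupp (c.tangentChart (u, y, 0)) (left_ne_zero_of_mul h)
      (c.proj_tangentChart (c.mem_tangentDomain_zero hu y))).2
    rw [c.tangentCoord_tangentChart (c.mem_tangentDomain_zero hu y)] at h1
    exact hy (by simpa using h1)
  · set B := Metric.closedBall (0 : Eu m) R with hB
    let γ : G := c.ψ (u, t • x)
    have hγ : Γ.r γ = c.φ u := c.r_ψ u hu _ hx
    let F : G → ℂ := fun η => f (.ofNe η t ht) * g (.ofNe (Γ.mul (Γ.inv η) γ) t ht)
    have hcont : ∀ {h : Γ.TangentGroupoid → ℂ}, IsSmoothCompactlySupported h →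
        Continuous fun η : G => h (.ofNe η t ht) := by
      intro h hh
      have h1 := hh.smooth_ne.continuousOn.comp_continuous
        (f := fun η : G => (η, t)) (by fun_prop) (fun η => ht)
      simpa [Function.comp_def, ht] using h1
    have hF : ContinuousOn F (Γ.r ⁻¹' {c.φ u}) := by
      refine (hcont hf).continuousOn.mul ((hcont hg).comp_continuousOn ?_)
      refine Γ.contMDiffOn_mul.continuousOn.comp (f := fun η : G => (Γ.inv η, γ))
        (Γ.contMDiff_inv.continuous.prodMk continuous_const).continuousOn fun η hη => ?_
      change Γ.s (Γ.inv η) = Γ.r γ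
      rw [Γ.s_inv, hγ]
      exact hη
    have hlamA : ∀ v ∈ t • B, (u, v) ∈ c.lamDomain := by
      rintro _ ⟨y, hy, rfl⟩
      exact (hdom y hy).1
    have hAV : t • B ⊆ c.V := fun v hv => (c.mem_source.1 (hlamA v hv).1.1).2
    have hlam : ∀ v ∈ t • B, c.haarCoeff μ u v = c.lam μ (u, v) := fun v hv =>
      c.haarCoeff_eq_lam μ (hlamA v hv)
    have hint := c.toSubmersionChart.integral_haar μ hu (A := t • B)
      ((isCompact_closedBall (0 : Eu m) R).smul t) hAV
      (((c.contDiffOn_lam μ).continuousOn.comp (f := fun v : Eu m => (u, v)) (by fun_prop)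
        (fun v hv => (hlamA v hv).1)).congr hlam)
      (fun v hv => by rw [hlam v hv]; exact c.lam_nonneg μ (hlamA v hv)) hF (by
        intro η hη hFη
        have h1 := hsupp (.ofNe η t ht) (left_ne_zero_of_mul hFη) (by rw [← hη]; rfl)
        have h2 : η ∈ c.ψ.target := h1.1
        have h3 : (c.ψ.symm η).1 = u :=
          c.φ.injOn (c.symm_mem h2).1 hu ((c.φ_fst_symm h2).trans hη)
        refine ⟨(c.ψ.symm η).2, ⟨t⁻¹ • (c.ψ.symm η).2, ?_, ?_⟩, ?_⟩
        · rw [hB, mem_closedBall_zero_iff]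
          exact h1.2
        · simp [smul_smul, mul_inv_cancel₀ ht]
        · rw [← h3, Prod.mk.eta, c.ψ.right_inv h2])
    -- The substitution `v = t y` in the integral over the ball.
    have hsub := Measure.setIntegral_comp_smul (volume : Measure (Eu m))
      (fun v => (c.haarCoeff μ u v : ℂ) * F (c.ψ (u, v))) (s := B) ht
    rw [c.tangentChart_ne ht]
    change ((|t| ^ m : ℝ) : ℂ)⁻¹ * ∫ η, F η ∂(μ.haar (Γ.r γ)) = _
    rw [hγ, hint]
    have habs : |(t ^ Module.finrank ℝ (Eu m))⁻¹| = (|t| ^ m)⁻¹ := by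
      simp [abs_inv, abs_pow]
    rw [habs, Complex.real_smul, Complex.ofReal_inv] at hsub
    rw [← hsub]
    refine setIntegral_congr_fun Metric.isClosed_closedBall.measurableSet fun y hy => ?_
    have hq := hdom y hy
    have hquot : Γ.mul (Γ.inv (c.ψ (u, t • y))) γ =
        c.ψ (c.src (u, t • y), t • divTime c.quotScaled ((u, y, x), t)) := by
      rw [← c.quot_eq_of_mem hq.2]
      exact (c.ψ_quot hq.2).symm
    change (c.haarCoeff μ u (t • y) : ℂ) * (f (.ofNe (c.ψ (u, t • y)) t ht) *
      g (.ofNe (Γ.mul (Γ.inv (c.ψ (u, t • y))) γ) t ht)) = _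
    rw [hlam _ (Set.smul_mem_smul_set hy), hquot, convIntegrand, pull, pull, c.tangentChart_ne ht,
      c.tangentChart_ne ht]
    ring

variable {c}

/-- Near a point of the fibre `t = 0`, the convolution is given in the chart by an integral over a
ball that is as large as desired. -/
theorem exists_conv_eventuallyEq [T2Space G] (hf : IsSmoothCompactlySupported f)
    (hg : IsSmoothCompactlySupported g) {u : Eu n} (hu : u ∈ c.φ.source) (x : Eu m) :
    ∃ R₀ : ℝ, 0 ≤ R₀ ∧ ∀ R ≥ R₀, (fun p => conv μ f g (c.tangentChart p)) =ᶠ[𝓝 (u, x, (0 : ℝ))]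
      fun p => ∫ y in Metric.closedBall 0 R, c.convIntegrand μ f g (p, y) := by
  have : T2Space M := t2Space_base Γ
  obtain ⟨δ, hδ, R₀, hR₀, -, hsupp⟩ := c.exists_support_bound hf.compact hu
  refine ⟨R₀, hR₀.le, fun R hR => ?_⟩
  obtain ⟨r, hr, hrΩ⟩ := exists_closedBall_prod_subset c.isOpen_convDomain
    (isCompact_closedBall (0 : Eu m) R) (p₀ := (u, x, (0 : ℝ)))
    (fun y _ => c.mem_convDomain_zero hu x y)
  filter_upwards [Metric.closedBall_mem_nhds _ hr, Metric.ball_mem_nhds (u, x, (0 : ℝ)) hδ]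
    with p hp hpδ
  obtain ⟨u', x', t⟩ := p
  rw [Metric.mem_ball, Prod.dist_eq, Prod.dist_eq, max_lt_iff, max_lt_iff] at hpδ
  refine c.conv_tangentChart μ hf hg (hR₀.le.trans hR) (fun y hy => hrΩ ⟨hp, hy⟩) fun z hz hzp => ?_
  have h := hsupp z hz u' hpδ.1 t (by simpa using hpδ.2.2) hzp
  exact ⟨h.1, (h.2.trans_le hR).le⟩

variable (c)

/-- The `t`-derivative of the convolution at `t = 0`, in the chart. -/
def convDeriv (f g : Γ.TangentGroupoid → ℂ) (u : Eu n) (x : Eu m) : ℂ :=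
  ∫ y, c.convIntegrandDeriv μ f g u x y

theorem exists_hasFDerivAt_conv [T2Space G] (hf : IsSmoothCompactlySupported f)
    (hg : IsSmoothCompactlySupported g) {u : Eu n} (hu : u ∈ c.φ.source) (x : Eu m) :
    ∃ L : Eu n × Eu m × ℝ →L[ℝ] ℂ, L (0, 0, 1) = c.convDeriv μ f g u x ∧
      HasFDerivAt (fun p => conv μ f g (c.tangentChart p)) L (u, x, 0) := by
  obtain ⟨R₀, -, hconv⟩ := exists_conv_eventuallyEq μ hf hg hu x
  obtain ⟨R₁, hzero⟩ := c.exists_convIntegrandDeriv_eq_zero μ (g := g) hf hu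
  let R := max R₀ R₁
  let B := Metric.closedBall (0 : Eu m) R
  have hΦ := c.contDiffOn_convIntegrand μ hf hg
  have hB : IsCompact B := isCompact_closedBall _ _
  have hBdom : ∀ y ∈ B, ((u, x, (0 : ℝ)), y) ∈ c.convDomain :=
    fun y _ => c.mem_convDomain_zero hu x y
  refine ⟨_, ?_, (hasFDerivAt_setIntegral_of_contDiffOn c.isOpen_convDomain hB hΦ hBdom
    volume).congr_of_eventuallyEq (hconv R (le_max_left _ _))⟩
  have hcont : ContinuousOn (fun y => (fderiv ℝ (c.convIntegrand μ f g) ((u, x, (0 : ℝ)), y)).comp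
      (ContinuousLinearMap.inl ℝ (Eu n × Eu m × ℝ) (Eu m))) B :=
    ((hΦ.continuousOn_fderiv_of_isOpen c.isOpen_convDomain le_rfl).comp (by fun_prop)
      hBdom).clm_comp continuousOn_const
  have hI : ∫ y in B, c.convIntegrandDeriv μ f g u x y = c.convDeriv μ f g u x := by
    refine setIntegral_eq_integral_of_forall_compl_eq_zero fun y hy => hzero x y ?_
    refine lt_of_le_of_lt (le_max_right R₀ R₁) ?_
    simpa [B, R] using hy
  rw [ContinuousLinearMap.integral_apply (hcont.integrableOn_compact hB), ← hI]
  · refine setIntegral_congr_fun Metric.isClosed_closedBall.measurableSet fun y hy => ?_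
    have h1 : HasFDerivAt (c.convIntegrand μ f g)
        (fderiv ℝ (c.convIntegrand μ f g) ((u, x, 0), y)) ((u, x, 0), y) :=
      ((hΦ.contDiffAt (c.isOpen_convDomain.mem_nhds (hBdom y hy))).differentiableAt
        (by simp)).hasFDerivAt
    have h2 := HasFDerivAt.comp_hasDerivAt
      (f := fun t : ℝ => (((u, x, t), y) : (Eu n × Eu m × ℝ) × Eu m)) (0 : ℝ) h1
      (((hasDerivAt_const _ _).prodMk ((hasDerivAt_const _ _).prodMk (hasDerivAt_id _))).prodMk
        (hasDerivAt_const _ _))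
    exact h2.unique (c.hasDerivAt_convIntegrand μ hf hg hu x y)

/-- The commutator vanishes at `t = 0`, since the convolution in a vector group is commutative. -/
theorem commutator_tangentChart_zero {u : Eu n} (hu : u ∈ c.φ.source) (x : Eu m) :
    commutator μ f g (c.tangentChart (u, x, 0)) = 0 := by
  rw [commutator, c.conv_tangentChart_zero μ hu, c.conv_tangentChart_zero μ hu,
    ← integral_sub_left_eq_self _ _ x]
  simp only [sub_sub_cancel]
  rw [sub_eq_zero]
  congr 2
  ext y
  rw [mul_comm]

/-- The commutator is differentiable at the points of the fibre `t = 0`, and its differential there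
is a multiple of `dt`, since the commutator vanishes on this fibre. -/
theorem hasFDerivAt_commutator [T2Space G] (hf : IsSmoothCompactlySupported f)
    (hg : IsSmoothCompactlySupported g) {u : Eu n} (hu : u ∈ c.φ.source) (x : Eu m) :
    HasFDerivAt (fun p : Eu n × Eu m × ℝ => commutator μ f g (c.tangentChart p))
      ((c.convDeriv μ f g u x - c.convDeriv μ g f u x) • (Complex.ofRealCLM.comp
        ((ContinuousLinearMap.snd ℝ (Eu m) ℝ).comp
          (ContinuousLinearMap.snd ℝ (Eu n) (Eu m × ℝ))))) (u, x, 0) := by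
  obtain ⟨L, hL, hLf⟩ := c.exists_hasFDerivAt_conv μ hf hg hu x
  obtain ⟨L', hL', hLf'⟩ := c.exists_hasFDerivAt_conv μ hg hf hu x
  have h := hLf.sub hLf'
  -- The commutator is constant on the fibre `t = 0`, so its differential vanishes along it.
  have hzero : ∀ (a : Eu n) (b : Eu m), (L - L') (a, b, 0) = 0 := by
    intro a b
    have hι : HasFDerivAt (fun q : Eu n × Eu m => ((q.1, q.2, (0 : ℝ)) : Eu n × Eu m × ℝ))
        ((ContinuousLinearMap.fst ℝ (Eu n) (Eu m)).prod
          ((ContinuousLinearMap.snd ℝ (Eu n) (Eu m)).prod 0)) (u, x) :=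
      hasFDerivAt_fst.prodMk (hasFDerivAt_snd.prodMk (hasFDerivAt_const _ _))
    have h1 := HasFDerivAt.comp (f := fun q : Eu n × Eu m => ((q.1, q.2, (0 : ℝ)) :
      Eu n × Eu m × ℝ)) (u, x) h hι
    have h2 : HasFDerivAt (fun q : Eu n × Eu m => commutator μ f g (c.tangentChart (q.1, q.2, 0)))
        (0 : Eu n × Eu m →L[ℝ] ℂ) (u, x) := by
      refine (hasFDerivAt_const (0 : ℂ) _).congr_of_eventuallyEq ?_
      filter_upwards [(c.φ.open_source.preimage continuous_fst).mem_nhds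
        (show (u, x) ∈ Prod.fst ⁻¹' c.φ.source from hu)] with q hq
      exact c.commutator_tangentChart_zero μ hq q.2
    exact congrArg (fun T : Eu n × Eu m →L[ℝ] ℂ => T (a, b)) (h1.unique h2)
  refine h.congr_fderiv (Eq.symm ?_)
  refine ContinuousLinearMap.ext fun p => ?_
  obtain ⟨a, b, t⟩ := p
  have hp : ((a, b, t) : Eu n × Eu m × ℝ) = (a, b, 0) + t • (0, 0, 1) := by simp
  change _ = (L - L') (a, b, t)
  rw [hp, map_add (L - L'), hzero, map_smul (L - L')]
  simp [hL, hL']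
  ring

end AdaptedChart

/-! ### The derivative of the convolution as a Schwartz function on the fibres -/

namespace AdaptedChart

open SchwartzMap FourierTransform LineDeriv

variable (c : Γ.AdaptedChart) (μ : Γ.SmoothDensity)
variable {f g : Γ.TangentGroupoid → ℂ}

/-- The chart of the tangent groupoid contains the whole fibre over each `u` at `t = 0`. -/
theorem contDiff_fibre {E : Type*} [NormedAddCommGroup E] [NormedSpace ℝ E]
    {Φ : Eu n × Eu m × ℝ → E} (hΦ : ContDiffOn ℝ ∞ Φ c.tangentDomain) {u : Eu n}
    (hu : u ∈ c.φ.source) : ContDiff ℝ ∞ fun y : Eu m => Φ (u, y, 0) := by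
  rw [← contDiffOn_univ]
  exact hΦ.comp (f := fun y : Eu m => ((u, y, 0) : Eu n × Eu m × ℝ)) (by fun_prop)
    (fun y _ => c.mem_tangentDomain_zero hu y)

theorem contDiffOn_fderiv_pull (hf : IsSmoothCompactlySupported f) (w : Eu n × Eu m × ℝ) :
    ContDiffOn ℝ ∞ (fun p => fderiv ℝ (c.pull f) p w) c.tangentDomain :=
  ((hf.smooth_chart c).fderiv_of_isOpen c.isOpen_tangentDomain (by simp)).clm_apply
    contDiffOn_const

/-- The structure constants `B_ijk` of the second-order term of the product in the chart. -/
def prodCoeff (u : Eu n) (i j k : Fin m) : ℝ := (c.prodBilin u (stdVec i) (stdVec j)) k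

theorem anchor_eq {u : Eu n} (hu : u ∈ c.φ.source) (y : Eu m) :
    c.anchor u y = ∑ i, ∑ j, (y i * c.anchorCoeff i j u) • (stdVec j : Eu n) := by
  have h1 : ((0, y) : Eu n × Eu m) = ∑ i, y i • ((0, stdVec i) : Eu n × Eu m) := by
    conv_lhs => rw [Eu.eq_sum_stdVec y]
    ext l <;> simp [Prod.fst_sum, Prod.snd_sum]
  rw [anchor, h1, map_sum]
  refine Finset.sum_congr rfl fun i _ => ?_
  rw [map_smul]
  conv_lhs => rw [Eu.eq_sum_stdVec (fderiv ℝ c.src (u, 0) (0, stdVec i)), Finset.smul_sum]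
  refine Finset.sum_congr rfl fun j _ => ?_
  rw [c.anchorCoeff_eq hu, smul_smul]

theorem prodBilin_apply (u : Eu n) (y w : Eu m) (k : Fin m) :
    (c.prodBilin u y w) k = ∑ i, ∑ j, y i * w j * c.prodCoeff u i j k := by
  have h1 : ((0, y) : Eu n × Eu m) = ∑ i, y i • ((0, stdVec i) : Eu n × Eu m) := by
    conv_lhs => rw [Eu.eq_sum_stdVec y]
    ext l <;> simp [Prod.fst_sum, Prod.snd_sum]
  have h2 : c.prodBilin u y w = ∑ i, ∑ j, (y i * w j) • c.prodBilin u (stdVec i) (stdVec j) := by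
    simp only [prodBilin]
    rw [h1, map_sum, _root_.sum_apply]
    refine Finset.sum_congr rfl fun i _ => ?_
    conv_lhs => rw [Eu.eq_sum_stdVec w, map_sum]
    refine Finset.sum_congr rfl fun j _ => ?_
    rw [map_smul, map_smul, mul_comm, mul_smul]
    rfl
  rw [h2]
  simp [prodCoeff]

variable [T2Space G]

/-- The restriction of `f` to the fibre of the Lie algebroid at `φ u`, in the chart. -/
def fibreMap (hf : IsSmoothCompactlySupported f) {u : Eu n} (hu : u ∈ c.φ.source) :
    𝓢(Eu m, ℂ) :=
  HasCompactSupport.toSchwartzMap (f := fun y => c.pull f (u, y, 0))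
    (by
      obtain ⟨R, hR⟩ := c.exists_pull_eventuallyEq_zero hf hu
      refine HasCompactSupport.intro (isCompact_closedBall (0 : Eu m) R) fun y hy => ?_
      exact (hR y (by simpa using hy)).eq_of_nhds)
    (c.contDiff_fibre (hf.smooth_chart c) hu)

/-- The restriction to the fibre of the Lie algebroid at `φ u` of the derivative of `f` along the
vector `w` in the chart. -/
def fibreDeriv (hf : IsSmoothCompactlySupported f) {u : Eu n} (hu : u ∈ c.φ.source)
    (w : Eu n × Eu m × ℝ) : 𝓢(Eu m, ℂ) :=
  HasCompactSupport.toSchwartzMap (f := fun y => fderiv ℝ (c.pull f) (u, y, 0) w)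
    (by
      obtain ⟨R, hR⟩ := c.exists_pull_eventuallyEq_zero hf hu
      refine HasCompactSupport.intro (isCompact_closedBall (0 : Eu m) R) fun y hy => ?_
      rw [(hR y (by simpa using hy)).fderiv_eq]
      simp)
    (c.contDiff_fibre (c.contDiffOn_fderiv_pull hf w) hu)

theorem fibreMap_apply (hf : IsSmoothCompactlySupported f) {u : Eu n} (hu : u ∈ c.φ.source)
    (y : Eu m) : c.fibreMap hf hu y = c.pull f (u, y, 0) := rfl

theorem fibreDeriv_apply (hf : IsSmoothCompactlySupported f) {u : Eu n} (hu : u ∈ c.φ.source)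
    (w : Eu n × Eu m × ℝ) (y : Eu m) :
    c.fibreDeriv hf hu w y = fderiv ℝ (c.pull f) (u, y, 0) w := rfl

theorem fderiv_fibreMap (hf : IsSmoothCompactlySupported f) {u : Eu n} (hu : u ∈ c.φ.source)
    (y w : Eu m) : fderiv ℝ (c.fibreMap hf hu) y w = fderiv ℝ (c.pull f) (u, y, 0) (0, w, 0) := by
  have h1 : HasFDerivAt (fun y : Eu m => ((u, y, 0) : Eu n × Eu m × ℝ))
      ((0 : Eu m →L[ℝ] Eu n).prod ((ContinuousLinearMap.id ℝ (Eu m)).prod 0)) y :=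
    (hasFDerivAt_const _ _).prodMk ((hasFDerivAt_id _).prodMk (hasFDerivAt_const _ _))
  have h2 := HasFDerivAt.comp (f := fun y : Eu m => ((u, y, 0) : Eu n × Eu m × ℝ)) y
    (c.hasFDerivAt_pull hf (c.mem_tangentDomain_zero hu y)) h1
  exact congrArg (fun T : Eu m →L[ℝ] ℂ => T w) h2.fderiv

/-- The Schwartz function `x ↦ c.convDeriv μ f g u x`, as a combination of convolutions. -/
def convDerivMap (hf : IsSmoothCompactlySupported f) (hg : IsSmoothCompactlySupported g)
    {u : Eu n} (hu : u ∈ c.φ.source) : 𝓢(Eu m, ℂ) :=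
  (μ.coeff c u : ℂ) • (schwartzConv (c.fibreDeriv hf hu (0, 0, 1)) (c.fibreMap hg hu) +
      schwartzConv (c.fibreMap hf hu) (c.fibreDeriv hg hu (0, 0, 1)) +
      ∑ i, ∑ j, (c.anchorCoeff i j u : ℂ) • schwartzConv (coordMul i (c.fibreMap hf hu))
        (c.fibreDeriv hg hu (stdVec j, 0, 0)) -
      ∑ i, ∑ j, ∑ k, (c.prodCoeff u i j k : ℂ) • schwartzConv (coordMul i (c.fibreMap hf hu))
        (∂_{(stdVec k : Eu m)} (coordMul j (c.fibreMap hg hu)))) +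
    ∑ i, ∑ j, ((c.anchorCoeff i j u * fderiv ℝ (μ.coeff c) u (stdVec j) : ℝ) : ℂ) •
      schwartzConv (coordMul i (c.fibreMap hf hu)) (c.fibreMap hg hu)

/-- The derivative of the convolution as a combination of convolutions. With `K = g(u, ·, 0)`, the
term with the trace of `B_u(y, ·)` and the derivative of `K` at `z` along `B_u(y, z)` add up to
`∑ B_ijk y_i ∂_k (z_j K)`, by the Leibniz rule. -/
theorem isIntegralOf_convDerivMap (hf : IsSmoothCompactlySupported f)
    (hg : IsSmoothCompactlySupported g) {u : Eu n} (hu : u ∈ c.φ.source) :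
    IsIntegralOf (c.convDerivMap μ hf hg hu) (c.convIntegrandDeriv μ f g u) := by
  have h := ((((isIntegralOf_schwartzConv (c.fibreDeriv hf hu (0, 0, 1)) (c.fibreMap hg hu)).add
    (isIntegralOf_schwartzConv (c.fibreMap hf hu) (c.fibreDeriv hg hu (0, 0, 1)))).add
    (IsIntegralOf.sum (s := Finset.univ) fun i => IsIntegralOf.sum (s := Finset.univ) fun j =>
      (isIntegralOf_schwartzConv (coordMul i (c.fibreMap hf hu))
        (c.fibreDeriv hg hu (stdVec j, 0, 0))).smul (c.anchorCoeff i j u : ℂ))).sub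
    (IsIntegralOf.sum (s := Finset.univ) fun i => IsIntegralOf.sum (s := Finset.univ) fun j =>
      IsIntegralOf.sum (s := Finset.univ) fun k =>
      (isIntegralOf_schwartzConv (coordMul i (c.fibreMap hf hu))
        (∂_{(stdVec k : Eu m)} (coordMul j (c.fibreMap hg hu)))).smul
          (c.prodCoeff u i j k : ℂ))).smul (μ.coeff c u : ℂ) |>.add
    (IsIntegralOf.sum (s := Finset.univ) fun i => IsIntegralOf.sum (s := Finset.univ) fun j =>
      (isIntegralOf_schwartzConv (coordMul i (c.fibreMap hf hu)) (c.fibreMap hg hu)).smul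
        ((c.anchorCoeff i j u * fderiv ℝ (μ.coeff c) u (stdVec j) : ℝ) : ℂ))
  refine IsIntegralOf.congr h fun x y => ?_
  beta_reduce
  set z := x - y with hz
  have ha : fderiv ℝ (c.pull g) (u, z, 0) (c.anchor u y, -c.prodBilin u y z, 1) =
      ∑ i, ∑ j, (y i * c.anchorCoeff i j u : ℝ) • c.fibreDeriv hg hu (stdVec j, 0, 0) z -
      ∑ k, ((c.prodBilin u y z) k) • fderiv ℝ (c.fibreMap hg hu) z (stdVec k) +
      c.fibreDeriv hg hu (0, 0, 1) z := by
    let L : Eu n × Eu m × ℝ →L[ℝ] ℂ := fderiv ℝ (c.pull g) (u, z, 0)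
    have h1 : ∀ a : Eu n, ∀ b : Eu m, L (a, -b, 1) = L (a, 0, 0) - L (0, b, 0) + L (0, 0, 1) := by
      intro a b
      rw [← map_sub, ← map_add]
      simp
    have h2 : ∀ b : Eu m, L (0, b, 0) = ∑ k, b k • fderiv ℝ (c.fibreMap hg hu) z (stdVec k) := by
      intro b
      rw [← c.fderiv_fibreMap hg hu]
      conv_lhs => rw [Eu.eq_sum_stdVec b, map_sum]
      simp only [map_smul]
    have h3 : L (c.anchor u y, 0, 0) =
        ∑ i, ∑ j, (y i * c.anchorCoeff i j u : ℝ) • c.fibreDeriv hg hu (stdVec j, 0, 0) z := by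
      change (L.comp (ContinuousLinearMap.inl ℝ (Eu n) (Eu m × ℝ))) (c.anchor u y) = _
      simp only [c.anchor_eq hu, map_sum, map_smul]
      rfl
    exact (h1 _ _).trans (by rw [h2, h3]; rfl)
  have hb : fderiv ℝ (μ.coeff c) u (c.anchor u y) =
      ∑ i, ∑ j, y i * c.anchorCoeff i j u * fderiv ℝ (μ.coeff c) u (stdVec j) := by
    simp only [c.anchor_eq hu, map_sum, map_smul, smul_eq_mul]
  rw [convIntegrandDeriv, ha, hb]
  rw [← c.fibreDeriv_apply hf hu, ← c.fibreMap_apply hf hu, ← c.fibreMap_apply hg hu]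
  -- The Leibniz rule for `∂_k (z_j g)` produces the trace of `B_u(y, ·)`.
  have hS : ∑ i, ∑ j, ∑ k, (c.prodCoeff u i j k : ℂ) * (coordMul i (c.fibreMap hf hu) y *
      (∂_{(stdVec k : Eu m)} (coordMul j (c.fibreMap hg hu))) z) =
      c.fibreMap hf hu y * ∑ k, ((c.prodBilin u y z) k) • fderiv ℝ (c.fibreMap hg hu) z (stdVec k) +
      c.fibreMap hf hu y * c.fibreMap hg hu z *
        ((∑ k, (c.prodBilin u y (stdVec k)) k : ℝ) : ℂ) := by
    have hcomm : ∀ F : Fin m → Fin m → Fin m → ℂ,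
        ∑ i, ∑ j, ∑ k, F i j k = ∑ k, ∑ i, ∑ j, F i j k := fun F =>
      (Finset.sum_congr rfl fun i _ => Finset.sum_comm).trans Finset.sum_comm
    rw [hcomm, Complex.ofReal_sum, Finset.mul_sum, Finset.mul_sum, ← Finset.sum_add_distrib]
    refine Finset.sum_congr rfl fun k _ => ?_
    simp only [c.prodBilin_apply, lineDerivOp_apply_eq_fderiv, fderiv_coordMul, coordMul_apply,
      Complex.real_smul, Complex.ofReal_sum, Finset.mul_sum, Finset.sum_mul,
      ← Finset.sum_add_distrib]
    refine Finset.sum_congr rfl fun i _ => Finset.sum_congr rfl fun j _ => ?_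
    push_cast
    ring
  have hA : ∑ i, ∑ j, (c.anchorCoeff i j u : ℂ) * (coordMul i (c.fibreMap hf hu) y *
      c.fibreDeriv hg hu (stdVec j, 0, 0) z) = c.fibreMap hf hu y *
      ∑ i, ∑ j, (y i * c.anchorCoeff i j u : ℝ) • c.fibreDeriv hg hu (stdVec j, 0, 0) z := by
    simp only [Finset.mul_sum, coordMul_apply, Complex.real_smul]
    refine Finset.sum_congr rfl fun i _ => Finset.sum_congr rfl fun j _ => ?_
    push_cast
    ring
  have hE : ∑ i, ∑ j, ((c.anchorCoeff i j u * fderiv ℝ (μ.coeff c) u (stdVec j) : ℝ) : ℂ) *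
      (coordMul i (c.fibreMap hf hu) y * c.fibreMap hg hu z) =
      c.fibreMap hf hu y * c.fibreMap hg hu z *
      ((∑ i, ∑ j, y i * c.anchorCoeff i j u * fderiv ℝ (μ.coeff c) u (stdVec j) : ℝ) : ℂ) := by
    simp only [Complex.ofReal_sum, Finset.mul_sum, coordMul_apply]
    refine Finset.sum_congr rfl fun i _ => Finset.sum_congr rfl fun j _ => ?_
    push_cast
    ring
  rw [hS, hA, hE, Complex.ofReal_add, Complex.ofReal_mul, Complex.ofReal_neg]
  ring

theorem convDeriv_eq (hf : IsSmoothCompactlySupported f)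
    (hg : IsSmoothCompactlySupported g) {u : Eu n} (hu : u ∈ c.φ.source) (x : Eu m) :
    c.convDeriv μ f g u x = c.convDerivMap μ hf hg hu x :=
  (c.isIntegralOf_convDerivMap μ hf hg hu).integral_eq x

end AdaptedChart

/-! ### The Fourier transform of the derivative -/

namespace AdaptedChart

open SchwartzMap FourierTransform LineDeriv

variable (c : Γ.AdaptedChart) (μ : Γ.SmoothDensity)
variable {f g : Γ.TangentGroupoid → ℂ}

theorem dualPoint_apply {u : Eu n} (hu : u ∈ c.φ.source) (η y : Eu m) :
    (c.dualPoint u η).2 (∑ i, y i • c.frame u i) = inner ℝ y η := by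
  have h1 : (c.dualPoint u η).2 (∑ i, y i • c.frame u i) =
      ∑ k, η k * (c.algCoord (c.φ u) (∑ i, y i • c.frame u i)) k := by
    change (∑ k, η k • ((EuclideanSpace.proj (𝕜 := ℝ) k).toLinearMap ∘ₗ
      c.algCoord (c.φ u))) (∑ i, y i • c.frame u i) = _
    rw [LinearMap.sum_apply]
    rfl
  rw [h1, c.algCoord_sum_frame hu]
  simp [PiLp.inner_apply]

/-- The Fourier transform of a function on the Lie algebroid, in the coordinates `(u, η)`. -/
theorem fourier_dualPoint_eq_integral {u : Eu n} (hu : u ∈ c.φ.source) (h : Γ.Algebroid → ℂ)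
    (η : Eu m) : fourier μ h (c.dualPoint u η) = (μ.coeff c u : ℂ) *
      ∫ y : Eu m, Complex.exp (2 * Real.pi * Complex.I * (inner ℝ y η : ℝ)) * h (c.θ u y) := by
  change μ.fibreIntegral (c.φ u) (fun Y => Complex.exp (2 * Real.pi * Complex.I *
    ((c.dualPoint u η).2 Y : ℂ)) * h ⟨c.φ u, Y⟩) = _
  rw [μ.fibreIntegral_eq (c.frameBasis hu), c.coe_frameBasis hu]
  congr 1
  refine integral_congr_ae (Filter.Eventually.of_forall fun y => ?_)
  beta_reduce
  rw [comb_apply]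
  exact congrArg (fun r : ℝ => Complex.exp (2 * Real.pi * Complex.I * (r : ℂ)) * h (c.θ u y))
    (c.dualPoint_apply hu η y)

variable [T2Space G]

theorem fourier_dualPoint (hf : IsSmoothCompactlySupported f) {u : Eu n} (hu : u ∈ c.φ.source)
    (η : Eu m) : fourier μ (restrictZero f) (c.dualPoint u η) =
      (μ.coeff c u : ℂ) * fourierAt η (c.fibreMap hf hu) := by
  rw [c.fourier_dualPoint_eq_integral μ hu, fourierAt_eq_integral]
  simp only [fibreMap_apply, pull_zero, restrictZero]

theorem fderiv_fourier_dualPoint (hf : IsSmoothCompactlySupported f) {u : Eu n}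
    (hu : u ∈ c.φ.source) (η : Eu m) (i : Fin m) :
    fderiv ℝ (fun η' : Eu m => fourier μ (restrictZero f) (c.dualPoint u η')) η (stdVec i) =
      (μ.coeff c u : ℂ) * (2 * Real.pi * Complex.I * fourierAt η (coordMul i (c.fibreMap hf hu))) := by
  simp only [c.fourier_dualPoint μ hf hu]
  rw [fderiv_const_mul (differentiableAt_fourierAt η _), ← fderiv_fourierAt]
  rfl

/-- Differentiation under the integral sign in the Fourier transform. -/
theorem hasFDerivAt_fourierAt_fibreMap (hf : IsSmoothCompactlySupported f) {u : Eu n}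
    (hu : u ∈ c.φ.source) (η : Eu m) : ∃ L : Eu n →L[ℝ] ℂ,
      (∀ a, L a = fourierAt η (c.fibreDeriv hf hu (a, 0, 0))) ∧
      HasFDerivAt (fun u' => ∫ y : Eu m,
        Complex.exp (2 * Real.pi * Complex.I * (inner ℝ y η : ℝ)) * c.pull f (u', y, 0)) L u := by
  obtain ⟨δ, hδ, R, hball, hzero⟩ := c.exists_pull_eq_zero hf hu
  obtain ⟨R', hR'⟩ := c.exists_pull_eventuallyEq_zero hf hu
  let B := Metric.closedBall (0 : Eu m) (max R R')
  have hB : IsCompact B := isCompact_closedBall _ _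
  let e : Eu m → ℂ := fun y => Complex.exp (2 * Real.pi * Complex.I * (inner ℝ y η : ℝ))
  have he : ContDiff ℝ 1 e := by
    have h1 : ContDiff ℝ 1 fun y : Eu m => ((inner ℝ y η : ℝ) : ℂ) :=
      Complex.ofRealCLM.contDiff.comp (contDiff_id.inner ℝ contDiff_const)
    exact (contDiff_const.mul h1).cexp
  let Φ : Eu n × Eu m → ℂ := fun q => e q.2 * c.pull f (q.1, q.2, 0)
  let Ω : Set (Eu n × Eu m) := c.φ.source ×ˢ Set.univ
  have hΩ : IsOpen Ω := c.φ.open_source.prod isOpen_univ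
  have hΦ : ContDiffOn ℝ 1 Φ Ω :=
    (he.comp contDiff_snd).contDiffOn.mul (((hf.smooth_chart c).of_le (by simp)).comp
      (f := fun q : Eu n × Eu m => ((q.1, q.2, 0) : Eu n × Eu m × ℝ)) (by fun_prop)
      (fun q hq => c.mem_tangentDomain_zero hq.1 q.2))
  have hmem : ∀ y ∈ B, (u, y) ∈ Ω := fun y _ => ⟨hu, trivial⟩
  have hL := hasFDerivAt_setIntegral_of_contDiffOn hΩ hB hΦ hmem volume
  refine ⟨_, fun a => ?_, hL.congr_of_eventuallyEq ?_⟩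
  · have hcont : ContinuousOn (fun y => (fderiv ℝ Φ (u, y)).comp
        (ContinuousLinearMap.inl ℝ (Eu n) (Eu m))) B :=
      ((hΦ.continuousOn_fderiv_of_isOpen hΩ le_rfl).comp (by fun_prop) hmem).clm_comp
        continuousOn_const
    have hI : ∫ y in B, e y * c.fibreDeriv hf hu (a, 0, 0) y =
        fourierAt η (c.fibreDeriv hf hu (a, 0, 0)) := by
      rw [fourierAt_eq_integral]
      refine setIntegral_eq_integral_of_forall_compl_eq_zero fun y hy => ?_
      rw [fibreDeriv_apply, (hR' y (lt_of_le_of_lt (le_max_right R R') (by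
        simpa [B] using hy))).fderiv_eq]
      simp
    rw [ContinuousLinearMap.integral_apply (hcont.integrableOn_compact hB), ← hI]
    refine setIntegral_congr_fun Metric.isClosed_closedBall.measurableSet fun y hy => ?_
    have hι : HasFDerivAt (fun u' : Eu n => ((u', y) : Eu n × Eu m))
        (ContinuousLinearMap.inl ℝ (Eu n) (Eu m)) u := hasFDerivAt_prodMk_left u y
    have h1 : HasFDerivAt Φ (fderiv ℝ Φ (u, y)) (u, y) :=
      ((hΦ.contDiffAt (hΩ.mem_nhds (hmem y hy))).differentiableAt (by simp)).hasFDerivAt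
    have h2 := HasFDerivAt.comp (f := fun u' : Eu n => ((u', y) : Eu n × Eu m)) u h1 hι
    have hκ : HasFDerivAt (fun u' : Eu n => ((u', y, 0) : Eu n × Eu m × ℝ))
        (ContinuousLinearMap.inl ℝ (Eu n) (Eu m × ℝ)) u := hasFDerivAt_prodMk_left u (y, 0)
    have h3 := HasFDerivAt.comp (f := fun u' : Eu n => ((u', y, 0) : Eu n × Eu m × ℝ)) u
      (c.hasFDerivAt_pull hf (c.mem_tangentDomain_zero hu y)) hκ
    exact congrArg (fun T : Eu n →L[ℝ] ℂ => T a) (h2.unique (h3.const_mul (e y)))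
  · filter_upwards [Metric.ball_mem_nhds u hδ] with u' hu'
    refine (setIntegral_eq_integral_of_forall_compl_eq_zero fun y hy => ?_).symm
    have h1 : c.pull f (u', y, 0) = 0 :=
      hzero u' hu' y 0 (by simpa using hδ) (c.mem_tangentDomain_zero (hball hu') y) (by
        have h2 : max R R' < ‖y‖ := by simpa [B] using hy
        exact ((le_max_left R R').trans h2.le))
    simp [h1]

theorem fderiv_fourier_base (hf : IsSmoothCompactlySupported f) {u : Eu n}
    (hu : u ∈ c.φ.source) (η : Eu m) (j : Fin n) :
    fderiv ℝ (fun u' : Eu n => fourier μ (restrictZero f) (c.dualPoint u' η)) u (stdVec j) =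
      (fderiv ℝ (μ.coeff c) u (stdVec j) : ℂ) * fourierAt η (c.fibreMap hf hu) +
      (μ.coeff c u : ℂ) * fourierAt η (c.fibreDeriv hf hu (stdVec j, 0, 0)) := by
  obtain ⟨L, hL, hLf⟩ := c.hasFDerivAt_fourierAt_fibreMap hf hu η
  have hρ : HasFDerivAt (μ.coeff c) (fderiv ℝ (μ.coeff c) u) u :=
    (((c.contDiffOn_coeff μ).contDiffAt (c.φ.open_source.mem_nhds hu)).differentiableAt
      (by simp)).hasFDerivAt
  have hρ' : HasFDerivAt (fun u' => (μ.coeff c u' : ℂ))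
      (Complex.ofRealCLM.comp (fderiv ℝ (μ.coeff c) u)) u :=
    Complex.ofRealCLM.hasFDerivAt.comp u hρ
  have h1 := hρ'.mul hLf
  have h2 : (fun u' : Eu n => fourier μ (restrictZero f) (c.dualPoint u' η)) =ᶠ[𝓝 u]
      fun u' => (μ.coeff c u' : ℂ) * ∫ y : Eu m,
        Complex.exp (2 * Real.pi * Complex.I * (inner ℝ y η : ℝ)) * c.pull f (u', y, 0) := by
    filter_upwards [c.φ.open_source.mem_nhds hu] with u' hu'
    rw [c.fourier_dualPoint_eq_integral μ hu']
    simp only [pull_zero, restrictZero]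
  rw [(h1.congr_of_eventuallyEq h2).fderiv]
  have h3 : ∫ y : Eu m, Complex.exp (2 * Real.pi * Complex.I * (inner ℝ y η : ℝ)) *
      c.pull f (u, y, 0) = fourierAt η (c.fibreMap hf hu) := by
    rw [fourierAt_eq_integral]; rfl
  simp only [_root_.add_apply, _root_.smul_apply, hL, h3, smul_eq_mul]
  simp
  ring

theorem fourierAt_convDerivMap (hf : IsSmoothCompactlySupported f)
    (hg : IsSmoothCompactlySupported g) {u : Eu n} (hu : u ∈ c.φ.source) (η : Eu m) :
    fourierAt η (c.convDerivMap μ hf hg hu) =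
      (μ.coeff c u : ℂ) * (fourierAt η (c.fibreDeriv hf hu (0, 0, 1)) *
          fourierAt η (c.fibreMap hg hu) +
        fourierAt η (c.fibreMap hf hu) * fourierAt η (c.fibreDeriv hg hu (0, 0, 1)) +
        (∑ i, ∑ j, (c.anchorCoeff i j u : ℂ) * (fourierAt η (coordMul i (c.fibreMap hf hu)) *
          fourierAt η (c.fibreDeriv hg hu (stdVec j, 0, 0)))) +
        2 * Real.pi * Complex.I * ∑ i, ∑ j, ∑ k, (c.prodCoeff u i j k : ℂ) * (η k : ℂ) *
          (fourierAt η (coordMul i (c.fibreMap hf hu)) *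
            fourierAt η (coordMul j (c.fibreMap hg hu)))) +
      ∑ i, ∑ j, (c.anchorCoeff i j u : ℂ) * (fderiv ℝ (μ.coeff c) u (stdVec j) : ℂ) *
        (fourierAt η (coordMul i (c.fibreMap hf hu)) * fourierAt η (c.fibreMap hg hu)) := by
  simp only [convDerivMap, map_add, map_sub, map_smul, map_sum, fourierAt_schwartzConv,
    fourierAt_lineDeriv, smul_eq_mul, Complex.ofReal_mul]
  congr 2
  rw [sub_eq_add_neg]
  congr 1
  simp only [Finset.mul_sum, ← Finset.sum_neg_distrib]
  refine Finset.sum_congr rfl fun i _ => Finset.sum_congr rfl fun j _ =>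
    Finset.sum_congr rfl fun k _ => ?_
  ring

/-- In the chart, the Poisson bracket of the Fourier transforms is, up to the factor `2πi`, the
Fourier transform of the `t`-derivative of the commutator. -/
theorem localPoisson_fourier [IsManifold 𝓘(ℝ, Eu (n + m)) ∞ G]
    (hf : IsSmoothCompactlySupported f)
    (hg : IsSmoothCompactlySupported g) {u : Eu n} (hu : u ∈ c.φ.source) (η : Eu m) :
    c.localPoisson (fourier μ (restrictZero f)) (fourier μ (restrictZero g)) u η =
      2 * Real.pi * Complex.I * ((μ.coeff c u : ℂ) *
        fourierAt η (c.convDerivMap μ hf hg hu - c.convDerivMap μ hg hf hu)) := by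
  rw [map_sub, c.fourierAt_convDerivMap μ hf hg hu, c.fourierAt_convDerivMap μ hg hf hu]
  simp only [localPoisson, c.fderiv_fourier_dualPoint μ hf hu, c.fderiv_fourier_dualPoint μ hg hu,
    c.fderiv_fourier_base μ hf hu, c.fderiv_fourier_base μ hg hu]
  set F := fun i => fourierAt η (coordMul i (c.fibreMap hf hu))
  set K := fun i => fourierAt η (coordMul i (c.fibreMap hg hu))
  set ρ : ℂ := (μ.coeff c u : ℂ)
  -- The terms with the bracket: exchanging `f` and `g` exchanges `i` and `j` in `B_ijk`.
  have hbr : ∑ i, ∑ j, ∑ k, (c.bracketCoeff i j k u : ℂ) * (η k : ℂ) *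
      (ρ * (2 * Real.pi * Complex.I * F i) * (ρ * (2 * Real.pi * Complex.I * K j))) =
      2 * Real.pi * Complex.I * (ρ * (ρ * (2 * Real.pi * Complex.I *
        (∑ i, ∑ j, ∑ k, (c.prodCoeff u i j k : ℂ) * (η k : ℂ) * (F i * K j)) -
        2 * Real.pi * Complex.I *
        (∑ i, ∑ j, ∑ k, (c.prodCoeff u i j k : ℂ) * (η k : ℂ) * (K i * F j))))) := by
    have hswap : ∑ i, ∑ j, ∑ k, (c.prodCoeff u i j k : ℂ) * (η k : ℂ) * (K i * F j) =
        ∑ i, ∑ j, ∑ k, (c.prodCoeff u j i k : ℂ) * (η k : ℂ) * (K j * F i) := Finset.sum_comm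
    rw [hswap]
    simp only [Finset.mul_sum, ← Finset.sum_sub_distrib]
    refine Finset.sum_congr rfl fun i _ => Finset.sum_congr rfl fun j _ =>
      Finset.sum_congr rfl fun k _ => ?_
    rw [c.bracketCoeff_eq hu, prodCoeff, prodCoeff]
    push_cast
    ring
  -- The terms with the anchor; the derivatives of `ρ` in the Fourier transform are matched by those
  -- in the derivative of the Haar coefficient.
  have han : ∑ i, ∑ j, (c.anchorCoeff i j u : ℂ) *
      (ρ * (2 * Real.pi * Complex.I * F i) *
          ((fderiv ℝ (μ.coeff c) u (stdVec j) : ℂ) * fourierAt η (c.fibreMap hg hu) +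
            ρ * fourierAt η (c.fibreDeriv hg hu (stdVec j, 0, 0))) -
        ρ * (2 * Real.pi * Complex.I * K i) *
          ((fderiv ℝ (μ.coeff c) u (stdVec j) : ℂ) * fourierAt η (c.fibreMap hf hu) +
            ρ * fourierAt η (c.fibreDeriv hf hu (stdVec j, 0, 0)))) =
      2 * Real.pi * Complex.I * (ρ * (ρ * ((∑ i, ∑ j, (c.anchorCoeff i j u : ℂ) *
          (F i * fourierAt η (c.fibreDeriv hg hu (stdVec j, 0, 0)))) -
        ∑ i, ∑ j, (c.anchorCoeff i j u : ℂ) *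
          (K i * fourierAt η (c.fibreDeriv hf hu (stdVec j, 0, 0)))) +
        ((∑ i, ∑ j, (c.anchorCoeff i j u : ℂ) * (fderiv ℝ (μ.coeff c) u (stdVec j) : ℂ) *
          (F i * fourierAt η (c.fibreMap hg hu))) -
        ∑ i, ∑ j, (c.anchorCoeff i j u : ℂ) * (fderiv ℝ (μ.coeff c) u (stdVec j) : ℂ) *
          (K i * fourierAt η (c.fibreMap hf hu))))) := by
    simp only [Finset.mul_sum, ← Finset.sum_sub_distrib, ← Finset.sum_add_distrib]
    refine Finset.sum_congr rfl fun i _ => Finset.sum_congr rfl fun j _ => ?_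
    ring
  -- The terms with `∂ₜf` and `∂ₜg` are symmetric in `f` and `g` and cancel.
  rw [hbr, han]
  ring

end AdaptedChart

/-! ### The Poisson bracket and the commutator -/

open SchwartzMap FourierTransform

variable (μ : Γ.SmoothDensity) {f g : Γ.TangentGroupoid → ℂ}

/-- Fourier inversion on a fibre of the Lie algebroid. -/
theorem fourierInv_fourier {x : M} {k : Γ.Algebroid → ℂ} {S : 𝓢(Eu m, ℂ)}
    (hS : ∀ v, S v = k ⟨x, comb (Γ.algBasis x) v⟩) (a : ℂ) (w : Γ.Alg x) :
    fourierInv μ (fun α => a * fourier μ k α) ⟨x, w⟩ = a * k ⟨x, w⟩ := by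
  let b := Γ.algBasis x
  obtain ⟨v, rfl⟩ : ∃ v, comb b v = w := ⟨(combEquiv b).symm w, by
    rw [← combEquiv_apply, LinearEquiv.apply_symm_apply]⟩
  have hμ : (μ.toFun x b : ℂ) ≠ 0 := by
    exact_mod_cast (μ.pos x b b.linearIndependent).ne'
  have hdual : ∀ η y : Eu m, (∑ i, η i • b.coord i) (comb b y) = inner ℝ η y := by
    intro η y
    rw [comb_apply, LinearMap.sum_apply]
    simp [PiLp.inner_apply, Finsupp.single_apply, mul_comm]
  have hF : ∀ η : Eu m, fourier μ k ⟨x, ∑ i, η i • b.coord i⟩ =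
      (μ.toFun x b : ℂ) * fourierAt η S := by
    intro η
    change μ.fibreIntegral x (fun Y => Complex.exp (2 * Real.pi * Complex.I *
      ((∑ i, η i • b.coord i) Y : ℂ)) * k ⟨x, Y⟩) = _
    rw [μ.fibreIntegral_eq b, fourierAt_eq_integral]
    simp only [hdual, hS, real_inner_comm η]
    rfl
  change (μ.toFun x b : ℂ)⁻¹ * ∫ η : Eu m, Complex.exp (-(2 * Real.pi * Complex.I *
    ((∑ i, η i • b.coord i) (comb b v) : ℂ))) * (a * fourier μ k ⟨x, ∑ i, η i • b.coord i⟩) = _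
  simp only [hdual, hF]
  have h1 : ∀ η : Eu m, Complex.exp (-(2 * Real.pi * Complex.I * (inner ℝ η v : ℝ))) *
      (a * ((μ.toFun x b : ℂ) * fourierAt η S)) = (a * (μ.toFun x b : ℂ)) *
      (Complex.exp (-(2 * Real.pi * Complex.I * (inner ℝ η v : ℝ))) * 𝓕⁻ S η) := by
    intro η
    rw [fourierAt_apply]
    ring
  simp only [h1]
  rw [integral_const_mul, integral_exp_fourierInv, hS]
  field_simp
  rfl

namespace AdaptedChart

theorem θ_algCoord (c : Γ.AdaptedChart) {u : Eu n} (hu : u ∈ c.φ.source) (w : Γ.Alg (c.φ u)) :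
    c.θ u (c.algCoord (c.φ u) w) = ⟨c.φ u, w⟩ :=
  congrArg (Sigma.mk (c.φ u)) (c.sum_frame_algCoord hu w)

end AdaptedChart

variable [IsManifold 𝓘(ℝ, Eu (n + m)) ∞ G] [IsManifold 𝓘(ℝ, Eu n) ∞ M]

/-- Every point of the Lie algebroid lies in the image of a chart. -/
theorem exists_θ_eq (X : Γ.Algebroid) :
    ∃ q : Γ.AdaptedChart × Eu n × Eu m, q.2.1 ∈ q.1.φ.source ∧ q.1.θ q.2.1 q.2.2 = X := by
  obtain ⟨x, w⟩ := X
  obtain ⟨c, hc⟩ := Γ.exists_adaptedChart x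
  obtain ⟨u, hu, rfl⟩ : ∃ u ∈ c.φ.source, c.φ u = x :=
    ⟨c.φ.symm x, c.φ.map_target hc, c.φ.right_inv hc⟩
  exact ⟨(c, u, c.algCoord (c.φ u) w), hu, c.θ_algCoord hu w⟩

variable [T2Space G] [MeasurableSpace G] [BorelSpace G]

/-- The `t`-derivative at `t = 0` of the commutator, computed in some chart around each point. -/
def timeDeriv (f g : Γ.TangentGroupoid → ℂ) (X : Γ.Algebroid) : ℂ :=
  let q := (exists_θ_eq X).choose
  q.1.convDeriv μ f g q.2.1 q.2.2 - q.1.convDeriv μ g f q.2.1 q.2.2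

/-- The differential determines the `t`-derivative, so every chart gives the same value. -/
theorem timeDeriv_θ (hf : IsSmoothCompactlySupported f) (hg : IsSmoothCompactlySupported g)
    (c : Γ.AdaptedChart) {u : Eu n} (hu : u ∈ c.φ.source) (v : Eu m) :
    timeDeriv μ f g (c.θ u v) = c.convDeriv μ f g u v - c.convDeriv μ g f u v := by
  obtain ⟨h1, h2⟩ := (exists_θ_eq (c.θ u v)).choose_spec
  exact AdaptedChart.eq_of_hasFDerivAt_smul_dt _ c h1 hu h2
    (AdaptedChart.hasFDerivAt_commutator _ μ hf hg h1 _) (c.hasFDerivAt_commutator μ hf hg hu v)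

theorem hasTimeDerivAtZero_commutator (hf : IsSmoothCompactlySupported f)
    (hg : IsSmoothCompactlySupported g) :
    HasTimeDerivAtZero (commutator μ f g) (timeDeriv μ f g) := by
  intro c u v hu
  rw [timeDeriv_θ μ hf hg c hu]
  exact c.hasFDerivAt_commutator μ hf hg hu v

theorem timeDeriv_θ_eq (hf : IsSmoothCompactlySupported f) (hg : IsSmoothCompactlySupported g)
    (c : Γ.AdaptedChart) {u : Eu n} (hu : u ∈ c.φ.source) (v : Eu m) :
    timeDeriv μ f g (c.θ u v) =
      (c.convDerivMap μ hf hg hu - c.convDerivMap μ hg hf hu) v := by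
  rw [timeDeriv_θ μ hf hg c hu, c.convDeriv_eq μ hf hg hu, c.convDeriv_eq μ hg hf hu]
  rfl

theorem poisson_fourier (hf : IsSmoothCompactlySupported f) (hg : IsSmoothCompactlySupported g)
    (α : Γ.DualAlgebroid) :
    poisson (fourier μ (restrictZero f)) (fourier μ (restrictZero g)) α =
      2 * Real.pi * Complex.I * fourier μ (timeDeriv μ f g) α := by
  obtain ⟨h1, h2⟩ := (exists_dualPoint α).choose_spec
  rw [poisson, AdaptedChart.localPoisson_fourier _ μ hf hg h1]
  conv_rhs => rw [← h2, AdaptedChart.fourier_dualPoint_eq_integral _ μ h1]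
  rw [fourierAt_eq_integral]
  simp only [timeDeriv_θ_eq μ hf hg _ h1]

/-- The Fourier transform of `timeDeriv` determines it, by Fourier inversion. The basis of the fibre
used for the inversion need not be the frame of the chart, and `R` is the change of basis. -/
theorem schwartzPoisson_restrictZero (hf : IsSmoothCompactlySupported f)
    (hg : IsSmoothCompactlySupported g) (X : Γ.Algebroid) :
    schwartzPoisson μ (restrictZero f) (restrictZero g) X =
      2 * Real.pi * Complex.I * timeDeriv μ f g X := by
  obtain ⟨x, w⟩ := X
  obtain ⟨c, hc⟩ := Γ.exists_adaptedChart x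
  obtain ⟨u, hu, rfl⟩ : ∃ u ∈ c.φ.source, c.φ u = x :=
    ⟨c.φ.symm x, c.φ.map_target hc, c.φ.right_inv hc⟩
  let b := Γ.algBasis (c.φ u)
  let R : Eu m ≃L[ℝ] Eu m :=
    ((combEquiv b).trans (combEquiv (c.frameBasis hu)).symm).toContinuousLinearEquiv
  have hR : ∀ v, c.θ u (R v) = ⟨c.φ u, comb b v⟩ := by
    intro v
    refine congrArg (Sigma.mk (c.φ u)) ?_
    have h1 : combEquiv (c.frameBasis hu) (R v) = combEquiv b v :=
      (combEquiv (c.frameBasis hu)).apply_symm_apply _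
    rw [combEquiv_apply, combEquiv_apply, comb_apply, c.coe_frameBasis hu] at h1
    exact h1
  rw [schwartzPoisson, show poisson _ _ = _ from funext (poisson_fourier μ hf hg)]
  refine fourierInv_fourier μ (S := compCLMOfContinuousLinearEquiv ℂ R
    (c.convDerivMap μ hf hg hu - c.convDerivMap μ hg hf hu)) (fun v => ?_) _ w
  rw [← hR, timeDeriv_θ_eq μ hf hg c hu]
  rfl

end LieGroupoid

end

theorem mainTheorem5 {n m : ℕ} {G M : Type*}
    [TopologicalSpace G] [T2Space G] [SecondCountableTopology G]
    [ChartedSpace (Eu (n + m)) G] [IsManifold 𝓘(ℝ, Eu (n + m)) ∞ G]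
    [MeasurableSpace G] [BorelSpace G]
    [TopologicalSpace M] [ChartedSpace (Eu n) M] [IsManifold 𝓘(ℝ, Eu n) ∞ M]
    (Γ : LieGroupoid n m G M) (μ : Γ.SmoothDensity) (f g : Γ.TangentGroupoid → ℂ)
    (hf : LieGroupoid.IsSmoothCompactlySupported f)
    (hg : LieGroupoid.IsSmoothCompactlySupported g) :
    LieGroupoid.HasTimeDerivAtZero (LieGroupoid.commutator μ f g)
      (fun X => 1 / (2 * Real.pi * Complex.I) *
        LieGroupoid.schwartzPoisson μ (LieGroupoid.restrictZero f)
          (LieGroupoid.restrictZero g) X) := by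
  have h : (fun X => 1 / (2 * Real.pi * Complex.I) *
      LieGroupoid.schwartzPoisson μ (LieGroupoid.restrictZero f)
        (LieGroupoid.restrictZero g) X) = LieGroupoid.timeDeriv μ f g := by
    funext X
    rw [LieGroupoid.schwartzPoisson_restrictZero μ hf hg X, one_div,
      inv_mul_cancel_left₀ Complex.two_pi_I_ne_zero]
  rw [h]
  exact LieGroupoid.hasTimeDerivAtZero_commutator μ hf hg
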